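/- We consider functions $f:\{0,1\}^+\to\mathbb N$ on nonempty binary words (all structures have a nonempty universe $\{0,\dots,n-1\}$). \emph{Circuits.} A Boolean circuit with $n$ inputs is a finite directed acyclic graph with an output gate (root) whose gates with at least one child are marked $\wedge$ or $\vee$ (unbounded fan-in) and whose leaves are marked with a constant $0,1$ or with a possibly negated input bit. A proof tree of the circuit on input $w$ is a subtree of its tree unfolding, containing the root, that contains all children of each of its $\wedge$-nodes and exactly one child of each of its $\vee$-nodes, and all of whose leaves are true on $w$. With an input $w$, a circuit is a structure over the vocabulary $(E^2,G_\wedge^1,G_\vee^1,B^1,r^1)$: $E(x,y)$ says that $y$ is a child of $x$, $G_\wedge,G_\vee$ mark the $\wedge$- and $\vee$-gates, $B$ the true leaves and $r$ the root. A family $(C_n)_n$ is FO-uniform if there is a first-order interpretation (with universe a definable set of $k$-tuples, for a fixed $k$) over the vocabulary $(\le,S,\mathrm{BIT})$ that maps, for each nonempty word $w$, the structure $\mathcal A_w$ (universe $\{0,\dots,|w|-1\}$, $S(i)$ iff the $i$-th bit of $w$ is $1$, standard $\le$ and $\mathrm{BIT}$) to the circuit $C_{|w|}$ with input $w$, where the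 tuples that name the gates of $C_{|w|}$ depend only on $|w|$. The class FO-uniform $\#\mathrm{AC}^0$ consists of all $f$ for which there is an FO-uniform family $(C_n)_n$ of polynomial size and constant depth such that $f(w)$ is the number of proof trees of $C_{|w|}$ on $w$, for all $w$. \emph{Logic.} A vocabulary $\sigma$ consists of finitely many relation symbols, at least one of them of positive arity, and finitely many constant symbols, together with the built-in symbols $\le$, $\mathrm{BIT}$, $\min$ with their standard interpretation. The encoding $\mathrm{enc}_\sigma(\mathcal A)\in\{0,1\}^+$ of a $\sigma$-structure $\mathcal A$ with universe $\{0,\dots,n-1\}$, $n\ge 1$, is the concatenation of the truth tables of its relations (in lexicographic order of the tuples) and of the values of its constants in binary with $\lceil\log_2 n\rceil$ digits; built-in symbols are not encoded. The class $\#\Pi_1^{\mathrm{prefix}}$ consists of all $g$ for which there are a vocabulary $\sigma$ and a formula $$\varphi(\overline F,\overline x)=\forall y_1\cdots\forall y_k\ \psi(\overline F,\overline x,y_1,\dots,y_k)$$ over $\sigma$ with free function variables $\overline F$ and free individual variables $\overline x$, where $\psi$ is quantifier-free and each function variable $F$ of arity $a$ (for any $a\ge 0$) occurs in $\psi$ only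 in the form $F(y_1,\dots,y_a)$, such that $$g(\mathrm{enc}_\sigma(\mathcal A))=\bigl|\{(\overline f,\overline c)\mid \mathcal A\models\varphi(\overline f,\overline c)\}\bigr|$$ for all $\sigma$-structures $\mathcal A$, and $g(w)=0$ for every $w$ that is not the encoding of a $\sigma$-structure. \textbf{Lemma.} $\text{FO-uniform }\#\mathrm{AC}^0=\#\Pi_1^{\mathrm{prefix}}$. -/

import Mathlib

namespace CountFO

/-! ### Words and structures -/

/-- Nonempty binary words. -/
abbrev Word : Type := {w : List Bool // w ≠ []}

/-- A finite vocabulary of relation and constant symbols. The built-in symbols `≤`, `BIT`, `min`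
are not listed here; they are always present in the language of the vocabulary. -/
structure Vocabulary where
  rels : ℕ
  arity : Fin rels → ℕ
  consts : ℕ

/-- A structure over the vocabulary `σ` with universe `{0, …, n - 1}`. -/
structure Vocabulary.Struc (σ : Vocabulary) (n : ℕ) where
  rel : (i : Fin σ.rels) → (Fin (σ.arity i) → Fin n) → Bool
  const : Fin σ.consts → Fin n

/-- All `a`-tuples over `{0, …, n - 1}`, in lexicographic order. -/
def tuples (n : ℕ) : (a : ℕ) → List (Fin a → Fin n)
  | 0 => [Fin.elim0]
  | a + 1 => (List.finRange n).flatMap fun x => (tuples n a).map fun t => Fin.cons x t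

/-- The binary representation of `v` with exactly `len` digits, most significant digit first. -/
def binary (len v : ℕ) : List Bool :=
  ((List.range len).map fun i => v.testBit i).reverse

/-- The standard binary encoding of a structure: the truth tables of the relations, row by row,
followed by the values of the constants, each written with `⌈log₂ n⌉` digits. Built-in symbols are
not encoded. -/
def Vocabulary.Struc.enc {σ : Vocabulary} {n : ℕ} (A : σ.Struc n) : List Bool :=
  ((List.finRange σ.rels).flatMap fun i => (tuples n (σ.arity i)).map (A.rel i)) ++
    (List.finRange σ.consts).flatMap fun j => binary (Nat.clog 2 n) (A.const j)

/-! ### Formulae over a vocabulary with free function variables -/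

/-- Function symbols: the built-in constant `min`, the constants of `σ`, and function variables
`F_i` of arity `ar i`. -/
inductive Vocabulary.Func (σ : Vocabulary) {m : ℕ} (ar : Fin m → ℕ) : ℕ → Type
  | min : Vocabulary.Func σ ar 0
  | const (j : Fin σ.consts) : Vocabulary.Func σ ar 0
  | funVar (i : Fin m) : Vocabulary.Func σ ar (ar i)

/-- Relation symbols: the built-in `≤` and `BIT`, and the relation symbols of `σ`. -/
inductive Vocabulary.Rel (σ : Vocabulary) : ℕ → Type
  | le : Vocabulary.Rel σ 2
  | bit : Vocabulary.Rel σ 2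
  | rel (i : Fin σ.rels) : Vocabulary.Rel σ (σ.arity i)

/-- The first-order language of `σ` with `≤`, `BIT`, `min`, together with function variables
`F_i` of arity `ar i`. -/
def Vocabulary.lang (σ : Vocabulary) {m : ℕ} (ar : Fin m → ℕ) : FirstOrder.Language.{0, 0} where
  Functions := σ.Func ar
  Relations := σ.Rel

/-- The structure `A` with its built-in symbols, the function variables being interpreted by the
functions `F i`. `BIT(i, j)` says that the `i`-th binary digit of `j` is `1`. -/
@[reducible]
def Vocabulary.Struc.expand {σ : Vocabulary} {n : ℕ} [NeZero n] (A : σ.Struc n) {m : ℕ}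
    {ar : Fin m → ℕ} (F : (i : Fin m) → (Fin (ar i) → Fin n) → Fin n) :
    (σ.lang ar).Structure (Fin n) where
  funMap := fun {_} f => match f with
    | .min => fun _ => 0
    | .const j => fun _ => A.const j
    | .funVar i => F i
  RelMap := fun {_} R => match R with
    | .le => fun x => x 0 ≤ x 1
    | .bit => fun x => (x 1 : ℕ).testBit (x 0 : ℕ) = true
    | .rel i => fun x => A.rel i x = true

/-- A condition on the application of a symbol to arguments: if the symbol is a function variable of
arity `a`, then the arguments are the first `a` bound (i.e. quantified) variables `y₁, …, y_a`. -/
def ArgsRestricted {σ : Vocabulary} {m : ℕ} {ar : Fin m → ℕ} {l k : ℕ} :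
    {a : ℕ} → σ.Func ar a → (Fin a → (σ.lang ar).Term (Fin l ⊕ Fin k)) → Prop
  | _, .min, _ => True
  | _, .const _, _ => True
  | _, .funVar i, ts => ∀ j : Fin (ar i), ∃ hj : (j : ℕ) < k, ts j = .var (Sum.inr ⟨j, hj⟩)

/-- In the term every function variable of arity `a` is applied only to the tuple of the first `a`
bound variables `y₁, …, y_a`. -/
def TermRestricted {σ : Vocabulary} {m : ℕ} {ar : Fin m → ℕ} {l k : ℕ} :
    (σ.lang ar).Term (Fin l ⊕ Fin k) → Prop
  | .var _ => True
  | .func f ts => ArgsRestricted f ts ∧ ∀ j, TermRestricted (ts j)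

/-- In the formula every function variable of arity `a` is applied only to the tuple of the first
`a` bound variables `y₁, …, y_a`. -/
def Restricted {σ : Vocabulary} {m : ℕ} {ar : Fin m → ℕ} {l : ℕ} :
    {k : ℕ} → (σ.lang ar).BoundedFormula (Fin l) k → Prop
  | _, .falsum => True
  | _, .equal s t => TermRestricted s ∧ TermRestricted t
  | _, .rel _ ts => ∀ j, TermRestricted (ts j)
  | _, .imp φ ψ => Restricted φ ∧ Restricted ψ
  | _, .all φ => Restricted φ

/-- A `Π₁` formula `φ(F, x) = ∀ y₁ … ∀ y_k ψ(F, x, y)` over `σ` with free function variables `F_i`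
and free individual variables `x₁, …, x_l`, where `ψ` is quantifier-free and every function
variable of arity `a` occurs in `ψ` only in the form `F(y₁, …, y_a)`. -/
structure RestrictedPiOne (σ : Vocabulary) where
  funVars : ℕ
  funArity : Fin funVars → ℕ
  freeVars : ℕ
  univVars : ℕ
  matrix : (σ.lang funArity).BoundedFormula (Fin freeVars) univVars
  isQF : matrix.IsQF
  restricted : Restricted matrix

/-- The formula `∀ y₁ … ∀ y_k ψ`. -/
def RestrictedPiOne.formula {σ : Vocabulary} (φ : RestrictedPiOne σ) :
    (σ.lang φ.funArity).Formula (Fin φ.freeVars) :=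
  φ.matrix.alls

/-- The number of assignments `(f, c)` to the function and individual variables that satisfy the
formula in `A`. -/
noncomputable def RestrictedPiOne.count {σ : Vocabulary} (φ : RestrictedPiOne σ) {n : ℕ} [NeZero n]
    (A : σ.Struc n) : ℕ :=
  Nat.card {p : ((i : Fin φ.funVars) → (Fin (φ.funArity i) → Fin n) → Fin n) ×
    (Fin φ.freeVars → Fin n) //
      @FirstOrder.Language.Formula.Realize _ _ (A.expand p.1) _ φ.formula p.2}

/-- The class `#Π₁^prefix`. The vocabulary has at least one relation symbol of positive arity, and
words that do not encode a structure are mapped to `0`. -/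
def SharpPiOnePrefixClass : Set (Word → ℕ) :=
  {g | ∃ σ : Vocabulary, (∃ i, 0 < σ.arity i) ∧ ∃ φ : RestrictedPiOne σ,
    (∀ (n : ℕ) [NeZero n] (A : σ.Struc n) (w : Word), A.enc = w.1 → g w = φ.count A) ∧
    ∀ w : Word, (¬ ∃ (n : ℕ) (_ : NeZero n) (A : σ.Struc n), A.enc = w.1) → g w = 0}

/-! ### Circuits and proof trees -/

/-- The mark of a gate in a circuit with `n` input bits. `lit i false` is the `i`-th input bit and
`lit i true` is its negation. -/
inductive GateKind (n : ℕ) : Type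
  | and : GateKind n
  | or : GateKind n
  | const (b : Bool) : GateKind n
  | lit (i : Fin n) (neg : Bool) : GateKind n

/-- The gate is an and-gate or an or-gate. -/
def GateKind.Inner {n : ℕ} (s : GateKind n) : Prop := s = .and ∨ s = .or

/-- The truth value of a leaf on an input. -/
def GateKind.LeafTrue {n : ℕ} (x : Fin n → Bool) : GateKind n → Prop
  | .and => False
  | .or => False
  | .const b => b = true
  | .lit i neg => (x i ^^ neg) = true

/-- A Boolean circuit with `n` input bits, with gates of unbounded fan-in and in negation normal
form: a finite directed acyclic graph with marked gates and an output gate (the root), in which the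
gates without children are exactly those marked with constants or literals. -/
structure Circuit (n : ℕ) where
  Gate : Type
  finite : Finite Gate
  kind : Gate → GateKind n
  /-- `child g h`: the gate `h` is a child of the gate `g`. -/
  child : Gate → Gate → Prop
  root : Gate
  inner_iff : ∀ g, (kind g).Inner ↔ ∃ h, child g h
  acyclic : ∀ g, ¬ Relation.TransGen child g g

namespace Circuit

variable {n : ℕ}

/-- The number of gates that are not input gates. -/
noncomputable def size (C : Circuit n) : ℕ := Nat.card {g : C.Gate // (C.kind g).Inner}

/-- Every path from the output gate to an input gate has length at most `d`. -/
def DepthLE (C : Circuit n) (d : ℕ) : Prop :=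
  ∀ (p : List C.Gate) (h : p ≠ []), p.IsChain C.child → p.head h = C.root →
    ¬ (C.kind (p.getLast h)).Inner → p.length ≤ d + 1

/-- Proof trees, on input `x`, of the tree unfolding of the circuit from the gate `g`: all children
of an and-gate and exactly one child of an or-gate are chosen, and all leaves that are reached are
true. -/
inductive ProofTree (C : Circuit n) (x : Fin n → Bool) : C.Gate → Type
  | leaf (g : C.Gate) (h : (C.kind g).LeafTrue x) : ProofTree C x g
  | and (g : C.Gate) (h : C.kind g = .and)
      (t : (c : C.Gate) → C.child g c → ProofTree C x c) : ProofTree C x g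
  | or (g : C.Gate) (h : C.kind g = .or) (c : C.Gate) (hc : C.child g c)
      (t : ProofTree C x c) : ProofTree C x g

/-- The number of proof trees of the circuit on input `x`. -/
noncomputable def numProofTrees (C : Circuit n) (x : Fin n → Bool) : ℕ :=
  Nat.card (C.ProofTree x C.root)

end Circuit

/-! ### First-order uniformity -/

/-- The relation symbols `≤`, `BIT` and `S`. -/
inductive StringRel : ℕ → Type
  | le : StringRel 2
  | bit : StringRel 2
  | one : StringRel 1

/-- The vocabulary of binary strings together with `BIT`. -/
def stringLang : FirstOrder.Language.{0, 0} := ⟨fun _ => Empty, StringRel⟩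

/-- The structure of a binary string of length `n`. -/
@[reducible]
def stringStructure {n : ℕ} (x : Fin n → Bool) : stringLang.Structure (Fin n) where
  funMap := fun {_} f => nomatch f
  RelMap := fun {_} R => match R with
    | .le => fun v => v 0 ≤ v 1
    | .bit => fun v => (v 1 : ℕ).testBit (v 0 : ℕ) = true
    | .one => fun v => x (v 0) = true

/-- The relation symbols `E`, `G_∧`, `G_∨`, `B`, `r`. -/
inductive CircRel : ℕ → Type
  | E : CircRel 2
  | and : CircRel 1
  | or : CircRel 1
  | B : CircRel 1
  | r : CircRel 1

/-- The vocabulary of Boolean circuits. -/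
def circLang : FirstOrder.Language.{0, 0} := ⟨fun _ => Empty, CircRel⟩

/-- A circuit with an input, as a structure: `E(g, h)` says that `h` is a child of `g`, and `B(g)`
says that `g` is a true leaf. -/
@[reducible]
def Circuit.toStructure {n : ℕ} (C : Circuit n) (x : Fin n → Bool) :
    circLang.Structure C.Gate where
  funMap := fun {_} f => nomatch f
  RelMap := fun {_} R => match R with
    | .E => fun v => C.child (v 0) (v 1)
    | .and => fun v => C.kind (v 0) = .and
    | .or => fun v => C.kind (v 0) = .or
    | .B => fun v => (C.kind (v 0)).LeafTrue x
    | .r => fun v => v 0 = C.root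

/-- A first-order interpretation of structures over a relational language `T` in structures over
`L`: the universe consists of `k`-tuples and is defined by the formula `univ`, and each relation
symbol is defined by a formula. -/
structure FOInterpretation (L T : FirstOrder.Language.{0, 0}) where
  k : ℕ
  univ : L.Formula (Fin k)
  rel : {a : ℕ} → T.Relations a → L.Formula (Fin a × Fin k)

/-- The family of circuits is first-order uniform: some first-order interpretation maps the
structure of every nonempty binary string `x` to the circuit for the length of `x`, with input `x`.
The naming `e` of the gates by tuples depends only on the length. -/
def FOUniform (C : (n : ℕ) → Circuit n) : Prop :=
  ∃ I : FOInterpretation stringLang circLang, ∀ n : ℕ, 0 < n →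
    ∃ e : (C n).Gate ↪ (Fin I.k → Fin n), ∀ x : Fin n → Bool,
      (∀ b : Fin I.k → Fin n, b ∈ Set.range e ↔
        @FirstOrder.Language.Formula.Realize _ _ (stringStructure x) _ I.univ b) ∧
      ∀ {a : ℕ} (R : circLang.Relations a) (v : Fin a → (C n).Gate),
        @FirstOrder.Language.Structure.RelMap _ _ ((C n).toStructure x) a R v ↔
          @FirstOrder.Language.Formula.Realize _ _ (stringStructure x) _ (I.rel R) fun q => e (v q.1) q.2

/-- The class FO-uniform `#AC⁰`: functions counting proof trees of FO-uniform circuit families of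
polynomial size and constant depth. -/
def FOUniformSharpACZero : Set (Word → ℕ) :=
  {f | ∃ C : (n : ℕ) → Circuit n, FOUniform C ∧
    (∃ p : Polynomial ℕ, ∀ n, (C n).size ≤ p.eval n) ∧
    (∃ d : ℕ, ∀ n, (C n).DepthLE d) ∧
    ∀ w : Word, f w = (C w.1.length).numProofTrees w.1.get}

end CountFO

namespace CountFO

/-! Both classes are shown to equal a third one: the functions given by the arithmetic expressions
`Arith`, built from 0 and 1 by sums and products over all positions and by case distinctions on
atomic facts about the string. Case distinctions over arbitrary first-order predicates then come for
free (`Arith.ite`): a universal quantifier is resolved by summing over candidates for the least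
counterexample, where exactly one candidate contributes, so no value is counted twice.

Every expression has a normal form: `d` alternations of a sum and a product over a simple kernel
(`Arith.altForm`). If the kernel is 0/1-valued, such a value counts Skolem functions
(`card_skolem`), because the choice made by a sum may depend exactly on the universal variables
before it. This is the pattern `F(y₁, …, y_a)` of the prefix class. Read as a circuit, sums are
or-gates, products are and-gates, and the same value counts proof trees
(`numProofTrees_prefixCircuit`). The formula admits any quantifier-free kernel. In a uniform circuit
the gate names, hence the choice of the literal at a leaf, depend on the length only; a test of an
input bit `x` therefore becomes `x·F + (1-x)·G`, which costs an alternation and needs two positions.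
Words of length one get a single leaf.

Conversely, proof tree counts add at or-gates and multiply at and-gates, so a circuit of bounded
depth unfolds into an expression (`FOInterpretation.gateValue_eq`). For a formula, the expression
sums over the size and the constants of the encoded structure and evaluates the matrix by reading
bits of the word. The positions of these bits are polynomials in the size, so multiplication must be
first-order definable from `≤` and `BIT` (`FODef.mul`). The carries of school multiplication form a
computation with about log n steps on states of O(log log n) bits, and two nested levels of guessed
numbers listing intermediate states describe it (`blockChain_of_forall`). -/

/-! ### First-order definable predicates of strings -/

/-- A predicate on assignments of positions of a binary string to the variables in `α`. -/
abbrev StrPred (α : Type) : Type := ∀ n : ℕ, (Fin n → Bool) → (α → Fin n) → Prop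

/-- Extension of an assignment by a value of the new variable `none`. -/
def ext {α β : Type} (v : α → β) (a : β) : Option α → β
  | none => a
  | some i => v i

/-- Predicates that are first-order definable, uniformly in all nonempty strings. -/
inductive FODef : {α : Type} → StrPred α → Prop
  | le {α : Type} (i j : α) : FODef fun _ _ v => (v i : ℕ) ≤ v j
  | bit {α : Type} (i j : α) : FODef fun _ _ v => (v j : ℕ).testBit (v i) = true
  | one {α : Type} (i : α) : FODef fun _ x v => x (v i) = true
  | fls {α : Type} : FODef (α := α) fun _ _ _ => False
  | imp {α : Type} {P Q : StrPred α} (hP : FODef P) (hQ : FODef Q) :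
      FODef fun n x v => P n x v → Q n x v
  | all {α : Type} {P : StrPred (Option α)} (hP : FODef P) :
      FODef fun n x v => ∀ a, P n x (ext v a)
  | congr {α : Type} {P Q : StrPred α} (hP : FODef P)
      (h : ∀ n, 0 < n → ∀ x v, P n x v ↔ Q n x v) : FODef Q

theorem ext_comp {α β γ : Type} (v : β → γ) (a : γ) (g : α → β) :
    ext (fun i => v (g i)) a = fun i => ext v a (Option.map g i) := by
  funext i; cases i <;> rfl

namespace FODef

variable {α β : Type}

theorem rename {P : StrPred α} (hP : FODef P) :
    ∀ {β : Type} (g : α → β), FODef fun n x v => P n x fun i => v (g i) := by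
  induction hP with
  | le i j => exact fun g => le (g i) (g j)
  | bit i j => exact fun g => bit (g i) (g j)
  | one i => exact fun g => one (g i)
  | fls => exact fun g => fls
  | imp _ _ h₁ h₂ => exact fun g => imp (h₁ g) (h₂ g)
  | all _ h =>
    intro β g
    refine (all (h (Option.map g))).congr fun n _ x v => ?_
    simp only [ext_comp]
  | congr _ h ih => exact fun g => (ih g).congr fun n hn x v => h n hn x _

theorem not {P : StrPred α} (hP : FODef P) : FODef fun n x v => ¬ P n x v := imp hP fls

theorem and {P Q : StrPred α} (hP : FODef P) (hQ : FODef Q) :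
    FODef fun n x v => P n x v ∧ Q n x v :=
  (not (imp hP (not hQ))).congr fun n _ x v => by tauto

theorem or {P Q : StrPred α} (hP : FODef P) (hQ : FODef Q) :
    FODef fun n x v => P n x v ∨ Q n x v :=
  (imp (not hP) hQ).congr fun n _ x v => by tauto

theorem iff {P Q : StrPred α} (hP : FODef P) (hQ : FODef Q) :
    FODef fun n x v => (P n x v ↔ Q n x v) :=
  (and (imp hP hQ) (imp hQ hP)).congr fun n _ x v => by tauto

theorem ex {P : StrPred (Option α)} (hP : FODef P) : FODef fun n x v => ∃ a, P n x (ext v a) :=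
  (not (all (not hP))).congr fun n _ x v => by simp

theorem all₁ {P : ∀ n : ℕ, (Fin n → Bool) → (α → Fin n) → Fin n → Prop}
    (hP : FODef fun n x (v : Option α → Fin n) => P n x (fun i => v (some i)) (v none)) :
    FODef fun n x v => ∀ a, P n x v a := all hP

theorem ex₁ {P : ∀ n : ℕ, (Fin n → Bool) → (α → Fin n) → Fin n → Prop}
    (hP : FODef fun n x (v : Option α → Fin n) => P n x (fun i => v (some i)) (v none)) :
    FODef fun n x v => ∃ a, P n x v a := ex hP

theorem const (p : Prop) : FODef (α := α) fun _ _ _ => p := by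
  by_cases h : p
  · exact (not fls).congr fun n _ x v => by tauto
  · exact fls.congr fun n _ x v => by tauto

theorem exFinite {ι : Type} [Finite ι] {P : ι → StrPred α} (hP : ∀ i, FODef (P i)) :
    FODef fun n x v => ∃ i, P i n x v := by
  classical
  have := Fintype.ofFinite ι
  suffices h : ∀ s : Finset ι, FODef fun n x v => ∃ i ∈ s, P i n x v from
    (h Finset.univ).congr fun n _ x v => by simp
  intro s
  induction s using Finset.induction_on with
  | empty => exact fls.congr fun n _ x v => by simp
  | insert a s _ ih => exact ((hP a).or ih).congr fun n _ x v => by simp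

theorem allFinite {ι : Type} [Finite ι] {P : ι → StrPred α} (hP : ∀ i, FODef (P i)) :
    FODef fun n x v => ∀ i, P i n x v :=
  (not (exFinite fun i => not (hP i))).congr fun n _ x v => by simp

theorem lt (i j : α) : FODef fun _ _ v => (v i : ℕ) < v j :=
  (not (le j i)).congr fun n _ x v => by omega

theorem eq (i j : α) : FODef fun _ _ v => (v i : ℕ) = v j :=
  ((le i j).and (le j i)).congr fun n _ x v => by omega

theorem zero (i : α) : FODef fun _ _ v => (v i : ℕ) = 0 :=
  (all (le (some i) none)).congr fun n hn x v =>
    ⟨fun h => by simpa [ext] using h ⟨0, hn⟩, fun h a => by simp only [ext, h]; omega⟩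

theorem last (i : α) : FODef fun n _ v => (v i : ℕ) + 1 = n :=
  (all (le none (some i))).congr fun n hn x v =>
    ⟨fun h => by have := h ⟨n - 1, by omega⟩; simp only [ext] at this; have := (v i).2; omega,
      fun h a => by have := a.2; simp only [ext]; omega⟩

theorem succ (i j : α) : FODef fun _ _ v => (v i : ℕ) + 1 = v j :=
  ((lt i j).and (all (not ((lt (some i) none).and (lt none (some j)))))).congr
    fun n hn x v => by
      simp only [ext]
      constructor
      · rintro ⟨h1, h2⟩
        by_contra h
        exact h2 ⟨v i + 1, by have := (v j).2; omega⟩ ⟨by simp, by simp only; omega⟩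
      · intro h
        exact ⟨by omega, fun a ha => by omega⟩

theorem numeral (c : ℕ) : ∀ {α : Type} (i : α), FODef fun _ _ v => (v i : ℕ) = c := by
  induction c with
  | zero => exact zero
  | succ c ih =>
    intro α i
    refine (ex ((ih none).and (succ none (some i)))).congr fun n hn x v => ?_
    simp only [ext]
    constructor
    · rintro ⟨a, h1, h2⟩; omega
    · intro h
      exact ⟨⟨c, by have := (v i).2; omega⟩, rfl, by simp only; omega⟩

theorem card_eq (c : ℕ) : FODef (α := α) fun n _ _ => n = c := by
  rcases Nat.eq_zero_or_pos c with rfl | hc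
  · exact fls.congr fun n hn x v => iff_of_false id hn.ne'
  refine (ex ((last none).and (numeral (c - 1) none))).congr fun n hn x v => ?_
  simp only [ext]
  constructor
  · rintro ⟨a, h1, h2⟩; omega
  · rintro rfl
    exact ⟨⟨n - 1, by omega⟩, by simp only; omega, rfl⟩

end FODef

/-! ### Arithmetic of positions from `≤` and `BIT`, up to multiplication. -/

/-! ### Definability of addition, powers of two and shifts -/

theorem testBit_lt_card {n : ℕ} {a : Fin n} {k : ℕ} (h : (a : ℕ).testBit k = true) : k < n :=
  (Nat.lt_two_pow_self.trans_le (Nat.ge_two_pow_of_testBit h)).trans a.2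

theorem eq_iff_testBit {n a b : ℕ} (ha : a < 2 ^ n) (hb : b < 2 ^ n) :
    a = b ↔ ∀ k : Fin n, a.testBit k = true ↔ b.testBit k = true := by
  constructor
  · rintro rfl k; rfl
  · intro h
    refine Nat.eq_of_testBit_eq fun k => ?_
    by_cases hk : k < n
    · exact Bool.eq_iff_iff.2 (h ⟨k, hk⟩)
    · rw [Nat.testBit_eq_false_of_lt (ha.trans_le (Nat.pow_le_pow_right two_pos (by omega))),
        Nat.testBit_eq_false_of_lt (hb.trans_le (Nat.pow_le_pow_right two_pos (by omega)))]

theorem lt_two_pow_card {n : ℕ} (a : Fin n) : (a : ℕ) < 2 ^ n := a.2.trans Nat.lt_two_pow_self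

/-- The carry into position `m` is the overflow of the residues modulo `2 ^ m`; the nested
equivalences are the exclusive or of three bits. -/
theorem testBit_add_iff (x y m : ℕ) : (x + y).testBit m = true ↔
    (x.testBit m = true ↔ (y.testBit m = true ↔ 2 ^ m ≤ x % 2 ^ m + y % 2 ^ m)) := by
  simp only [Nat.testBit_eq_decide_div_mod_eq, decide_eq_true_eq]
  rw [Nat.add_div (by positivity)]
  split_ifs with h <;> simp only [h, iff_true, iff_false] <;> omega

theorem mod_two_pow_succ_eq {x y m : ℕ} (h : x % 2 ^ m = y % 2 ^ m)
    (hm : x.testBit m = true ↔ y.testBit m = true) : x % 2 ^ (m + 1) = y % 2 ^ (m + 1) := by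
  refine Nat.eq_of_testBit_eq fun k => ?_
  have hk := congrArg (fun z => z.testBit k) h
  simp only [Nat.testBit_mod_two_pow] at hk ⊢
  rcases lt_trichotomy k m with h1 | rfl | h1
  · simpa [h1, show k < m + 1 by omega] using hk
  · simpa using Bool.eq_iff_iff.2 hm
  · simp [show ¬ k < m + 1 by omega]

/-- An overflow shows in the result: the residue of the sum wraps around below that of a summand.
The carry can thus be read off from `x` and `z` by comparing residues. -/
theorem carry_iff {x y z m : ℕ} (h : z % 2 ^ m = (x + y) % 2 ^ m) :
    z % 2 ^ m < x % 2 ^ m ↔ 2 ^ m ≤ x % 2 ^ m + y % 2 ^ m := by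
  have hx := Nat.mod_lt x (Nat.two_pow_pos m)
  have hy := Nat.mod_lt y (Nat.two_pow_pos m)
  rw [h, Nat.add_mod]
  by_cases hc : 2 ^ m ≤ x % 2 ^ m + y % 2 ^ m
  · rw [Nat.mod_eq_sub_mod hc, Nat.mod_eq_of_lt (by omega)]
    omega
  · rw [Nat.mod_eq_of_lt (by omega)]
    omega

theorem add_eq_iff {n : ℕ} (x y z : Fin n) : (x : ℕ) + y = z ↔
    ∀ i : Fin n, (z : ℕ).testBit i = true ↔ ((x : ℕ).testBit i = true ↔
      ((y : ℕ).testBit i = true ↔ (z : ℕ) % 2 ^ (i : ℕ) < x % 2 ^ (i : ℕ))) := by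
  constructor
  · intro h i
    rw [carry_iff (by rw [h]), ← testBit_add_iff, h]
  · intro h
    have key : ∀ m ≤ n, (z : ℕ) % 2 ^ m = (x + y) % 2 ^ m := by
      intro m
      induction m with
      | zero => simp [Nat.mod_one]
      | succ m ih =>
        intro hm
        have ih := ih (by omega)
        refine mod_two_pow_succ_eq ih ?_
        rw [h ⟨m, by omega⟩, testBit_add_iff, carry_iff ih]
    have h1 := key n le_rfl
    -- The induction determines both sides modulo `2 ^ n` only, and `x + y` may exceed `n`; it still
    -- stays below `2 * n ≤ 2 ^ n`.
    have h2 : (x : ℕ) + y < 2 ^ n := by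
      have : ∀ n : ℕ, 2 * n ≤ 2 ^ n := by
        intro n
        induction n with
        | zero => simp
        | succ n ih => 
          have := Nat.one_le_two_pow (n := n)
          rw [pow_succ]; omega
      have := this n
      omega
    rw [Nat.mod_eq_of_lt (lt_two_pow_card z), Nat.mod_eq_of_lt h2] at h1
    exact h1.symm

namespace FODef

variable {α β : Type}

theorem modPow (k i j : α) : FODef fun _ _ v => (v k : ℕ) = v i % 2 ^ (v j : ℕ) :=
  (all ((bit none (some k)).iff ((lt none (some j)).and (bit none (some i))))).congr
    fun n hn x v => by
      rw [eq_iff_testBit (lt_two_pow_card _) ((Nat.mod_le _ _).trans_lt (lt_two_pow_card _))]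
      simp [ext, Nat.testBit_mod_two_pow]

theorem modPow_lt (i j k : α) :
    FODef fun _ _ v => (v i : ℕ) % 2 ^ (v k : ℕ) < v j % 2 ^ (v k : ℕ) :=
  (ex (ex (((modPow none (some (some i)) (some (some k))).and
    (modPow (some none) (some (some j)) (some (some k)))).and (lt none (some none))))).congr
    fun n hn x v => by
      simp only [ext]
      constructor
      · rintro ⟨a, b, ⟨h1, h2⟩, h3⟩
        rwa [← h1, ← h2]
      · intro h
        exact ⟨⟨_, (Nat.mod_le _ _).trans_lt (v j).2⟩, ⟨_, (Nat.mod_le _ _).trans_lt (v i).2⟩,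
          ⟨rfl, rfl⟩, h⟩

theorem add (i j k : α) : FODef fun _ _ v => (v i : ℕ) + v j = v k :=
  (all ((bit none (some k)).iff ((bit none (some i)).iff ((bit none (some j)).iff
    (modPow_lt (some k) (some i) none))))).congr fun _ _ _ _ => (add_eq_iff _ _ _).symm

theorem pow (i j : α) : FODef fun _ _ v => (v j : ℕ) = 2 ^ (v i : ℕ) :=
  (all ((bit none (some j)).iff (eq none (some i)))).congr fun n hn x v => by
    rw [eq_iff_testBit (lt_two_pow_card _) (Nat.pow_lt_pow_right (by omega) (v i).2)]
    refine forall_congr' fun k => iff_congr Iff.rfl ?_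
    simp [ext, Nat.testBit_two_pow, eq_comm]

/-- Multiplication by a power of two only moves bits, so addition of bit positions suffices. This is
all that is needed to address blocks of digits before general multiplication is available. -/
theorem shift (i b j : α) : FODef fun _ _ v => (v j : ℕ) = v i * 2 ^ (v b : ℕ) :=
  ((all ((bit none (some j)).imp (ex ((add none (some (some b)) (some none)).and
    (bit none (some (some i))))))).and
   (all ((bit none (some i)).imp (ex ((add (some none) (some (some b)) none).and
    (bit none (some (some j)))))))).congr fun n hn x v => by
    constructor
    · rintro ⟨h1, h2⟩
      refine Nat.eq_of_testBit_eq fun k => Bool.eq_iff_iff.2 ?_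
      rw [Nat.testBit_mul_two_pow]
      simp only [Bool.and_eq_true, decide_eq_true_eq]
      constructor
      · intro h
        obtain ⟨a, h3, h4⟩ := h1 ⟨k, testBit_lt_card h⟩ h
        simp only [ext] at h3 h4
        rw [← h3]
        simpa using h4
      · rintro ⟨h3, h4⟩
        obtain ⟨a, h5, h6⟩ := h2 ⟨_, testBit_lt_card h4⟩ h4
        simp only [ext] at h5 h6
        rwa [← h5, Nat.sub_add_cancel h3] at h6
    · intro h
      refine ⟨fun a ha => ?_, fun a ha => ?_⟩
      · simp only [ext] at ha
        rw [h, Nat.testBit_mul_two_pow] at ha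
        simp only [Bool.and_eq_true, decide_eq_true_eq] at ha
        exact ⟨⟨a - v b, by omega⟩, by simp only [ext]; omega, ha.2⟩
      · simp only [ext] at ha
        have : (v j : ℕ).testBit (a + v b) = true := by
          rw [h, Nat.testBit_mul_two_pow]; simpa using ha
        exact ⟨⟨a + v b, testBit_lt_card this⟩, rfl, this⟩

/-- The block of `len` binary digits of `c` that starts at position `p`. -/
def _root_.CountFO.slice (c p len : ℕ) : ℕ := c / 2 ^ p % 2 ^ len

theorem slice (c p l s : α) : FODef fun _ _ v => (v s : ℕ) = slice (v c) (v p) (v l) :=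
  (all ((bit none (some s)).iff ((lt none (some l)).and
    (ex ((add (some none) (some (some p)) none).and (bit none (some (some c)))))))).congr
    fun n hn x v => by
      rw [CountFO.slice, eq_iff_testBit (n := n) (lt_two_pow_card _) (((Nat.mod_le _ _).trans
        (Nat.div_le_self _ _)).trans_lt (lt_two_pow_card (v c)))]
      refine forall_congr' fun k => ?_
      simp only [ext, Nat.testBit_mod_two_pow, Nat.testBit_div_two_pow,
        Bool.and_eq_true, decide_eq_true_eq]
      refine iff_congr Iff.rfl (and_congr_right fun _ => ?_)
      constructor
      · rintro ⟨a, h1, h2⟩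
        rwa [h1]
      · intro h
        exact ⟨⟨_, testBit_lt_card h⟩, rfl, h⟩

/-- Definability only has to be checked on long strings if the predicate does not depend on the
bits of the string. -/
theorem of_eventually [Finite α] {P : ∀ n : ℕ, (α → Fin n) → Prop} {Q : StrPred α} (hQ : FODef Q)
    (m : ℕ) (h : ∀ n, m ≤ n → ∀ x v, Q n x v ↔ P n v) : FODef fun n _ v => P n v := by
  -- For each of the finitely many short lengths, the predicate is a finite table of assignments.
  have small : ∀ c : Fin m, FODef fun n _ (v : α → Fin n) => n = c ∧
      ∃ u : {u : α → Fin c // P c u}, ∀ i, (v i : ℕ) = u.1 i := fun c =>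
    (card_eq c).and (exFinite fun u => allFinite fun i => numeral _ i)
  have large : FODef (α := α) fun n _ _ => ∀ c : Fin m, ¬ n = c :=
    allFinite fun c => (card_eq c).not
  refine ((exFinite small).or (large.and hQ)).congr fun n _ x v => ?_
  constructor
  · rintro (⟨c, rfl, u, hu⟩ | ⟨hn, hv⟩)
    · rw [show v = u.1 from funext fun i => Fin.ext (hu i)]
      exact u.2
    · refine (h n ?_ x v).1 hv
      by_contra hlt
      exact hn ⟨n, by omega⟩ rfl
  · intro hP
    by_cases hn : n < m
    · exact .inl ⟨⟨n, hn⟩, rfl, ⟨v, hP⟩, fun i => rfl⟩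
    · exact .inr ⟨fun c hc => by omega, (h n (by omega) x v).2 hP⟩

end FODef

/-! ### Definability of long computations -/

/-- Two steps of the relation `R` on states, starting at time `2 * (p + i)`, lead from the `i`-th
to the next block of `B = 2 ^ b` binary digits of `c`. -/
def InnerStep {n : ℕ} (R : ℕ → ℕ → ℕ → Prop) (b B c p i : Fin n) : Prop :=
  ∃ o o' w w' j r r' m : Fin n, ((o : ℕ) = i * 2 ^ (b : ℕ) ∧ (o : ℕ) + B = o') ∧
    -- Only every second state is listed; the middle state `m` is quantified directly. This doubling
    -- lets a listing that fits into `l` bits cover more than `l` steps.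
    ((w : ℕ) = slice c o B ∧ (w' : ℕ) = slice c o' B) ∧
    ((p : ℕ) + i = j ∧ (j : ℕ) + j = r ∧ (r : ℕ) + 1 = r') ∧ R r w m ∧ R r' m w'

/-- Witnessed by a number `d` that lists intermediate states, `2 * B` steps of the relation `R`,
starting at time `2 * p`, lead from the state at position `p` of `c` to the state at `p + B`. -/
def BlockStep {n : ℕ} (R : ℕ → ℕ → ℕ → Prop) (b B c p : Fin n) : Prop :=
  ∃ d e p' u u' z : Fin n, ((z : ℕ) = 0 ∧ (p : ℕ) + B = p' ∧ (e : ℕ) = B * 2 ^ (b : ℕ)) ∧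
    ((u : ℕ) = slice c p B ∧ (u : ℕ) = slice d z B) ∧
    ((u' : ℕ) = slice c p' B ∧ (u' : ℕ) = slice d e B) ∧
    ∀ i : Fin n, (i : ℕ) < B → InnerStep R b B d p i

/-- Witnessed by a number `c` that lists the states at multiples of a power of two, `2 * k` steps of
the relation `R` lead from the state `s` to the state `t`. -/
def BlockChain {n : ℕ} (R : ℕ → ℕ → ℕ → Prop) (k s t : Fin n) : Prop :=
  ∃ b B c z q : Fin n, ((B : ℕ) = 2 ^ (b : ℕ) ∧ (z : ℕ) = 0 ∧ (k : ℕ) = q * 2 ^ (b : ℕ)) ∧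
    ((s : ℕ) = slice c z B ∧ (t : ℕ) = slice c k B) ∧
    ∀ p : Fin n, (p : ℕ) < k → (∃ q : Fin n, (p : ℕ) = q * 2 ^ (b : ℕ)) → BlockStep R b B c p

/-- A relation between times and pairs of states, definable with parameters. -/
def FODefRel {α : Type} (R : ∀ n : ℕ, (Fin n → Bool) → (α → Fin n) → ℕ → ℕ → ℕ → Prop) : Prop :=
  ∀ (β : Type) (g : α → β) (i s t : β),
    FODef fun n x v => R n x (fun a => v (g a)) (v i) (v s) (v t)

section

variable {α β : Type} {R : ∀ n : ℕ, (Fin n → Bool) → (α → Fin n) → ℕ → ℕ → ℕ → Prop}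

open FODef

theorem FODef.innerStep (hR : FODefRel R) (g : α → β) (b B c p i : β) :
    FODef fun n x v => InnerStep (R n x fun a => v (g a)) (v b) (v B) (v c) (v p) (v i) :=
  ex₁ <| ex₁ <| ex₁ <| ex₁ <| ex₁ <| ex₁ <| ex₁ <| ex₁ <|
    ((shift _ _ _).and (add _ _ _)).and <| ((slice _ _ _ _).and (slice _ _ _ _)).and <|
    ((add _ _ _).and ((add _ _ _).and (succ _ _))).and <|
    (hR _ (fun a => some (some (some (some (some (some (some (some (g a)))))))))
      (some (some none)) (some (some (some (some (some none))))) none).and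
    (hR _ (fun a => some (some (some (some (some (some (some (some (g a)))))))))
      (some none) none (some (some (some (some none)))))

theorem FODef.blockStep (hR : FODefRel R) (g : α → β) (b B c p : β) :
    FODef fun n x v => BlockStep (R n x fun a => v (g a)) (v b) (v B) (v c) (v p) :=
  ex₁ <| ex₁ <| ex₁ <| ex₁ <| ex₁ <| ex₁ <|
    ((zero _).and ((add _ _ _).and (shift _ _ _))).and <|
    ((slice _ _ _ _).and (slice _ _ _ _)).and <| ((slice _ _ _ _).and (slice _ _ _ _)).and <|
    all₁ <| imp (lt _ _) (innerStep hR (fun a => some (some (some (some (some (some (some (g a))))))))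
      _ _ _ _ _)

theorem FODef.blockChain (hR : FODefRel R) (g : α → β) (k s t : β) :
    FODef fun n x v => BlockChain (R n x fun a => v (g a)) (v k) (v s) (v t) :=
  ex₁ <| ex₁ <| ex₁ <| ex₁ <| ex₁ <| ((pow _ _).and ((zero _).and (shift _ _ _))).and <|
    ((slice _ _ _ _).and (slice _ _ _ _)).and <|
    all₁ <| imp (lt _ _) <| imp (ex₁ (shift _ _ _)) <|
      blockStep hR (fun a => some (some (some (some (some (some (g a))))))) _ _ _ _

end

/-- One step of the computation described by `R`, on pairs of a time and a state. -/
def TimedStep (R : ℕ → ℕ → ℕ → Prop) (a b : ℕ × ℕ) : Prop := b.1 = a.1 + 1 ∧ R a.1 a.2 b.2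

theorem InnerStep.reach {n : ℕ} {R : ℕ → ℕ → ℕ → Prop} {b B c p i : Fin n}
    (h : InnerStep R b B c p i) (hB : (B : ℕ) = 2 ^ (b : ℕ)) :
    Relation.ReflTransGen (TimedStep R) (2 * (p + i), slice c (i * B) B)
      (2 * (p + (i + 1)), slice c ((i + 1) * B) B) := by
  obtain ⟨o, o', w, w', j, r, r', m, ⟨h1, h2⟩, ⟨h3, h4⟩, ⟨h5, h6, h7⟩, h8, h9⟩ := h
  have e1 : (i * B : ℕ) = o := by rw [h1, hB]
  have e2 : ((i + 1) * B : ℕ) = o' := by rw [← h2, ← e1]; ring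
  rw [e1, e2, ← h3, ← h4]
  have s1 : TimedStep R (2 * (p + i), w) (r', m) :=
    ⟨by simp only; omega, by
      have : 2 * ((p : ℕ) + i) = r := by omega
      simpa only [this] using h8⟩
  have s2 : TimedStep R (r', m) (2 * (p + (i + 1)), w') := ⟨by simp only; omega, h9⟩
  exact (Relation.ReflTransGen.single s1).tail s2

theorem BlockStep.reach {n : ℕ} {R : ℕ → ℕ → ℕ → Prop} {b B c p : Fin n}
    (h : BlockStep R b B c p) (hB : (B : ℕ) = 2 ^ (b : ℕ)) :
    Relation.ReflTransGen (TimedStep R) (2 * p, slice c p B) (2 * (p + B), slice c (p + B) B) := by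
  obtain ⟨d, e, p', u, u', z, ⟨h1, h2, h3⟩, ⟨h4, h5⟩, ⟨h6, h7⟩, h8⟩ := h
  have key : ∀ i ≤ (B : ℕ), Relation.ReflTransGen (TimedStep R) (2 * p, slice c p B)
      (2 * (p + i), slice d (i * B) B) := by
    intro i
    induction i with
    | zero =>
      intro _
      rw [← h4, h5, h1, zero_mul, add_zero]
    | succ i ih =>
      intro hi
      exact (ih (by omega)).trans ((h8 ⟨i, by omega⟩ (by simp only; omega)).reach hB)
  have := key B le_rfl
  rwa [show (B * B : ℕ) = e by rw [h3, hB], ← h7, h6, ← h2] at this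

/-- Soundness holds for every `n` and for arbitrary guessed numbers: consecutive blocks of `c` are
linked by runs, themselves listed by other numbers. Size bounds matter only for completeness. -/
theorem BlockChain.reach {n : ℕ} {R : ℕ → ℕ → ℕ → Prop} {k s t : Fin n}
    (h : BlockChain R k s t) :
    Relation.ReflTransGen (TimedStep R) (0, s) (2 * k, t) := by
  obtain ⟨b, B, c, z, q, ⟨h1, h2, h3⟩, ⟨h4, h5⟩, h6⟩ := h
  have key : ∀ i ≤ (q : ℕ), Relation.ReflTransGen (TimedStep R) (0, s)
      (2 * (i * B), slice c (i * B) B) := by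
    intro i
    induction i with
    | zero =>
      intro _
      rw [h4, h2, zero_mul, mul_zero]
    | succ i ih =>
      intro hi
      have hlt : i * (B : ℕ) < k := by
        rw [h3, ← h1]
        exact Nat.mul_lt_mul_of_pos_right (by omega) (by rw [h1]; positivity)
      have := (h6 ⟨i * B, by omega⟩ hlt ⟨⟨i, by omega⟩, by simp only [h1]⟩).reach h1
      rw [show (i + 1) * (B : ℕ) = i * B + B by ring]
      exact (ih (by omega)).trans this
  have := key q le_rfl
  rwa [h1, ← h3, ← h1, ← h5] at this

/-- Any sequence of short numbers is listed by the blocks of binary digits of a number. -/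
theorem exists_slice_eq (B : ℕ) (s : ℕ → ℕ) (hs : ∀ i, s i < 2 ^ B) (m : ℕ) :
    ∃ c < 2 ^ (m * B), ∀ i < m, slice c (i * B) B = s i := by
  induction m generalizing s with
  | zero => exact ⟨0, by simp, by simp⟩
  | succ m ih =>
    obtain ⟨c, hc, h⟩ := ih (fun i => s (i + 1)) fun i => hs (i + 1)
    refine ⟨s 0 + 2 ^ B * c, ?_, fun i hi => ?_⟩
    · have h0 := hs 0
      calc s 0 + 2 ^ B * c < 2 ^ B + 2 ^ B * c := by omega
        _ = 2 ^ B * (c + 1) := by ring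
        _ ≤ 2 ^ B * 2 ^ (m * B) := Nat.mul_le_mul_left _ hc
        _ = 2 ^ ((m + 1) * B) := by rw [← pow_add]; congr 1; ring
    · cases i with
      | zero => simp [slice, Nat.mod_eq_of_lt (hs 0)]
      | succ i =>
        rw [← h i (by omega), slice, slice, show (i + 1) * B = B + i * B by ring, pow_add,
          ← Nat.div_div_eq_div_mul, Nat.add_mul_div_left _ _ (Nat.two_pow_pos B),
          Nat.div_eq_of_lt (hs 0), zero_add]

theorem innerStep_of_forall {n : ℕ} {R : ℕ → ℕ → ℕ → Prop} {b B c p i : Fin n} {σ : ℕ → ℕ}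
    (hB : (B : ℕ) = 2 ^ (b : ℕ)) (hR : ∀ j, R j (σ j) (σ (j + 1))) (hσ : ∀ j, σ j < n)
    (h1 : (i + 1) * (B : ℕ) < n) (h2 : 2 * (p + i : ℕ) + 1 < n)
    (h3 : slice c (i * B) B = σ (2 * (p + i)))
    (h4 : slice c ((i + 1) * B) B = σ (2 * (p + (i + 1)))) : InnerStep R b B c p i := by
  have e : (i + 1) * (B : ℕ) = i * B + B := by ring
  refine ⟨⟨i * B, by omega⟩, ⟨(i + 1) * B, h1⟩, ⟨_, hσ (2 * (p + i))⟩,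
    ⟨_, hσ (2 * (p + (i + 1)))⟩, ⟨p + i, by omega⟩, ⟨2 * (p + i), by omega⟩,
    ⟨2 * (p + i) + 1, h2⟩, ⟨_, hσ (2 * (p + i) + 1)⟩, ⟨by simp only [hB], by simp only [e]⟩,
    ⟨h3.symm, h4.symm⟩, ⟨rfl, by simp only; omega, rfl⟩, hR _, ?_⟩
  exact hR (2 * (p + i) + 1)

/-- Completeness: a run is cut into `q` blocks of `2 ^ b` double steps. The outer number lists `q +
1` states and each inner one `2 ^ b + 1` states, of `2 ^ b` bits each; `h1` and `h2` say that these
numbers are positions. -/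
theorem blockChain_of_forall {n : ℕ} {R : ℕ → ℕ → ℕ → Prop} {σ : ℕ → ℕ} {b q : ℕ}
    (hR : ∀ j, R j (σ j) (σ (j + 1))) (hσ : ∀ j, σ j < 2 ^ 2 ^ b)
    (h1 : 2 ^ ((q + 1) * 2 ^ b) ≤ n) (h2 : 2 ^ ((2 ^ b + 1) * 2 ^ b) ≤ n)
    (h3 : 2 * (q * 2 ^ b) < n) {k s t : Fin n} (hk : (k : ℕ) = q * 2 ^ b) (hs : (s : ℕ) = σ 0)
    (ht : (t : ℕ) = σ (2 * k)) : BlockChain R k s t := by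
  obtain ⟨c, hc, hc'⟩ := exists_slice_eq (2 ^ b) (fun i => σ (2 * (i * 2 ^ b)))
    (fun i => hσ _) (q + 1)
  have hbB : b < 2 ^ b := Nat.lt_two_pow_self
  have hBB : 2 ^ b ≤ 2 ^ b * 2 ^ b := Nat.le_mul_of_pos_left _ (Nat.two_pow_pos b)
  have hBn : (2 ^ b + 1) * 2 ^ b < n := Nat.lt_two_pow_self.trans_le h2
  have hBn' : 2 ^ b * 2 ^ b + 2 ^ b < n := by rwa [← Nat.succ_mul]
  have hqn : (q + 1) * 2 ^ b < n := Nat.lt_two_pow_self.trans_le h1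
  have hqq : q ≤ q * 2 ^ b := Nat.le_mul_of_pos_right _ (Nat.two_pow_pos b)
  have hσn : ∀ j, σ j < n := fun j =>
    ((hσ j).trans_le (Nat.pow_le_pow_right two_pos (by rw [Nat.succ_mul]; omega))).trans_le h2
  refine ⟨⟨b, by omega⟩, ⟨2 ^ b, by omega⟩, ⟨c, by omega⟩, ⟨0, by omega⟩, ⟨q, by omega⟩,
    ⟨rfl, rfl, hk⟩, ⟨?_, ?_⟩, ?_⟩
  · have := hc' 0 (by omega)
    simpa [hs] using this.symm
  · have := hc' q (by omega)
    rw [ht, hk]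
    exact this.symm
  · rintro p hp ⟨i, hi⟩
    simp only at hi
    have hiq : (i : ℕ) < q := by
      rw [hi, hk] at hp
      exact Nat.lt_of_mul_lt_mul_right hp
    have hpB : (p : ℕ) + 2 ^ b ≤ q * 2 ^ b := by
      rw [hi, ← Nat.succ_mul]; exact Nat.mul_le_mul_right _ hiq
    obtain ⟨d, hd, hd'⟩ := exists_slice_eq (2 ^ b) (fun i => σ (2 * (p + i)))
      (fun i => hσ _) (2 ^ b + 1)
    refine ⟨⟨d, by omega⟩, ⟨2 ^ b * 2 ^ b, by omega⟩, ⟨p + 2 ^ b, by omega⟩,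
      ⟨σ (2 * p), hσn _⟩, ⟨σ (2 * (p + 2 ^ b)), hσn _⟩, ⟨0, by omega⟩, ⟨rfl, rfl, rfl⟩,
      ⟨?_, ?_⟩, ⟨?_, ?_⟩, ?_⟩
    · have := hc' i (by omega)
      rw [← hi] at this
      exact this.symm
    · have := hd' 0 (by omega)
      simpa using this.symm
    · have := hc' (i + 1) (by omega)
      rw [Nat.succ_mul, ← hi] at this
      exact this.symm
    · have := hd' (2 ^ b) (by omega)
      exact this.symm
    · intro j hj
      simp only at hj
      refine innerStep_of_forall rfl hR hσn ?_ ?_ ?_ ?_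
      · refine lt_of_le_of_lt (Nat.mul_le_mul_right _ ?_) hBn
        omega
      · omega
      · exact hd' j (by omega)
      · exact hd' (j + 1) (by omega)

/-- For long strings there is a block size that suits computations of logarithmic length. -/
theorem exists_block_size {l : ℕ} (hl : 2 ^ 13 ≤ l) : ∃ b q : ℕ, 8 * l < 2 ^ 2 ^ b ∧
    (q + 1) * 2 ^ b ≤ l ∧ (2 ^ b + 1) * 2 ^ b ≤ l ∧ l < 2 * (q * 2 ^ b) := by
  set s := Nat.log 2 l with hs
  have hs13 : 13 ≤ s := Nat.le_log_of_pow_le (by norm_num) hl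
  have hsl : 2 ^ s ≤ l := Nat.pow_log_le_self 2 (by omega)
  have hls : l < 2 ^ (s + 1) := Nat.lt_pow_succ_log_self (by norm_num) l
  -- The block size is the least power of two that is at least `s + 4`: then `2 ^ (s + 4)` exceeds
  -- `8 * l`, so states fit into blocks, while the block size stays logarithmic in `l`.
  obtain ⟨b, hb1, hb2⟩ : ∃ b, s + 4 ≤ 2 ^ b ∧ 2 ^ b ≤ 2 * (s + 4) := by
    refine ⟨Nat.clog 2 (s + 4), Nat.le_pow_clog (by norm_num) _, ?_⟩
    have := Nat.pow_pred_clog_lt_self (b := 2) (by norm_num) (x := s + 4) (by omega)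
    have hpos : 0 < Nat.clog 2 (s + 4) := Nat.clog_pos (by norm_num) (by omega)
    obtain ⟨c, hc⟩ := Nat.exists_eq_succ_of_ne_zero hpos.ne'
    rw [hc] at this ⊢
    simp only [Nat.succ_eq_add_one, Nat.pred_succ] at this
    rw [Nat.succ_eq_add_one, pow_succ]
    omega
  have hgrow : ∀ s ≥ 13, (2 * (s + 4) + 1) * (2 * (s + 4)) ≤ 2 ^ s := by
    intro s hs
    induction s, hs using Nat.le_induction with
    | base => norm_num
    | succ s hs ih =>
      rw [pow_succ]
      nlinarith
  have hBB : (2 ^ b + 1) * 2 ^ b ≤ l :=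
    (Nat.mul_le_mul (by omega) hb2).trans ((hgrow s hs13).trans hsl)
  have h4 : 4 * 2 ^ b ≤ l :=
    (Nat.mul_le_mul_right _ (by omega : 4 ≤ 2 ^ b + 1)).trans hBB
  set B := 2 ^ b with hB
  have hdm := Nat.div_add_mod l (2 * B)
  have hml := Nat.mod_lt l (show 0 < 2 * B by omega)
  -- The least `q` for which `q` blocks of `B` double steps go beyond time `l`.
  refine ⟨b, l / (2 * B) + 1, ?_, ?_, hBB, ?_⟩
  · calc 8 * l < 8 * 2 ^ (s + 1) := by omega
      _ = 2 ^ (s + 4) := by ring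
      _ ≤ 2 ^ B := Nat.pow_le_pow_right two_pos hb1
  · rw [← hB]
    have : (l / (2 * B) + 1 + 1) * B * 2 = 2 * B * (l / (2 * B)) + 4 * B := by ring
    omega
  · rw [← hB]
    have : 2 * ((l / (2 * B) + 1) * B) = 2 * B * (l / (2 * B)) + 2 * B := by ring
    omega

/-- The relation `R` leads from state `s` at time `0` to state `t` at some time after `l`. -/
def Reaches {n : ℕ} (R : ℕ → ℕ → ℕ → Prop) (l s t : Fin n) : Prop :=
  ∃ k e : Fin n, ((k : ℕ) + k = e ∧ (l : ℕ) < e) ∧ BlockChain R k s t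

theorem FODef.reaches {α β : Type}
    {R : ∀ n : ℕ, (Fin n → Bool) → (α → Fin n) → ℕ → ℕ → ℕ → Prop} (hR : FODefRel R) (g : α → β)
    (l s t : β) : FODef fun n x v => Reaches (R n x fun a => v (g a)) (v l) (v s) (v t) :=
  ex₁ <| ex₁ <| ((add _ _ _).and (lt _ _)).and <|
    blockChain hR (fun a => some (some (g a))) (some none) (some (some s)) (some (some t))

theorem Reaches.exists_time {n : ℕ} {R : ℕ → ℕ → ℕ → Prop} {l s t : Fin n} (h : Reaches R l s t) :
    ∃ m, (l : ℕ) < m ∧ Relation.ReflTransGen (TimedStep R) (0, s) (m, t) := by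
  obtain ⟨k, e, ⟨h1, h2⟩, h3⟩ := h
  exact ⟨2 * k, by omega, h3.reach⟩

/-- The end of the last block overshoots `l` by an uncontrolled amount. This is harmless because the
run is constant after time `l`. -/
theorem reaches_of_forall {n : ℕ} {l : Fin n} (hl : 2 ^ 13 ≤ (l : ℕ)) (hn : 2 ^ (l : ℕ) ≤ n)
    {R : ℕ → ℕ → ℕ → Prop} {σ : ℕ → ℕ} (hR : ∀ j, R j (σ j) (σ (j + 1)))
    (hσ : ∀ j, σ j ≤ 8 * l) {s t : Fin n} (hs : (s : ℕ) = σ 0) (ht : ∀ j, (l : ℕ) < j → σ j = t) :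
    Reaches R l s t := by
  obtain ⟨b, q, h1, h2, h3, h4⟩ := exists_block_size hl
  have hln : (l : ℕ) * l < n := by
    refine lt_of_lt_of_le ?_ hn
    have : ∀ l ≥ 5, l * l < 2 ^ l := by
      intro l hl
      induction l, hl using Nat.le_induction with
      | base => norm_num
      | succ l hl ih => rw [pow_succ]; nlinarith
    exact this l (by omega)
  have hqB : q * 2 ^ b + 2 ^ b ≤ l := by rwa [← Nat.succ_mul]
  have : 2 * (l : ℕ) ≤ l * l := Nat.mul_le_mul_right _ (by omega)
  have hb := Nat.two_pow_pos b
  refine ⟨⟨q * 2 ^ b, by omega⟩, ⟨2 * (q * 2 ^ b), by omega⟩, ⟨by simp only; omega, h4⟩,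
    blockChain_of_forall (b := b) (q := q) hR
    (fun j => (hσ j).trans_lt h1) ((Nat.pow_le_pow_right two_pos h2).trans hn)
    ((Nat.pow_le_pow_right two_pos h3).trans hn) (by omega) rfl hs (ht _ h4).symm⟩

/-! ### Definability of multiplication -/

/-- The step relation that counts the numbers that satisfy `A`. -/
def CountStep (A : ℕ → Prop) (i s t : ℕ) : Prop := (A i ∧ s + 1 = t) ∨ (¬ A i ∧ s = t)

/-- The statement that `t` numbers up to `l` satisfy `A`. -/
def HasCount {n : ℕ} (A : ℕ → Prop) (l t : Fin n) : Prop :=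
  ∃ z : Fin n, (z : ℕ) = 0 ∧ Reaches (CountStep A) l z t

theorem FODef.hasCount {α β : Type} {A : ∀ n : ℕ, (Fin n → Bool) → (α → Fin n) → ℕ → Prop}
    (hA : ∀ (β : Type) (g : α → β) (i : β), FODef fun n x v => A n x (fun a => v (g a)) (v i))
    (g : α → β) (l t : β) :
    FODef fun n x v => HasCount (A n x fun a => v (g a)) (v l) (v t) := by
  refine ex₁ <| (zero _).and <| reaches (R := fun n x v => CountStep (A n x v)) ?_
    (fun a => some (g a)) (some l) none (some t)
  intro β g i s t
  exact ((hA β g i).and (succ _ _)).or ((hA β g i).not.and (eq _ _))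

-- `CountStep` is deterministic, so the state of every run is the number of elements counted so far.
-- Stopping late does not change it, since `A` has no elements above `l`.
open Classical in
theorem hasCount_iff {n : ℕ} {A : ℕ → Prop} {l t : Fin n} (hl : 2 ^ 13 ≤ (l : ℕ))
    (hn : 2 ^ (l : ℕ) ≤ n) (hA : ∀ i, A i → i ≤ l) :
    HasCount A l t ↔ (t : ℕ) = ((Finset.range (l + 1)).filter A).card := by
  have step : ∀ m, ((Finset.range (m + 1)).filter A).card =
      ((Finset.range m).filter A).card + if A m then 1 else 0 := by
    intro m
    rw [Finset.range_add_one, Finset.filter_insert]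
    split_ifs <;> simp
  have stable : ∀ m, (l : ℕ) < m →
      ((Finset.range m).filter A).card = ((Finset.range (l + 1)).filter A).card := by
    intro m hm
    congr 1
    ext i
    simp only [Finset.mem_filter, Finset.mem_range]
    constructor
    · rintro ⟨_, h⟩; exact ⟨by have := hA i h; omega, h⟩
    · rintro ⟨_, h⟩; exact ⟨by omega, h⟩
  constructor
  · rintro ⟨z, hz, h⟩
    obtain ⟨m, hm, hr⟩ := h.exists_time
    rw [← stable m hm]
    have key : ∀ b : ℕ × ℕ, Relation.ReflTransGen (TimedStep (CountStep A)) (0, z) b →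
        b.2 = ((Finset.range b.1).filter A).card := by
      intro b hb
      induction hb with
      | refl => simp [hz]
      | tail _ h ih =>
        rw [h.1, step, ← ih]
        rcases h.2 with ⟨h1, h2⟩ | ⟨h1, h2⟩ <;> simp [h1, ← h2]
    exact key _ hr
  · intro ht
    refine ⟨⟨0, by omega⟩, rfl, reaches_of_forall hl hn
      (σ := fun m => ((Finset.range m).filter A).card) ?_ ?_ (by simp) ?_⟩
    · intro m
      simp only [CountStep, step]
      split_ifs with h <;> simp [h]
    · intro m
      rcases le_or_gt m l with h | h
      · exact (Finset.card_filter_le _ _).trans (by simp; omega)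
      · simp only [stable m h]
        exact (Finset.card_filter_le _ _).trans (by simp; omega)
    · intro m hm
      simp only [stable m hm, ht]

/-- The entries in column `i` of the multiplication of `x` and `y`. -/
def Column (x y i k : ℕ) : Prop := x.testBit k = true ∧ ∃ j, k + j = i ∧ y.testBit j = true

/-- The step relation between the carries in the multiplication of `x` and `y` with result `z`. -/
def CarryStep {n : ℕ} (l x y z : Fin n) (i s t : ℕ) : Prop :=
  ∃ c e f : Fin n, HasCount (Column x y i) l c ∧ ((c : ℕ) + s = e ∧ t + t = f) ∧
    (((z : ℕ).testBit i = true ∧ (f : ℕ) + 1 = e) ∨ (¬ (z : ℕ).testBit i = true ∧ (f : ℕ) = e))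

/-- The graph of multiplication, as it is defined by a formula. -/
def Mult {n : ℕ} (x y z : Fin n) : Prop :=
  -- The conditions force `l` to be the highest bit position that occurs in any position of the
  -- string. The run starts and ends with carry `u = 0`.
  ∃ l u : Fin n, (u : ℕ) = 0 ∧ (∃ a : Fin n, (a : ℕ).testBit l = true) ∧
    (∀ i a : Fin n, (a : ℕ).testBit i = true → (i : ℕ) ≤ l) ∧
    (∀ k j : Fin n, (x : ℕ).testBit k = true → (y : ℕ).testBit j = true →
      ∃ s : Fin n, (k : ℕ) + j = s ∧ (s : ℕ) ≤ l) ∧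
    Reaches (CarryStep l x y z) l u u

theorem FODef.column {β : Type} (x y i k : β) :
    FODef fun n _ v => Column (v x : Fin n) (v y) (v i) (v k) := by
  refine (bit _ _).and ((ex ((add (some k) none (some i)).and (bit none (some y)))).congr ?_)
  intro n _ _ v
  constructor
  · rintro ⟨a, h⟩; exact ⟨a, h⟩
  · rintro ⟨j, h⟩; exact ⟨⟨j, by have := h.1; have := (v i).2; omega⟩, h⟩

theorem FODef.carryStep {α : Type} (l x y z : α) : FODefRel fun n _ (v : α → Fin n) =>
    CarryStep (v l) (v x) (v y) (v z) := by
  intro β g i s t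
  refine ex₁ <| ex₁ <| ex₁ <| (hasCount (α := Fin 3)
    (A := fun n _ v => Column (v 0 : Fin n) (v 1) (v 2)) (fun β g i => column _ _ _ _)
    (fun a => some (some (some (![g x, g y, i] a)))) (some (some (some (g l)))) (some (some none))).and
    <| ((add _ _ _).and (add _ _ _)).and <| ((bit _ _).and (succ _ _)).or ((bit _ _).not.and (eq _ _))

theorem FODef.mult {α : Type} (x y z : α) : FODef fun n _ v => Mult (v x : Fin n) (v y) (v z) :=
  ex₁ <| ex₁ <| (zero _).and <| (ex₁ <| bit _ _).and <| (all₁ <| all₁ <| imp (bit _ _) (le _ _)).and <|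
    (all₁ <| all₁ <| imp (bit _ _) <| imp (bit _ _) <| ex₁ <| (add _ _ _).and (le _ _)).and <|
    reaches (α := Fin 4) (carryStep 0 1 2 3)
      ![some none, some (some x), some (some y), some (some z)] (some none) none none

theorem mod_two_pow_succ (x m : ℕ) :
    x % 2 ^ (m + 1) = x % 2 ^ m + 2 ^ m * (x.testBit m).toNat := by
  rw [pow_succ, Nat.mod_mul, Nat.toNat_testBit]

/-- The sum of the first `m` columns in the multiplication of `x` and `y`. -/
def partialProduct (l x y m : ℕ) : ℕ :=
  ∑ k ∈ Finset.range (l + 1), if x.testBit k = true then 2 ^ k * (y % 2 ^ (m - k)) else 0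

-- Row `k` of the school scheme is truncated to the columns below `m`; passing to `m + 1` adds at
-- most one bit of `y` to each row, and together these are the entries of column `m`.
open Classical in
theorem partialProduct_succ (l x y m : ℕ) : partialProduct l x y (m + 1) =
    partialProduct l x y m +
      2 ^ m * ((Finset.range (l + 1)).filter (Column x y m)).card := by
  rw [partialProduct, partialProduct, Finset.card_filter, Finset.mul_sum, ← Finset.sum_add_distrib]
  refine Finset.sum_congr rfl fun k _ => ?_
  unfold Column
  by_cases hx : x.testBit k = true
  swap
  · simp [hx]
  by_cases hk : k ≤ m
  · obtain ⟨j, rfl⟩ := Nat.exists_eq_add_of_le hk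
    have : (∃ i, k + i = k + j ∧ y.testBit i = true) ↔ y.testBit j = true :=
      ⟨fun ⟨i, h1, h2⟩ => by rwa [← Nat.add_left_cancel h1], fun h => ⟨j, rfl, h⟩⟩
    rw [show k + j + 1 - k = j + 1 by omega, Nat.add_sub_cancel_left, mod_two_pow_succ]
    simp only [hx, if_true, this, true_and]
    by_cases hy : y.testBit j = true <;> simp [hy, pow_add, mul_add]
  · have : ¬ ∃ i, k + i = m ∧ y.testBit i = true := fun ⟨i, h, _⟩ => hk (by omega)
    simp [this, show m + 1 - k = 0 by omega, show m - k = 0 by omega, Nat.mod_one]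

theorem sum_testBit {l x : ℕ} (hx : x < 2 ^ (l + 1)) :
    (∑ k ∈ Finset.range (l + 1), if x.testBit k = true then 2 ^ k else 0) = x := by
  have key : ∀ m, (∑ k ∈ Finset.range m, if x.testBit k = true then 2 ^ k else 0) = x % 2 ^ m := by
    intro m
    induction m with
    | zero => simp [Nat.mod_one]
    | succ m ih =>
      rw [Finset.sum_range_succ, ih, mod_two_pow_succ]
      by_cases h : x.testBit m = true <;> simp [h]
  rw [key, Nat.mod_eq_of_lt hx]

theorem partialProduct_eq {l x y m : ℕ} (hx : x < 2 ^ (l + 1))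
    (h : ∀ k j, x.testBit k = true → y.testBit j = true → k + j < m) :
    partialProduct l x y m = x * y := by
  conv_rhs => rw [← sum_testBit hx, Finset.sum_mul]
  refine Finset.sum_congr rfl fun k _ => ?_
  split_ifs with hk
  · rw [Nat.mod_eq_of_lt]
    refine Nat.lt_pow_two_of_testBit _ fun j hj => ?_
    by_contra hy
    have := h k j hk (by simpa using hy)
    omega
  · simp

theorem partialProduct_modEq {l x y m : ℕ} (hx : x < 2 ^ (l + 1)) :
    partialProduct l x y m ≡ x * y [MOD 2 ^ m] := by
  conv_rhs => rw [← sum_testBit hx, Finset.sum_mul]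
  refine Nat.ModEq.sum fun k _ => ?_
  split_ifs with hk
  · rcases le_total k m with h | h
    · have := (Nat.mod_modEq y (2 ^ (m - k))).mul_left' (2 ^ k)
      rwa [← pow_add, Nat.add_sub_cancel' h] at this
    · have h2 : 2 ^ k ≡ 0 [MOD 2 ^ m] := (Nat.modEq_zero_iff_dvd.2 (Nat.pow_dvd_pow 2 h))
      exact (h2.mul_right _).trans (by simpa using (h2.mul_right y).symm)
  · simp [Nat.ModEq.refl]

/-- Each truncated row is at most `2 ^ m`. Hence carries are at most `l + 1`, which keeps the states
of the computation short. -/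
theorem partialProduct_le (l x y m : ℕ) : partialProduct l x y m ≤ (l + 1) * 2 ^ m := by
  have := Finset.sum_le_card_nsmul (Finset.range (l + 1))
    (fun k => if x.testBit k = true then 2 ^ k * (y % 2 ^ (m - k)) else 0) (2 ^ m) ?_
  · simpa [partialProduct] using this
  · intro k _
    split_ifs
    · rcases le_total k m with h | h
      · calc 2 ^ k * (y % 2 ^ (m - k)) ≤ 2 ^ k * 2 ^ (m - k) :=
              Nat.mul_le_mul_left _ (Nat.mod_lt _ (Nat.two_pow_pos _)).le
          _ = 2 ^ m := by rw [← pow_add, Nat.add_sub_cancel' h]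
      · simp [show m - k = 0 by omega, Nat.mod_one]
    · exact Nat.zero_le _

open Classical in
theorem carryStep_iff {n : ℕ} {l x y z : Fin n} (hl : 2 ^ 13 ≤ (l : ℕ)) (hn : 2 ^ (l : ℕ) ≤ n)
    (hx : ∀ i, (x : ℕ).testBit i = true → i ≤ l) {i s t : ℕ} (hs : s ≤ 2 * l) :
    CarryStep l x y z i s t ↔
      ((Finset.range (l + 1)).filter (Column x y i)).card + s = 2 * t + ((z : ℕ).testBit i).toNat := by
  have hcard := (Finset.card_filter_le (Finset.range ((l : ℕ) + 1)) (Column x y i))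
  rw [Finset.card_range] at hcard
  -- The column sum plus the incoming carry is at most `3 * l + 1`, so the intermediate values are
  -- positions.
  have hln : 4 * (l : ℕ) < n := by
    refine lt_of_lt_of_le ?_ hn
    have : ∀ l ≥ 5, 4 * l < 2 ^ l := by
      intro l hl
      induction l, hl using Nat.le_induction with
      | base => norm_num
      | succ l hl ih => rw [pow_succ]; omega
    exact this l (by omega)
  unfold CarryStep
  simp only [hasCount_iff hl hn (A := Column x y i) fun k hk => hx k hk.1]
  generalize ((Finset.range ((l : ℕ) + 1)).filter (Column x y i)).card = w at *
  have hb := ((z : ℕ).testBit i).toNat_le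
  constructor
  · rintro ⟨c, e, f, h1, ⟨h2, h3⟩, ⟨h4, h5⟩ | ⟨h4, h5⟩⟩
    · simp only [h4, Bool.toNat_true]; omega
    · simp only [h4, Bool.toNat_false]; omega
  · intro h
    refine ⟨⟨w, by omega⟩, ⟨w + s, by omega⟩, ⟨t + t, by omega⟩, rfl, ⟨rfl, rfl⟩, ?_⟩
    · by_cases hz : (z : ℕ).testBit i = true
      · refine .inl ⟨hz, ?_⟩
        simp only [hz, Bool.toNat_true] at h
        simp only; omega
      · refine .inr ⟨hz, ?_⟩
        simp only [hz, Bool.toNat_false] at h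
        simp only; omega

-- The invariant at time `m` is: the sum of the first `m` columns equals `2 ^ m` times the carry
-- plus `z % 2 ^ m`. After time `l` all columns have been used and `z % 2 ^ m = z`, so the product
-- is `z` exactly if the final carry vanishes.
open Classical in
theorem mult_iff {M n : ℕ} (hM : 2 ^ 13 ≤ M) (hn : 2 ^ M < n) (x y z : Fin n) :
    Mult x y z ↔ (x : ℕ) * y = z := by
  constructor
  · rintro ⟨l, u, hu, ⟨a, ha⟩, h1, h2, h3⟩
    -- `2 ^ M` is itself a position, so its bit `M` bounds `l` from below.
    have hl : 2 ^ 13 ≤ (l : ℕ) :=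
      hM.trans (h1 ⟨M, Nat.lt_two_pow_self.trans hn⟩ ⟨2 ^ M, hn⟩ Nat.testBit_two_pow_self)
    have hln : 2 ^ (l : ℕ) ≤ n := (Nat.ge_two_pow_of_testBit ha).trans a.2.le
    have bitle : ∀ (a : Fin n) i, (a : ℕ).testBit i = true → i ≤ l := fun a i hi =>
      h1 ⟨i, testBit_lt_card hi⟩ a hi
    have bound : ∀ a : Fin n, (a : ℕ) < 2 ^ ((l : ℕ) + 1) := fun a =>
      Nat.lt_pow_two_of_testBit _ fun i hi => by
        by_contra hc
        have := bitle a i (by simpa using hc)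
        omega
    have colle : ∀ k j, (x : ℕ).testBit k = true → (y : ℕ).testBit j = true → k + j ≤ l := by
      intro k j hk hj
      obtain ⟨s, h4, h5⟩ := h2 ⟨k, testBit_lt_card hk⟩ ⟨j, testBit_lt_card hj⟩ hk hj
      exact h4.trans_le h5
    obtain ⟨m, hm, hr⟩ := h3.exists_time
    have key : ∀ b : ℕ × ℕ, Relation.ReflTransGen (TimedStep (CarryStep l x y z)) (0, u) b →
        partialProduct l x y b.1 = 2 ^ b.1 * b.2 + z % 2 ^ b.1 := by
      intro b hb
      induction hb with
      | refl => simp [hu, partialProduct, Nat.mod_one]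
      | @tail b c _ h ih =>
        -- The formula does not bound the carry; the bound follows from the invariant and
        -- `partialProduct_le`.
        have hle : b.2 ≤ 2 * l := by
          have h4 : 2 ^ b.1 * b.2 ≤ 2 ^ b.1 * (l + 1) := by
            rw [Nat.mul_comm _ ((l : ℕ) + 1)]
            exact le_trans (by omega) (partialProduct_le l x y b.1)
          have := Nat.le_of_mul_le_mul_left h4 (Nat.two_pow_pos _)
          omega
        have h5 := (carryStep_iff hl hln (bitle x) hle).1 h.2
        rw [h.1, partialProduct_succ, ih, mod_two_pow_succ, pow_succ]
        linear_combination 2 ^ b.1 * h5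
    have := key _ hr
    rw [partialProduct_eq (bound x) fun k j hk hj => (colle k j hk hj).trans_lt hm, hu,
      Nat.mod_eq_of_lt ((bound z).trans_le (Nat.pow_le_pow_right two_pos hm))] at this
    simpa using this
  · intro h
    have hl : 2 ^ 13 ≤ Nat.log 2 (n - 1) := hM.trans (Nat.le_log_of_pow_le (by norm_num) (Nat.le_sub_one_of_lt hn))
    have hln' : 2 ^ Nat.log 2 (n - 1) ≤ n - 1 := Nat.pow_log_le_self 2 (by have := Nat.two_pow_pos M; omega)
    have hln : 2 ^ Nat.log 2 (n - 1) ≤ n := by omega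
    have hnl : n - 1 < 2 ^ (Nat.log 2 (n - 1) + 1) := Nat.lt_pow_succ_log_self (by norm_num) _
    have hlt' : ∀ a : Fin n, (a : ℕ) < 2 ^ (Nat.log 2 (n - 1) + 1) := fun a => by omega
    have hlt : Nat.log 2 (n - 1) < n := Nat.lt_two_pow_self.trans_le hln
    set l : Fin n := ⟨Nat.log 2 (n - 1), hlt⟩ with hldef
    have bitle : ∀ (a : Fin n) i, (a : ℕ).testBit i = true → i ≤ l := by
      intro a i hi
      have := (Nat.ge_two_pow_of_testBit hi).trans_lt (hlt' a)
      have := (Nat.pow_lt_pow_iff_right (by norm_num : 1 < 2)).1 this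
      simp only [hldef]; omega
    have colle : ∀ k j, (x : ℕ).testBit k = true → (y : ℕ).testBit j = true → k + j ≤ l := by
      intro k j hk hj
      have h1 : 2 ^ (k + j) ≤ (z : ℕ) := by
        rw [pow_add, ← h]
        exact Nat.mul_le_mul (Nat.ge_two_pow_of_testBit hk) (Nat.ge_two_pow_of_testBit hj)
      have := h1.trans_lt (hlt' z)
      have := (Nat.pow_lt_pow_iff_right (by norm_num : 1 < 2)).1 this
      simp only [hldef]; omega
    have hdecomp : ∀ m, partialProduct l x y m =
        2 ^ m * (partialProduct l x y m / 2 ^ m) + z % 2 ^ m := by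
      intro m
      have := partialProduct_modEq (l := l) (y := y) (m := m) (hlt' x)
      rw [← h, ← this, Nat.div_add_mod]
    have hbound : ∀ m, partialProduct l x y m / 2 ^ m ≤ l + 1 := fun m =>
      (Nat.div_le_div_right (partialProduct_le l x y m)).trans
        (by rw [Nat.mul_div_cancel _ (Nat.two_pow_pos m)])
    refine ⟨l, ⟨0, by omega⟩, rfl, ⟨⟨_, hln'.trans_lt (by omega)⟩, Nat.testBit_two_pow_self⟩,
      fun i a => bitle a i, fun k j hk hj =>
      ⟨⟨k + j, (colle k j hk hj).trans_lt l.2⟩, rfl, colle k j hk hj⟩,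
      reaches_of_forall hl hln (σ := fun m => partialProduct l x y m / 2 ^ m) ?_ ?_ ?_ ?_⟩
    · intro m
      rw [carryStep_iff hl hln (bitle x) ((hbound m).trans (by simp only [hldef]; omega))]
      have h1 := (hdecomp (m + 1)).symm.trans (partialProduct_succ _ _ _ _)
      have h2 := hdecomp m
      generalize partialProduct l x y m / 2 ^ m = p at *
      generalize partialProduct l x y (m + 1) / 2 ^ (m + 1) = q at *
      rw [h2, mod_two_pow_succ, pow_succ] at h1
      refine Nat.eq_of_mul_eq_mul_left (Nat.two_pow_pos m) ?_
      linarith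
    · intro m
      have h2 : (l : ℕ) + 1 ≤ 8 * l := by simp only [hldef]; omega
      exact (hbound m).trans h2
    · simp [partialProduct, Nat.mod_one]
    · intro m hm
      have := partialProduct_eq (l := l) (m := m) (hlt' x) fun k j hk hj =>
        (colle k j hk hj).trans_lt hm
      simp only [this, h]
      refine Nat.div_eq_of_lt ((hlt' z).trans_le (Nat.pow_le_pow_right two_pos hm))

theorem FODef.mul {α : Type} (x y z : α) : FODef fun _ _ v => (v x : ℕ) * v y = v z :=
  (of_eventually (P := fun n (v : Fin 3 → Fin n) => (v 0 : ℕ) * v 1 = v 2) (mult 0 1 2)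
    (2 ^ 2 ^ 13 + 1) fun _ hn _ _ => mult_iff le_rfl hn _ _ _).rename ![x, y, z]

/-! ### Arithmetic expressions and their alternating normal forms. -/

/-! ### Arithmetic expressions over strings -/

/-- A number depending on a string and an assignment of positions to the variables in `α`. -/
abbrev StrFun (α : Type) : Type := ∀ n : ℕ, (Fin n → Bool) → (α → Fin n) → ℕ

open Classical in
/-- Functions obtained from `0` and `1` by sums and products over all positions and by case
distinctions. -/
inductive Arith : {α : Type} → StrFun α → Prop
  | zero {α : Type} : Arith (α := α) fun _ _ _ => 0
  | one {α : Type} : Arith (α := α) fun _ _ _ => 1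
  | sum {α : Type} {F : StrFun (Option α)} (hF : Arith F) :
      Arith fun n x v => ∑ a, F n x (ext v a)
  | prod {α : Type} {F : StrFun (Option α)} (hF : Arith F) :
      Arith fun n x v => ∏ a, F n x (ext v a)
  | iteLe {α : Type} (i j : α) {F G : StrFun α} (hF : Arith F) (hG : Arith G) :
      Arith fun n x v => if (v i : ℕ) ≤ v j then F n x v else G n x v
  | iteZero {α : Type} (i : α) {F G : StrFun α} (hF : Arith F) (hG : Arith G) :
      Arith fun n x v => if (v i : ℕ) = 0 then F n x v else G n x v
  | iteBit {α : Type} (i j : α) {F G : StrFun α} (hF : Arith F) (hG : Arith G) :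
      Arith fun n x v => if (v j : ℕ).testBit (v i) = true then F n x v else G n x v
  | iteOne {α : Type} (i : α) {F G : StrFun α} (hF : Arith F) (hG : Arith G) :
      Arith fun n x v => if x (v i) = true then F n x v else G n x v
  | congr {α : Type} {F G : StrFun α} (hF : Arith F)
      (h : ∀ n, 0 < n → ∀ x v, F n x v = G n x v) : Arith G

theorem ite_congr_decidable {p q : Prop} {_ : Decidable p} {_ : Decidable q} (h : p ↔ q)
    {a b : ℕ} : (if p then a else b) = if q then a else b := if_congr h rfl rfl

namespace Arith

theorem rename {α : Type} {F : StrFun α} (hF : Arith F) :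
    ∀ {β : Type} (g : α → β), Arith fun n x v => F n x fun i => v (g i) := by
  induction hF with
  | zero => exact fun g => zero
  | one => exact fun g => one
  | sum _ h =>
    intro β g
    refine (sum (h (Option.map g))).congr fun n _ x v => ?_
    simp only [ext_comp]
  | prod _ h =>
    intro β g
    refine (prod (h (Option.map g))).congr fun n _ x v => ?_
    simp only [ext_comp]
  | iteLe i j _ _ h₁ h₂ => exact fun g => iteLe (g i) (g j) (h₁ g) (h₂ g)
  | iteZero i _ _ h₁ h₂ => exact fun g => iteZero (g i) (h₁ g) (h₂ g)
  | iteBit i j _ _ h₁ h₂ => exact fun g => iteBit (g i) (g j) (h₁ g) (h₂ g)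
  | iteOne i _ _ h₁ h₂ => exact fun g => iteOne (g i) (h₁ g) (h₂ g)
  | congr _ h ih => exact fun g => (ih g).congr fun n hn x v => h n hn x _

theorem prod_ite_zero {n : ℕ} [∀ z : Fin n, Decidable ((z : ℕ) = 0)] (hn : 0 < n) (c : ℕ) :
    ∏ z : Fin n, (if (z : ℕ) = 0 then c else 1) = c := by
  rw [Finset.prod_eq_single (⟨0, hn⟩ : Fin n)]
  · simp
  · intro z _ hz
    rw [if_neg]
    exact fun h => hz (Fin.ext h)
  · simp

-- Exactly one summand survives: `u = 0` if `Q` holds everywhere, and otherwise the least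
-- counterexample `u`, whose product checks that `Q` holds below `u`. The value `f` or `g` enters as
-- the factor at `z = 0`. Only instances of `Q` itself are tested, which makes this usable in an
-- induction on formulas.
open Classical in
theorem sum_prod_counterexample {n : ℕ} (hn : 0 < n) (Q : Fin n → Prop) (f g : ℕ) :
    (∑ u : Fin n, ∏ z : Fin n,
      if Q u then
        if (u : ℕ) = 0 then if Q z then if (z : ℕ) = 0 then f else 1 else 0 else 0
      else
        if (u : ℕ) ≤ z then if (z : ℕ) = 0 then g else 1
        else if Q z then if (z : ℕ) = 0 then g else 1 else 0) =
    if ∀ a, Q a then f else g := by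
  split_ifs with h
  · rw [Finset.sum_eq_single (⟨0, hn⟩ : Fin n)]
    · simp only [h, if_true]
      exact prod_ite_zero hn f
    · intro u _ hu
      have hu' : ¬ (u : ℕ) = 0 := fun h => hu (Fin.ext h)
      refine Finset.prod_eq_zero (Finset.mem_univ u) ?_
      simp [h, hu']
    · simp
  · obtain ⟨u₀, h₀, hmin⟩ : ∃ u : Fin n, ¬ Q u ∧ ∀ z < u, Q z := by
      push Not at h
      obtain ⟨u, hu, hmin⟩ := WellFounded.has_min (wellFounded_lt (α := Fin n)) {u | ¬ Q u} h
      exact ⟨u, hu, fun z hz => by_contra fun hq => hmin z hq hz⟩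
    rw [Finset.sum_eq_single u₀]
    · simp only [h₀, if_false]
      refine Eq.trans ?_ (prod_ite_zero hn g)
      refine Finset.prod_congr rfl fun z _ => ?_
      by_cases hz : (u₀ : ℕ) ≤ z
      · simp [hz]
      · simp [hz, hmin z (not_le.1 hz)]
    · intro u _ hu
      by_cases hQ : Q u
      · refine Finset.prod_eq_zero (Finset.mem_univ u₀) ?_
        simp [hQ, h₀]
      · have hlt : u₀ < u := by
          rcases lt_trichotomy u u₀ with h1 | h1 | h1
          · exact absurd (hmin u h1) hQ
          · exact absurd h1 hu
          · exact h1
        refine Finset.prod_eq_zero (Finset.mem_univ u₀) ?_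
        have : ¬ (u : ℕ) ≤ u₀ := not_le.2 hlt
        simp [hQ, h₀, this]
    · simp

-- Renamings are part of the statement because a universal quantifier needs the induction hypothesis
-- twice, at the candidate `u` and at the tested position `z`.
open Classical in
theorem ite_rename {α : Type} {P : StrPred α} (hP : FODef P) :
    ∀ {β : Type} (g : α → β) {F G : StrFun β}, Arith F → Arith G →
      Arith fun n x v => if P n x (fun i => v (g i)) then F n x v else G n x v := by
  induction hP with
  | le i j => exact fun g _ _ hF hG =>
    (iteLe (g i) (g j) hF hG).congr fun _ _ _ _ => ite_congr_decidable Iff.rfl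
  | bit i j => exact fun g _ _ hF hG =>
    (iteBit (g i) (g j) hF hG).congr fun _ _ _ _ => ite_congr_decidable Iff.rfl
  | one i => exact fun g _ _ hF hG =>
    (iteOne (g i) hF hG).congr fun _ _ _ _ => ite_congr_decidable Iff.rfl
  | fls => exact fun g _ _ hF hG => hG.congr fun n _ x v => by simp
  | imp _ _ h₁ h₂ =>
    refine fun g _ _ hF hG => (h₁ g (h₂ g hF hG) hF).congr fun n _ x v => ?_
    split_ifs <;> tauto
  | @all α P _ h =>
    intro β g F G hF hG
    have zf := iteZero none (hF.rename fun i => some (some i)) (one (α := Option (Option β)))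
    have zg := iteZero none (hG.rename fun i => some (some i)) (one (α := Option (Option β)))
    -- The quantified variable becomes the outer variable `u` under `gu` and the inner variable `z`
    -- under `gz`.
    let gu : Option α → Option (Option β) := fun o => o.elim (some none) fun i => some (some (g i))
    let gz : Option α → Option (Option β) := fun o => o.elim none fun i => some (some (g i))
    have body := h gu (iteZero (some none) (h gz zf zero) zero)
      (iteLe (some none) none zg (h gz zg zero))
    refine (sum (prod body)).congr fun n hn x v => ?_
    refine Eq.trans ?_ ((sum_prod_counterexample hn (fun a => P n x (ext (fun i => v (g i)) a))
      (F n x v) (G n x v)).trans (ite_congr_decidable Iff.rfl))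
    refine Finset.sum_congr rfl fun u _ => Finset.prod_congr rfl fun z _ => ?_
    have e1 : (fun i => ext (ext v u) z (gu i)) = ext (fun i => v (g i)) u := by
      funext i; cases i <;> rfl
    have e2 : (fun i => ext (ext v u) z (gz i)) = ext (fun i => v (g i)) z := by
      funext i; cases i <;> rfl
    simp only [e1, e2]
    rfl
  | congr _ h ih =>
    refine fun g _ _ hF hG => (ih g hF hG).congr fun n hn x v => ?_
    simp only [h n hn]

open Classical in
/-- Case distinctions over all first-order definable predicates. -/
theorem ite {α : Type} {P : StrPred α} (hP : FODef P) {F G : StrFun α} (hF : Arith F)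
    (hG : Arith G) : Arith fun n x v => if P n x v then F n x v else G n x v :=
  ite_rename hP id hF hG

/-- Move the first of several variables to a context. -/
def moveHead {α : Type} {k : ℕ} : α ⊕ Fin (k + 1) → Option α ⊕ Fin k :=
  Sum.elim (fun i => .inl (some i)) (Fin.cases (.inl none) .inr)

theorem elim_moveHead {α β : Type} {k : ℕ} (v : α → β) (b : β) (a : Fin k → β) :
    (fun i => Sum.elim (ext v b) a (moveHead i)) = Sum.elim v (Fin.cons b a : Fin (k + 1) → β) := by
  funext i
  rcases i with i | i
  · rfl
  · refine Fin.cases rfl (fun j => rfl) i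

theorem sumTuple {α ι : Type} [Fintype ι] [DecidableEq ι] {F : StrFun (α ⊕ ι)} (hF : Arith F) :
    Arith fun n x v => ∑ a : ι → Fin n, F n x (Sum.elim v a) := by
  have key : ∀ (k : ℕ) {α : Type} {F : StrFun (α ⊕ Fin k)}, Arith F →
      Arith fun n x v => ∑ a : Fin k → Fin n, F n x (Sum.elim v a) := by
    intro k
    induction k with
    | zero =>
      intro α F hF
      refine (hF.rename (Sum.elim id Fin.elim0)).congr fun n _ x v => ?_
      rw [Fintype.sum_unique]
      congr 1
      funext i
      rcases i with i | i
      exacts [rfl, i.elim0]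
    | succ k ih =>
      intro α F hF
      refine (sum (ih (hF.rename moveHead))).congr fun n _ x v => ?_
      simp only [elim_moveHead]
      rw [← (Fin.consEquiv fun _ : Fin (k + 1) => Fin n).sum_comp, Fintype.sum_prod_type]
      rfl
  let e := Fintype.equivFin ι
  refine (key _ (hF.rename (Sum.map id e))).congr fun n _ x v => ?_
  rw [← (e.arrowCongr (Equiv.refl (Fin n))).sum_comp]
  refine Finset.sum_congr rfl fun a _ => congrArg _ ?_
  funext i
  rcases i with i | i <;> simp

theorem prodTuple {α ι : Type} [Fintype ι] [DecidableEq ι] {F : StrFun (α ⊕ ι)} (hF : Arith F) :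
    Arith fun n x v => ∏ a : ι → Fin n, F n x (Sum.elim v a) := by
  have key : ∀ (k : ℕ) {α : Type} {F : StrFun (α ⊕ Fin k)}, Arith F →
      Arith fun n x v => ∏ a : Fin k → Fin n, F n x (Sum.elim v a) := by
    intro k
    induction k with
    | zero =>
      intro α F hF
      refine (hF.rename (Sum.elim id Fin.elim0)).congr fun n _ x v => ?_
      rw [Fintype.prod_unique]
      congr 1
      funext i
      rcases i with i | i
      exacts [rfl, i.elim0]
    | succ k ih =>
      intro α F hF
      refine (prod (ih (hF.rename moveHead))).congr fun n _ x v => ?_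
      simp only [elim_moveHead]
      rw [← (Fin.consEquiv fun _ : Fin (k + 1) => Fin n).prod_comp, Fintype.prod_prod_type]
      rfl
  let e := Fintype.equivFin ι
  refine (key _ (hF.rename (Sum.map id e))).congr fun n _ x v => ?_
  rw [← (e.arrowCongr (Equiv.refl (Fin n))).prod_comp]
  refine Finset.prod_congr rfl fun a _ => congrArg _ ?_
  funext i
  rcases i with i | i <;> simp

/-- Over a single position every sum and product has one term. For words of length one the circuit
can therefore be a single leaf. -/
theorem le_one {α : Type} {F : StrFun α} (hF : Arith F) : ∀ x v, F 1 x v ≤ 1 := by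
  induction hF with
  | zero => simp
  | one => simp
  | sum _ h => exact fun x v => by simpa using h x (ext v 0)
  | prod _ h => exact fun x v => by simpa using h x (ext v 0)
  | congr _ h ih => exact fun x v => (h 1 one_pos x v) ▸ ih x v
  | iteLe _ _ _ _ h₁ h₂ => exact fun x v => by dsimp only; split_ifs; exacts [h₁ x v, h₂ x v]
  | iteZero _ _ _ h₁ h₂ => exact fun x v => by dsimp only; split_ifs; exacts [h₁ x v, h₂ x v]
  | iteBit _ _ _ _ h₁ h₂ => exact fun x v => by dsimp only; split_ifs; exacts [h₁ x v, h₂ x v]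
  | iteOne _ _ _ h₁ h₂ => exact fun x v => by dsimp only; split_ifs; exacts [h₁ x v, h₂ x v]

end Arith

/-! ### Alternating sums and products -/

/-- The value of `d` alternations of a sum over `Z i` and a product over `Fin n`. -/
def altVal (n : ℕ) : (d : ℕ) → (Z : ℕ → Type) → [∀ i, Fintype (Z i)] →
    ((Fin d → Fin n) → ((i : Fin d) → Z i) → ℕ) → ℕ
  | 0, _, _, M => M Fin.elim0 fun i => i.elim0
  | d + 1, Z, _, M => ∑ z : Z 0, ∏ b : Fin n, altVal n d (fun i => Z (i + 1)) fun ys zs =>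
      M (Fin.cons b ys) (Fin.cons (α := fun i => Z i) z zs)

/-- The first `i` entries of a tuple. -/
def prefixTuple {d : ℕ} {β : Type} (ys : Fin d → β) (i : Fin d) : Fin i → β :=
  fun j => ys ⟨j, j.2.trans i.2⟩

theorem prefixTuple_cons_succ {d : ℕ} {β : Type} (b : β) (ys : Fin d → β) (i : Fin d) :
    prefixTuple (Fin.cons b ys : Fin (d + 1) → β) i.succ =
      (Fin.cons b (prefixTuple ys i) : Fin (i + 1) → β) := by
  funext j
  refine Fin.cases rfl (fun j => rfl) j

theorem eval_cons {n d : ℕ} {Z : ℕ → Type} (f : (i : Fin (d + 1)) → (Fin i → Fin n) → Z i)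
    (b : Fin n) (ys : Fin d → Fin n) :
    (fun i => f i (prefixTuple (Fin.cons b ys) i)) =
      (Fin.cons (α := fun i : Fin (d + 1) => Z i) (f 0 Fin.elim0)
        fun i => f i.succ (Fin.cons b (prefixTuple ys i))) := by
  funext i
  refine Fin.cases ?_ (fun i => ?_) i
  · exact congrArg (f 0) (funext fun j => j.elim0)
  · exact congrArg (f i.succ) (prefixTuple_cons_succ b ys i)

/-- Splitting off the outermost sum and product when counting Skolem functions. -/
def skolemEquiv {n d : ℕ} {Z : ℕ → Type}
    (M : (Fin (d + 1) → Fin n) → ((i : Fin (d + 1)) → Z i) → Prop) :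
    {f : (i : Fin (d + 1)) → (Fin i → Fin n) → Z i //
      ∀ ys, M ys fun i => f i (prefixTuple ys i)} ≃
    Σ z : Z 0, (b : Fin n) → {g : (i : Fin d) → (Fin i → Fin n) → Z (i + 1) //
      ∀ ys, M (Fin.cons b ys)
        (Fin.cons (α := fun i => Z i) z fun i => g i (prefixTuple ys i))} where
  toFun f := ⟨f.1 0 Fin.elim0, fun b => ⟨fun i t => f.1 i.succ (Fin.cons b t), fun ys => by
    have := f.2 (Fin.cons b ys)
    rwa [eval_cons f.1] at this⟩⟩
  invFun p := ⟨Fin.cons (α := fun i : Fin (d + 1) => (Fin i → Fin n) → Z i) (fun _ => p.1)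
      fun i t => (p.2 (t ⟨0, i.succ_pos⟩)).1 i fun j => t j.succ, fun ys => by
    have := (p.2 (ys 0)).2 (Fin.tail ys)
    rw [← Fin.cons_self_tail ys, eval_cons]
    exact this⟩
  left_inv f := by
    refine Subtype.ext (funext fun i => ?_)
    refine Fin.cases ?_ (fun i => ?_) i
    · funext t
      exact congrArg (f.1 0) (funext fun j => j.elim0)
    · funext t
      refine congrArg (f.1 i.succ) ?_
      funext j
      rcases j with ⟨_ | j, hj⟩ <;> rfl
  right_inv p := rfl

-- The function at index 0 is a constant `z`. Once `z` is fixed, the restrictions of the other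
-- functions to the different first arguments `b` can be chosen independently, so the count is a sum
-- over `z` of a product over `b` of counts of the same kind.
open Classical in
theorem card_skolem {n : ℕ} (d : ℕ) (Z : ℕ → Type) [∀ i, Fintype (Z i)]
    (M : (Fin d → Fin n) → ((i : Fin d) → Z i) → Prop) :
    Nat.card {f : (i : Fin d) → (Fin i → Fin n) → Z i //
      ∀ ys, M ys fun i => f i (prefixTuple ys i)} =
    altVal n d Z fun ys zs => if M ys zs then 1 else 0 := by
  induction d generalizing Z with
  | zero =>
    have e : ∀ f : (i : Fin 0) → (Fin i → Fin n) → Z i,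
        (∀ ys, M ys fun i => f i (prefixTuple ys i)) ↔ M Fin.elim0 fun i => i.elim0 := by
      intro f
      constructor
      · intro h
        convert h Fin.elim0 using 1
      · intro h ys
        convert h using 1
    simp only [altVal]
    split_ifs with h
    · rw [Nat.card_congr (Equiv.subtypeUnivEquiv fun f => (e f).2 h)]
      simp
    · have : IsEmpty {f : (i : Fin 0) → (Fin i → Fin n) → Z i //
          ∀ ys, M ys fun i => f i (prefixTuple ys i)} := ⟨fun f => h ((e f.1).1 f.2)⟩
      exact Nat.card_of_isEmpty
  | succ d ih =>
    rw [Nat.card_congr (skolemEquiv M), Nat.card_sigma]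
    refine Finset.sum_congr rfl fun z _ => ?_
    rw [Nat.card_pi]
    exact Finset.prod_congr rfl fun b _ => ih (fun i => Z (i + 1)) fun ys zs =>
      M (Fin.cons b ys) (Fin.cons (α := fun i => Z i) z zs)

/-! ### Alternating normal forms of arithmetic expressions -/

/-- Functions that are given by `d` alternations of a sum and a product over all positions of the
string, applied to a function in the class `base`, for all strings of length at least `m`. -/
def AltForm (base : {α : Type} → StrFun α → Prop) (m : ℕ) : ℕ → {α : Type} → StrFun α → Prop
  | 0, _, F => base F
  | d + 1, α, F => ∃ G : StrFun (Option (Option α)), AltForm base m d G ∧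
      ∀ n, m ≤ n → ∀ x v, F n x v = ∑ a, ∏ b, G n x (ext (ext v a) b)

open Classical in
/-- A class of functions that contains `0` and `1` and admits case distinctions by `cond`. -/
structure IsBase (base : {α : Type} → StrFun α → Prop) (cond : {α : Type} → StrPred α → Prop)
    (m : ℕ) : Prop where
  pos : 0 < m
  zero {α : Type} : base (α := α) fun _ _ _ => 0
  one {α : Type} : base (α := α) fun _ _ _ => 1
  rename {α β : Type} (g : α → β) {F : StrFun α} :
    base F → base fun n x v => F n x fun i => v (g i)
  congr {α : Type} {F G : StrFun α} : base F → (∀ n, m ≤ n → ∀ x v, F n x v = G n x v) → base G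
  ite {α : Type} {P : StrPred α} {F G : StrFun α} : cond P → base F → base G →
    base fun n x v => if P n x v then F n x v else G n x v
  cond_rename {α β : Type} (g : α → β) {P : StrPred α} :
    cond P → cond fun n x v => P n x fun i => v (g i)
  cond_zero {α : Type} (i : α) : cond fun _ _ v => (v i : ℕ) = 0

namespace IsBase

variable {base : {α : Type} → StrFun α → Prop} {cond : {α : Type} → StrPred α → Prop} {m : ℕ}

theorem altForm_congr (h : IsBase base cond m) {d : ℕ} {α : Type} {F G : StrFun α}
    (hF : AltForm base m d F) (hFG : ∀ n, m ≤ n → ∀ x v, F n x v = G n x v) :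
    AltForm base m d G := by
  cases d with
  | zero => exact h.congr hF hFG
  | succ d =>
    obtain ⟨H, h1, h2⟩ := hF
    exact ⟨H, h1, fun n hn x v => (hFG n hn x v).symm.trans (h2 n hn x v)⟩

theorem altForm_rename (h : IsBase base cond m) {d : ℕ} {α : Type} {F : StrFun α}
    (hF : AltForm base m d F) {β : Type} (g : α → β) :
    AltForm base m d fun n x v => F n x fun i => v (g i) := by
  induction d generalizing α β with
  | zero => exact h.rename g hF
  | succ d ih =>
    obtain ⟨H, h1, h2⟩ := hF
    refine ⟨_, ih h1 (Option.map (Option.map g)), fun n hn x v => ?_⟩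
    simp only [h2 n hn, ext_comp]

-- The condition does not involve the bound variables of the sums and products, so it can be pushed
-- through them into the kernel.
open Classical in
theorem altForm_ite (h : IsBase base cond m) {d : ℕ} {α : Type} {P : StrPred α} {F G : StrFun α}
    (hP : cond P) (hF : AltForm base m d F) (hG : AltForm base m d G) :
    AltForm base m d fun n x v => if P n x v then F n x v else G n x v := by
  induction d generalizing α with
  | zero => exact h.ite hP hF hG
  | succ d ih =>
    obtain ⟨F', h1, h2⟩ := hF
    obtain ⟨G', h3, h4⟩ := hG
    refine ⟨_, ih (h.cond_rename (fun i => some (some i)) hP) h1 h3, fun n hn x v => ?_⟩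
    simp only [h2 n hn, h4 n hn]
    change _ = ∑ a, ∏ b, if P n x v then _ else _
    split_ifs <;> rfl

theorem altForm_const (h : IsBase base cond m) {c : ℕ} (hc : c ≤ 1) (d : ℕ) {α : Type} :
    AltForm base m d (α := α) fun _ _ _ => c := by
  classical
  induction d generalizing α c with
  | zero =>
    obtain rfl | rfl : c = 0 ∨ c = 1 := by omega
    exacts [h.zero, h.one]
  | succ d ih =>
    refine ⟨_, h.altForm_ite (h.cond_zero (some none)) (ih hc) (ih zero_le_one), fun n hn x v => ?_⟩
    have hn0 : 0 < n := h.pos.trans_le hn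
    simp only [ext]
    rw [Finset.sum_eq_single (⟨0, hn0⟩ : Fin n)]
    · obtain rfl | rfl : c = 0 ∨ c = 1 := by omega
      · simp [hn0.ne']
      · simp
    · intro z _ hz
      have hz' : ¬ (z : ℕ) = 0 := fun h => hz (Fin.ext h)
      simp [hz', hn0.ne']
    · simp

-- The additional alternation is inserted innermost. It is trivial: the kernel counts only at `a =
-- 0` and `b = 0`, with default 0 in the sum and 1 in the product.
open Classical in
theorem altForm_pad (h : IsBase base cond m) {d : ℕ} {α : Type} {F : StrFun α}
    (hF : AltForm base m d F) : AltForm base m (d + 1) F := by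
  induction d generalizing α with
  | zero =>
    refine ⟨_, h.ite (h.cond_zero (some none)) (h.ite (h.cond_zero none)
      (h.rename (fun i => some (some i)) hF) h.one) h.zero, fun n hn x v => ?_⟩
    have hn0 : 0 < n := h.pos.trans_le hn
    simp only [ext]
    rw [Finset.sum_eq_single (⟨0, hn0⟩ : Fin n)]
    · simp only [if_true]
      exact (Arith.prod_ite_zero hn0 _).symm.trans
        (Finset.prod_congr rfl fun b _ => ite_congr_decidable Iff.rfl)
    · intro z _ hz
      have hz' : ¬ (z : ℕ) = 0 := fun h => hz (Fin.ext h)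
      simp [hz', hn0.ne']
    · simp
  | succ d ih =>
    obtain ⟨G, h1, h2⟩ := hF
    exact ⟨G, ih h1, h2⟩

theorem altForm_mono (h : IsBase base cond m) {d e : ℕ} (hde : d ≤ e) {α : Type} {F : StrFun α}
    (hF : AltForm base m d F) : AltForm base m e F := by
  induction e, hde using Nat.le_induction with
  | base => exact hF
  | succ e _ ih => exact h.altForm_pad ih

theorem altForm_sum (h : IsBase base cond m) {d : ℕ} {α : Type} {F : StrFun (Option α)}
    (hF : AltForm base m d F) : AltForm base m (d + 1) fun n x v => ∑ a, F n x (ext v a) := by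
  refine ⟨_, h.altForm_ite (h.cond_zero none) (h.altForm_rename hF some)
    (h.altForm_const le_rfl d), fun n hn x v => ?_⟩
  exact Finset.sum_congr rfl fun a _ => ((Arith.prod_ite_zero (h.pos.trans_le hn) _).symm.trans
    (Finset.prod_congr rfl fun b _ => ite_congr_decidable Iff.rfl))

theorem altForm_prod (h : IsBase base cond m) {d : ℕ} {α : Type} {F : StrFun (Option α)}
    (hF : AltForm base m d F) : AltForm base m (d + 1) fun n x v => ∏ a, F n x (ext v a) := by
  classical
  refine ⟨_, h.altForm_ite (h.cond_zero (some none)) (h.altForm_rename hF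
    fun o => o.elim none fun i => some (some i)) (h.altForm_const zero_le_one d),
    fun n hn x v => ?_⟩
  have hn0 : 0 < n := h.pos.trans_le hn
  have e : ∀ a b : Fin n, (fun i : Option α => ext (ext v a) b
      (i.elim none fun i => some (some i))) = ext v b := by
    intro a b; funext i; cases i <;> rfl
  simp only [e]
  simp only [ext]
  rw [Finset.sum_eq_single (⟨0, hn0⟩ : Fin n)]
  · simp only [if_true]
  · intro z _ hz
    have hz' : ¬ (z : ℕ) = 0 := fun h => hz (Fin.ext h)
    simp [hz', hn0.ne']
  · simp

end IsBase

variable {base : {α : Type} → StrFun α → Prop} {cond : {α : Type} → StrPred α → Prop} {m : ℕ}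

theorem Arith.altForm (h : IsBase base cond m)
    (hle : ∀ {α : Type} (i j : α), cond fun _ _ v => (v i : ℕ) ≤ v j)
    (hbit : ∀ {α : Type} (i j : α), cond fun _ _ v => (v j : ℕ).testBit (v i) = true)
    (hone : ∀ {α : Type} (i : α) (d : ℕ) {F G : StrFun α}, AltForm base m d F →
      AltForm base m d G → ∃ e, AltForm base m e fun n x v =>
        if x (v i) = true then F n x v else G n x v)
    {α : Type} {F : StrFun α} (hF : Arith F) : ∃ d, AltForm base m d F := by
  classical
  have cases : ∀ {α : Type} {P : StrPred α} {F G : StrFun α}, cond P →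
      (∃ d, AltForm base m d F) → (∃ d, AltForm base m d G) →
      ∃ d, AltForm base m d fun n x v => if P n x v then F n x v else G n x v := by
    rintro α P F G hP ⟨d, h1⟩ ⟨e, h2⟩
    exact ⟨max d e, h.altForm_ite hP (h.altForm_mono (le_max_left _ _) h1)
      (h.altForm_mono (le_max_right _ _) h2)⟩
  induction hF with
  | zero => exact ⟨0, h.zero⟩
  | one => exact ⟨0, h.one⟩
  | sum _ ih =>
    obtain ⟨d, hd⟩ := ih
    exact ⟨d + 1, h.altForm_sum hd⟩
  | prod _ ih =>
    obtain ⟨d, hd⟩ := ih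
    exact ⟨d + 1, h.altForm_prod hd⟩
  | iteLe i j _ _ h₁ h₂ =>
    obtain ⟨d, hd⟩ := cases (hle i j) h₁ h₂
    exact ⟨d, h.altForm_congr hd fun _ _ _ _ => ite_congr_decidable Iff.rfl⟩
  | iteZero i _ _ h₁ h₂ =>
    obtain ⟨d, hd⟩ := cases (h.cond_zero i) h₁ h₂
    exact ⟨d, h.altForm_congr hd fun _ _ _ _ => ite_congr_decidable Iff.rfl⟩
  | iteBit i j _ _ h₁ h₂ =>
    obtain ⟨d, hd⟩ := cases (hbit i j) h₁ h₂
    exact ⟨d, h.altForm_congr hd fun _ _ _ _ => ite_congr_decidable Iff.rfl⟩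
  | iteOne i _ _ h₁ h₂ =>
    obtain ⟨d, hd⟩ := h₁
    obtain ⟨e, he⟩ := h₂
    exact hone i (max d e) (h.altForm_mono (le_max_left _ _) hd)
      (h.altForm_mono (le_max_right _ _) he)
  | congr _ hFG ih =>
    obtain ⟨d, hd⟩ := ih
    exact ⟨d, h.altForm_congr hd fun n hn => hFG n (h.pos.trans_le hn)⟩

/-- Renaming of variables that splits off the variables of the outermost sum and product. -/
def flattenVar {α : Type} {d : ℕ} :
    Option (Option α) ⊕ (Fin d ⊕ Fin d) → α ⊕ (Fin (d + 1) ⊕ Fin (d + 1)) :=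
  Sum.elim (fun o => o.elim (.inr (.inl 0)) fun o => o.elim (.inr (.inr 0)) .inl)
    (.inr ∘ Sum.map Fin.succ Fin.succ)

theorem IsBase.flatten (h : IsBase base cond m) {d : ℕ} {α : Type} {F : StrFun α}
    (hF : AltForm base m d F) : ∃ B : StrFun (α ⊕ (Fin d ⊕ Fin d)), base B ∧
      ∀ n, m ≤ n → ∀ x v, F n x v = altVal n d (fun _ => Fin n) fun ys zs =>
        B n x (Sum.elim v (Sum.elim ys zs)) := by
  induction d generalizing α with
  | zero => exact ⟨_, h.rename .inl hF, fun n _ x v => rfl⟩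
  | succ d ih =>
    obtain ⟨G, h1, h2⟩ := hF
    obtain ⟨B, h3, h4⟩ := ih h1
    refine ⟨_, h.rename flattenVar h3, fun n hn x v => ?_⟩
    rw [h2 n hn]
    refine Finset.sum_congr rfl fun a _ => Finset.prod_congr rfl fun b _ => ?_
    rw [h4 n hn]
    congr 1
    funext ys zs
    congr 1
    funext i
    rcases i with (_ | _ | i) | i | i <;> rfl

/-! ### Quantifier-free predicates -/

/-- Predicates that are definable by quantifier-free formulae. -/
inductive QFDef {α : Type} : StrPred α → Prop
  | le (i j : α) : QFDef fun _ _ v => (v i : ℕ) ≤ v j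
  | bit (i j : α) : QFDef fun _ _ v => (v j : ℕ).testBit (v i) = true
  | zero (i : α) : QFDef fun _ _ v => (v i : ℕ) = 0
  | one (i : α) : QFDef fun _ x v => x (v i) = true
  | fls : QFDef fun _ _ _ => False
  | imp {P Q : StrPred α} (hP : QFDef P) (hQ : QFDef Q) : QFDef fun n x v => P n x v → Q n x v

theorem QFDef.rename {α β : Type} (g : α → β) {P : StrPred α} (hP : QFDef P) :
    QFDef fun n x v => P n x fun i => v (g i) := by
  induction hP with
  | le i j => exact le (g i) (g j)
  | bit i j => exact bit (g i) (g j)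
  | zero i => exact zero (g i)
  | one i => exact one (g i)
  | fls => exact fls
  | imp _ _ h₁ h₂ => exact imp h₁ h₂

open Classical in
/-- Indicator functions of quantifier-free predicates. -/
def QFBase {α : Type} (F : StrFun α) : Prop :=
  ∃ P : StrPred α, QFDef P ∧ ∀ n, 1 ≤ n → ∀ x v, F n x v = if P n x v then 1 else 0

theorem isBase_qfBase : IsBase QFBase QFDef 1 where
  pos := one_pos
  zero := ⟨_, .fls, fun n _ x v => by simp⟩
  one := ⟨_, .imp .fls .fls, fun n _ x v => by simp⟩
  rename g := fun ⟨P, h1, h2⟩ => ⟨_, h1.rename g, fun n hn x v => h2 n hn x _⟩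
  congr := fun ⟨P, h1, h2⟩ h => ⟨P, h1, fun n hn x v => (h n hn x v).symm.trans (h2 n hn x v)⟩
  ite := fun {α P F G} hP ⟨A, h1, h2⟩ ⟨B, h3, h4⟩ => by
    -- The case distinction is `(P → A) ∧ (¬ P → B)`, written with implication and falsum.
    refine ⟨_, .imp (.imp (hP.imp h1) ((hP.imp .fls).imp h3 |>.imp .fls)) .fls, fun n hn x v => ?_⟩
    simp only [h2 n hn, h4 n hn]
    by_cases hp : P n x v <;> by_cases ha : A n x v <;> by_cases hb : B n x v <;> simp [hp, ha, hb]
  cond_rename g := fun h => h.rename g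
  cond_zero := .zero

/-- Every arithmetic expression has an alternating normal form with a quantifier-free kernel. -/
theorem Arith.qfNormalForm {α : Type} {F : StrFun α} (hF : Arith F) :
    ∃ d, AltForm QFBase 1 d F := by
  refine hF.altForm isBase_qfBase .le .bit fun i d F G h1 h2 => ⟨d, ?_⟩
  exact isBase_qfBase.altForm_congr (isBase_qfBase.altForm_ite (.one i) h1 h2)
    fun _ _ _ _ => ite_congr_decidable Iff.rfl

/-! ### Arithmetic expressions yield prefix formulae. -/

/-! ### From arithmetic expressions to prefix formulae -/

/-- The vocabulary of binary strings: one unary relation symbol. -/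
def stringVoc : Vocabulary := ⟨1, fun _ => 1, 0⟩

/-- The term for a variable of the normal form: a universally quantified variable, or a Skolem
function applied to the universally quantified variables that precede it. -/
def skolemTerm {d : ℕ} :
    Empty ⊕ (Fin d ⊕ Fin d) → (stringVoc.lang (Fin.val : Fin d → ℕ)).Term (Fin 0 ⊕ Fin d)
  | .inl e => e.elim
  | .inr (.inl j) => .var (.inr j)
  | .inr (.inr i) => .func (.funVar i : stringVoc.Func (Fin.val : Fin d → ℕ) i)
      fun j => .var (.inr ⟨j, j.2.trans i.2⟩)

theorem skolemTerm_restricted {d : ℕ} (i : Empty ⊕ (Fin d ⊕ Fin d)) :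
    TermRestricted (skolemTerm i) := by
  rcases i with e | j | i
  · exact e.elim
  · simp [skolemTerm, TermRestricted]
  · refine ⟨fun j => ⟨j.2.trans i.2, rfl⟩, fun j => ?_⟩
    simp [TermRestricted]

/-- The structure of a binary string over the vocabulary `stringVoc`. -/
def stringStruc {n : ℕ} (x : Fin n → Bool) : stringVoc.Struc n := ⟨fun _ t => x (t (0 : Fin 1)), Fin.elim0⟩

/-- The assignment to the variables of the normal form that is given by Skolem functions. -/
def skolemVal {n d : ℕ} (F : (i : Fin d) → (Fin i → Fin n) → Fin n) (ys : Fin d → Fin n) :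
    Empty ⊕ (Fin d ⊕ Fin d) → Fin n :=
  Sum.elim Empty.elim (Sum.elim ys fun i => F i (prefixTuple ys i))

theorem realize_skolemTerm {n d : ℕ} [NeZero n] (x : Fin n → Bool)
    (F : (i : Fin d) → (Fin i → Fin n) → Fin n) (ys : Fin d → Fin n)
    (c : Fin 0 → Fin n) (i : Empty ⊕ (Fin d ⊕ Fin d)) :
    @FirstOrder.Language.Term.realize _ _ ((stringStruc x).expand F) _ (Sum.elim c ys)
      (skolemTerm i) = skolemVal F ys i := by
  rcases i with e | j | i
  · exact e.elim
  · rfl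
  · rfl

open FirstOrder.Language in
theorem QFDef.exists_matrix {d : ℕ} {P : StrPred (Empty ⊕ (Fin d ⊕ Fin d))} (hP : QFDef P) :
    ∃ ψ : (stringVoc.lang (Fin.val : Fin d → ℕ)).BoundedFormula (Fin 0) d, ψ.IsQF ∧ Restricted ψ ∧
      ∀ (n : ℕ) [NeZero n] (x : Fin n → Bool) F (ys : Fin d → Fin n) (c : Fin 0 → Fin n),
        @BoundedFormula.Realize _ _ ((stringStruc x).expand F) _ _ ψ c ys ↔
          P n x (skolemVal F ys) := by
  induction hP with
  | le i j =>
    refine ⟨.rel (.le : stringVoc.Rel 2) ![skolemTerm i, skolemTerm j],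
      (BoundedFormula.IsAtomic.rel _ _).isQF, ?_, fun n _ x F ys c => ?_⟩
    · intro k
      fin_cases k <;> exact skolemTerm_restricted _
    · simp only [← realize_skolemTerm x F ys c]
      rfl
  | bit i j =>
    refine ⟨.rel (.bit : stringVoc.Rel 2) ![skolemTerm i, skolemTerm j],
      (BoundedFormula.IsAtomic.rel _ _).isQF, ?_, fun n _ x F ys c => ?_⟩
    · intro k
      fin_cases k <;> exact skolemTerm_restricted _
    · simp only [← realize_skolemTerm x F ys c]
      rfl
  | zero i =>
    refine ⟨.equal (skolemTerm i) (.func (.min : stringVoc.Func (Fin.val : Fin d → ℕ) 0) Fin.elim0),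
      (BoundedFormula.IsAtomic.equal _ _).isQF, ⟨skolemTerm_restricted _, trivial, fun j => j.elim0⟩,
      fun n _ x F ys c => ?_⟩
    simp only [← realize_skolemTerm x F ys c]
    exact Fin.ext_iff
  | one i =>
    refine ⟨.rel (.rel (0 : Fin 1) : stringVoc.Rel 1) fun _ => skolemTerm i,
      (BoundedFormula.IsAtomic.rel _ _).isQF, ?_, fun n _ x F ys c => ?_⟩
    · intro k
      exact skolemTerm_restricted i
    simp only [← realize_skolemTerm x F ys c]
    rfl
  | fls => exact ⟨⊥, .falsum, trivial, fun n _ x F ys c => Iff.rfl⟩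
  | imp _ _ h₁ h₂ =>
    obtain ⟨ψ, h1, h2, h3⟩ := h₁
    obtain ⟨χ, h4, h5, h6⟩ := h₂
    refine ⟨ψ.imp χ, h1.imp h4, ⟨h2, h5⟩, fun n _ x F ys c => ?_⟩
    exact imp_congr (h3 n x F ys c) (h6 n x F ys c)

theorem enc_stringVoc {n : ℕ} (A : stringVoc.Struc n) :
    A.enc = List.ofFn fun i => A.rel (0 : Fin 1) fun _ => i := by
  have h : ∀ t : Fin n, (Fin.cons t Fin.elim0 : Fin 1 → Fin n) = fun _ => t := by
    intro t; funext i; fin_cases i; rfl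
  rw [List.ofFn_eq_map]
  have e : A.enc = (((List.finRange n).flatMap fun t =>
      [(Fin.cons t Fin.elim0 : Fin 1 → Fin n)]).map (A.rel (0 : Fin 1)) ++ []) ++ [] := rfl
  rw [e, List.append_nil, List.append_nil]
  generalize A.rel (0 : Fin 1) = r
  simp only [h]
  rw [List.map_eq_flatMap (f := fun i => r fun _ => i)]
  exact List.map_flatMap

theorem stringStruc_rel {n : ℕ} (A : stringVoc.Struc n) :
    stringStruc (fun i => A.rel (0 : Fin 1) fun _ => i) = A := by
  obtain ⟨r, c⟩ := A
  unfold stringStruc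
  congr 1
  · funext i t
    obtain rfl : i = (0 : Fin 1) := Subsingleton.elim (α := Fin 1) _ _
    exact congrArg (r (0 : Fin 1)) (funext fun j => congrArg t (Subsingleton.elim (α := Fin 1) _ _))
  · funext i
    exact Fin.elim0 i

theorem eval_ofFn (F : StrFun Empty) {n : ℕ} (g : Fin n → Bool) (l : List Bool)
    (h : l = List.ofFn g) : F l.length l.get Empty.elim = F n g Empty.elim := by
  have hn : l.length = n := by rw [h, List.length_ofFn]
  subst hn
  congr 1
  funext i
  rw [List.get_eq_getElem, ← List.getElem_ofFn (f := g) (i := i) (by simp)]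
  simp only [← h]

/-- The formula has `d` universal variables and one function variable of each arity below `d`. With
one unary relation symbol, every nonempty word is its own encoding, so no word has to be sent to 0.
-/
theorem Arith.mem_sharpPiOnePrefixClass {F : StrFun Empty} (hF : Arith F) {f : Word → ℕ}
    (hf : ∀ w : Word, f w = F w.1.length w.1.get Empty.elim) : f ∈ SharpPiOnePrefixClass := by
  classical
  obtain ⟨d, hd⟩ := hF.qfNormalForm
  obtain ⟨B, ⟨P, hP, hB⟩, h⟩ := isBase_qfBase.flatten hd
  obtain ⟨ψ, h1, h2, h3⟩ := hP.exists_matrix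
  let φ : RestrictedPiOne stringVoc := ⟨d, Fin.val, 0, d, ψ, h1, h2⟩
  refine ⟨stringVoc, ⟨(0 : Fin 1), one_pos⟩, φ, fun n hn A w hw => ?_, fun w hw => (hw ?_).elim⟩
  · rw [enc_stringVoc] at hw
    have count : ∀ x : Fin n → Bool, φ.count (stringStruc x) = F n x Empty.elim := by
      intro x
      rw [h n (NeZero.pos n)]
      simp only [hB n (NeZero.pos n)]
      rw [← card_skolem d (fun _ => Fin n) fun ys zs => P n x (Sum.elim Empty.elim (Sum.elim ys zs))]
      refine Nat.card_congr ((Equiv.prodUnique _ _).subtypeEquiv fun p => ?_)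
      refine (@FirstOrder.Language.BoundedFormula.realize_alls _ _ ((stringStruc x).expand p.1)
        _ _ _ _).trans (forall_congr' fun ys => ?_)
      exact h3 n x p.1 ys p.2
    rw [hf, eval_ofFn F _ _ hw.symm, ← count, stringStruc_rel]
  · refine ⟨w.1.length, ⟨fun h0 => w.2 (List.eq_nil_of_length_eq_zero h0)⟩, stringStruc w.1.get, ?_⟩
    rw [enc_stringVoc]
    exact List.ofFn_get w.1

open FirstOrder

/-! ### Uniform circuit families yield arithmetic expressions. -/

/-! ### Formulae over strings define definable predicates -/

/-- The variable that a term over the relational vocabulary of strings consists of. -/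
def stringTermVar {α : Type} : stringLang.Term α → α
  | .var i => i
  | .func f _ => (nomatch (f : Empty))

theorem realize_stringTerm {α : Type} {n : ℕ} (x : Fin n → Bool) (v : α → Fin n)
    (t : stringLang.Term α) :
    @Language.Term.realize _ _ (stringStructure x) _ v t = v (stringTermVar t) := by
  cases t with
  | var i => rfl
  | func f _ => exact (nomatch (f : Empty))

theorem FODef.of_boundedFormula {α : Type} {k : ℕ} (φ : stringLang.BoundedFormula α k) :
    FODef fun n x (v : α ⊕ Fin k → Fin n) =>
      @Language.BoundedFormula.Realize _ _ (stringStructure x) _ _ φ (fun i => v (.inl i))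
        fun i => v (.inr i) := by
  have hv : ∀ {k n : ℕ} (v : α ⊕ Fin k → Fin n),
      Sum.elim (fun i => v (.inl i)) (fun i => v (.inr i)) = v := by
    intro k n v; funext i; cases i <;> rfl
  induction φ with
  | falsum => exact fls
  | equal t₁ t₂ =>
    refine (FODef.eq (stringTermVar t₁) (stringTermVar t₂)).congr fun n _ x v => ?_
    simp only [Language.BoundedFormula.Realize, realize_stringTerm, hv, Fin.ext_iff]
  | rel R ts =>
    cases R with
    | le =>
      refine (le (stringTermVar (ts 0)) (stringTermVar (ts 1))).congr fun n _ x v => ?_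
      simp only [Language.BoundedFormula.Realize, realize_stringTerm, hv]
      rfl
    | bit =>
      refine (bit (stringTermVar (ts 0)) (stringTermVar (ts 1))).congr fun n _ x v => ?_
      simp only [Language.BoundedFormula.Realize, realize_stringTerm, hv]
      rfl
    | one =>
      refine (one (stringTermVar (ts 0))).congr fun n _ x v => ?_
      simp only [Language.BoundedFormula.Realize, realize_stringTerm, hv]
      rfl
  | imp _ _ h₁ h₂ => exact h₁.imp h₂
  | @all k φ h =>
    refine (FODef.all (h.rename fun i : α ⊕ Fin (k + 1) => (Sum.elim (fun i => some (.inl i))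
      (Fin.lastCases none fun j => some (.inr j)) i : Option (α ⊕ Fin k)))).congr
      fun _ _ x v => forall_congr' fun a => ?_
    refine iff_of_eq (congrArg₂ (@Language.BoundedFormula.Realize _ _ (stringStructure x) _ _ φ)
      rfl (funext fun i => ?_))
    refine Fin.lastCases ?_ (fun j => ?_) i
    · simp [ext]
    · simp [ext]

theorem FODef.of_formula {α : Type} (φ : stringLang.Formula α) :
    FODef fun _ x v => @Language.Formula.Realize _ _ (stringStructure x) _ φ v := by
  refine ((of_boundedFormula φ).rename (Sum.elim id Fin.elim0)).congr fun _ _ x v => ?_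
  refine iff_of_eq (congrArg₂ (@Language.BoundedFormula.Realize _ _ (stringStructure x) _ _ φ)
      rfl (funext fun i => i.elim0))

/-! ### Counting proof trees recursively -/

namespace Circuit

variable {n : ℕ} (C : Circuit n) (x : Fin n → Bool)

theorem not_inner_of_leafTrue {s : GateKind n} {x : Fin n → Bool} (h : s.LeafTrue x) :
    ¬ s.Inner := by
  rintro (rfl | rfl) <;> exact h

/-- Proof trees of an and-gate. -/
def proofTreeAnd {g : C.Gate} (h : C.kind g = .and) :
    C.ProofTree x g ≃ ((c : {c // C.child g c}) → C.ProofTree x c) where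
  toFun t := match t with
    | .leaf _ h' => (not_inner_of_leafTrue h' (.inl h)).elim
    | .and _ _ t => fun c => t c.1 c.2
    | .or _ h' _ _ _ => by rw [h] at h'; cases h'
  invFun t := .and g h fun c hc => t ⟨c, hc⟩
  left_inv t := by
    cases t with
    | leaf _ h' => exact (not_inner_of_leafTrue h' (.inl h)).elim
    | and _ _ t => rfl
    | or _ h' _ _ _ => rw [h] at h'; cases h'
  right_inv t := rfl

/-- Proof trees of an or-gate. -/
def proofTreeOr {g : C.Gate} (h : C.kind g = .or) :
    C.ProofTree x g ≃ (Σ c : {c // C.child g c}, C.ProofTree x c) where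
  toFun t := match t with
    | .leaf _ h' => (not_inner_of_leafTrue h' (.inr h)).elim
    | .and _ h' _ => by rw [h] at h'; cases h'
    | .or _ _ c hc t => ⟨⟨c, hc⟩, t⟩
  invFun t := .or g h t.1.1 t.1.2 t.2
  left_inv t := by
    cases t with
    | leaf _ h' => exact (not_inner_of_leafTrue h' (.inr h)).elim
    | and _ h' _ => rw [h] at h'; cases h'
    | or _ _ c hc t => rfl
  right_inv t := rfl

/-- Proof trees of a leaf. -/
def proofTreeLeaf {g : C.Gate} (h : ¬ (C.kind g).Inner) :
    C.ProofTree x g ≃ PLift ((C.kind g).LeafTrue x) where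
  toFun t := match t with
    | .leaf _ h' => ⟨h'⟩
    | .and _ h' _ => (h (.inl h')).elim
    | .or _ h' _ _ _ => (h (.inr h')).elim
  invFun t := .leaf g t.1
  left_inv t := by
    cases t with
    | leaf _ h' => rfl
    | and _ h' _ => exact (h (.inl h')).elim
    | or _ h' _ _ _ => exact (h (.inr h')).elim
  right_inv t := rfl

theorem wellFounded_child : WellFounded fun a b => C.child b a := by
  have := C.finite
  let r : C.Gate → C.Gate → Prop := fun a b => Relation.TransGen C.child b a
  have : IsTrans C.Gate r := ⟨fun a b c h1 h2 => Relation.TransGen.trans h2 h1⟩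
  have : Std.Irrefl r := ⟨C.acyclic⟩
  exact Subrelation.wf (fun h => Relation.TransGen.single h)
    (Finite.wellFounded_of_trans_of_irrefl r)

theorem finite_proofTree (g : C.Gate) : Finite (C.ProofTree x g) := by
  have := C.finite
  induction g using C.wellFounded_child.induction with
  | _ g ih =>
    have : ∀ c : {c // C.child g c}, Finite (C.ProofTree x c) := fun c => ih c.1 c.2
    by_cases h : (C.kind g).Inner
    · rcases h with h | h
      · exact Finite.of_equiv _ (C.proofTreeAnd x h).symm
      · exact Finite.of_equiv _ (C.proofTreeOr x h).symm
    · exact Finite.of_equiv _ (C.proofTreeLeaf x h).symm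

/-- The number of proof trees at a gate. -/
noncomputable def treeCount (g : C.Gate) : ℕ := Nat.card (C.ProofTree x g)

theorem treeCount_and [Fintype C.Gate] {g : C.Gate} [Fintype {c // C.child g c}]
    (h : C.kind g = .and) :
    C.treeCount x g = ∏ c : {c // C.child g c}, C.treeCount x c := by
  rw [treeCount, Nat.card_congr (C.proofTreeAnd x h), Nat.card_pi]
  rfl

theorem treeCount_or [Fintype C.Gate] {g : C.Gate} [Fintype {c // C.child g c}]
    (h : C.kind g = .or) :
    C.treeCount x g = ∑ c : {c // C.child g c}, C.treeCount x c := by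
  have := C.finite_proofTree x
  rw [treeCount, Nat.card_congr (C.proofTreeOr x h), Nat.card_sigma]
  rfl

open Classical in
theorem treeCount_leaf {g : C.Gate} (h : ¬ (C.kind g).Inner) :
    C.treeCount x g = if (C.kind g).LeafTrue x then 1 else 0 := by
  rw [treeCount, Nat.card_congr (C.proofTreeLeaf x h)]
  split_ifs with hl
  · have : Unique (PLift ((C.kind g).LeafTrue x)) := ⟨⟨⟨hl⟩⟩, fun _ => rfl⟩
    exact Nat.card_unique
  · have : IsEmpty (PLift ((C.kind g).LeafTrue x)) := ⟨fun h => hl h.1⟩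
    exact Nat.card_of_isEmpty

/-- Every path from the gate `g` to a leaf has at most `d` gates. -/
def HeightLE (g : C.Gate) (d : ℕ) : Prop :=
  ∀ (p : List C.Gate) (h : p ≠ []), p.IsChain C.child → p.head h = g →
    ¬ (C.kind (p.getLast h)).Inner → p.length ≤ d

theorem HeightLE.child {C : Circuit n} {g c : C.Gate} {d : ℕ} (h : C.HeightLE g (d + 1))
    (hc : C.child g c) : C.HeightLE c d := by
  intro p hp h1 h2 h3
  have := h (g :: p) (by simp) (by
    cases p with
    | nil => exact (hp rfl).elim
    | cons a p =>
      simp only [List.head_cons] at h2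
      exact List.isChain_cons_cons.2 ⟨h2 ▸ hc, h1⟩) rfl (by rwa [List.getLast_cons hp])
  simpa using this

/-- Some path from every gate ends in a leaf, by well-founded induction. This makes the base case of
`gateValue_eq` vacuous. -/
theorem not_heightLE_zero (g : C.Gate) : ¬ C.HeightLE g 0 := by
  suffices h : ∃ (p : List C.Gate) (h : p ≠ []), p.IsChain C.child ∧ p.head h = g ∧
      ¬ (C.kind (p.getLast h)).Inner by
    obtain ⟨p, hp, h1, h2, h3⟩ := h
    intro h0
    exact hp (List.eq_nil_of_length_eq_zero (Nat.le_zero.1 (h0 p hp h1 h2 h3)))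
  induction g using C.wellFounded_child.induction with
  | _ g ih =>
    by_cases h : (C.kind g).Inner
    · obtain ⟨c, hc⟩ := (C.inner_iff g).1 h
      obtain ⟨p, hp, h1, h2, h3⟩ := ih c hc
      refine ⟨g :: p, by simp, ?_, rfl, by rwa [List.getLast_cons hp]⟩
      cases p with
      | nil => exact (hp rfl).elim
      | cons a p =>
        simp only [List.head_cons] at h2
        exact List.isChain_cons_cons.2 ⟨h2 ▸ hc, h1⟩
    · exact ⟨[g], by simp, by simp, rfl, h⟩

end Circuit

/-! ### From uniform circuit families to arithmetic expressions -/

namespace FOInterpretation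

variable (I : FOInterpretation stringLang circLang)

/-- The relation symbol `R` of circuits, applied to names of gates. -/
def Holds {a : ℕ} (R : CircRel a) (n : ℕ) (x : Fin n → Bool) (v : Fin a → Fin I.k → Fin n) : Prop :=
  @Language.Formula.Realize _ _ (stringStructure x) _ (I.rel (R : circLang.Relations a))
    fun q => v q.1 q.2

/-- A tuple names a gate. -/
def IsGate (n : ℕ) (x : Fin n → Bool) (b : Fin I.k → Fin n) : Prop :=
  @Language.Formula.Realize _ _ (stringStructure x) _ I.univ b

theorem foDef_holds {a : ℕ} (R : CircRel a) {α : Type} (g : Fin a → Fin I.k → α) :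
    FODef fun n x v => I.Holds R n x fun i j => v (g i j) :=
  (FODef.of_formula (I.rel (R : circLang.Relations a))).rename fun q => g q.1 q.2

theorem foDef_isGate {α : Type} (g : Fin I.k → α) :
    FODef fun n x v => I.IsGate n x fun j => v (g j) :=
  (FODef.of_formula I.univ).rename g

open Classical in
/-- The number of proof trees at the gate with a given name, for gates of height at most `m`. -/
noncomputable def gateValue : ℕ → StrFun (Fin I.k)
  | 0 => fun _ _ _ => 0
  | m + 1 => fun n x b =>
    if I.Holds .B n x (fun _ => b) then 1
    else if I.Holds .and n x (fun _ => b) then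
      ∏ c : Fin I.k → Fin n,
        if I.IsGate n x c ∧ I.Holds .E n x ![b, c] then gateValue m n x c else 1
    else if I.Holds .or n x (fun _ => b) then
      ∑ c : Fin I.k → Fin n,
        if I.IsGate n x c ∧ I.Holds .E n x ![b, c] then gateValue m n x c else 0
    else 0

theorem arith_gateValue (m : ℕ) : Arith (I.gateValue m) := by
  classical
  induction m with
  | zero => exact .zero
  | succ m ih =>
    have hE : FODef fun n x (v : Fin I.k ⊕ Fin I.k → Fin n) => (I.IsGate n x fun j => v (.inr j)) ∧
        I.Holds .E n x ![fun j => v (.inl j), fun j => v (.inr j)] := by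
      refine (I.foDef_isGate _).and ((I.foDef_holds .E ![.inl, .inr]).congr fun n _ x v => ?_)
      refine iff_of_eq (congrArg _ ?_)
      funext i
      fin_cases i <;> rfl
    exact .ite (I.foDef_holds .B fun _ j => j) .one <| .ite (I.foDef_holds .and fun _ j => j)
      ((Arith.prodTuple (.ite hE (ih.rename .inr) .one)).congr fun _ _ _ _ =>
        Finset.prod_congr rfl fun _ _ => ite_congr_decidable Iff.rfl) <|
        .ite (I.foDef_holds .or fun _ j => j)
      ((Arith.sumTuple (.ite hE (ih.rename .inr) .zero)).congr fun _ _ _ _ =>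
        Finset.sum_congr rfl fun _ _ => ite_congr_decidable Iff.rfl) .zero

/-- The sums and products run over all tuples, but tuples that do not name a child contribute the
neutral element, and each child has exactly one name. -/
theorem gateValue_eq {n : ℕ} {C : Circuit n} {x : Fin n → Bool} {e : C.Gate ↪ (Fin I.k → Fin n)}
    (h1 : ∀ b, b ∈ Set.range e ↔ I.IsGate n x b)
    (h2 : ∀ {a : ℕ} (R : CircRel a) (v : Fin a → C.Gate),
      @Language.Structure.RelMap circLang _ (C.toStructure x) a R v ↔
        I.Holds R n x fun i => e (v i))
    (m : ℕ) (g : C.Gate) (hg : C.HeightLE g m) : I.gateValue m n x (e g) = C.treeCount x g := by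
  classical
  have := C.finite
  have := Fintype.ofFinite C.Gate
  induction m generalizing g with
  | zero => exact (C.not_heightLE_zero g hg).elim
  | succ m ih =>
    have hB : I.Holds .B n x (fun _ => e g) ↔ (C.kind g).LeafTrue x := (h2 .B fun _ => g).symm
    have hand : I.Holds .and n x (fun _ => e g) ↔ C.kind g = .and := (h2 .and fun _ => g).symm
    have hor : I.Holds .or n x (fun _ => e g) ↔ C.kind g = .or := (h2 .or fun _ => g).symm
    have hE : ∀ c, I.Holds .E n x ![e g, e c] ↔ C.child g c := by
      intro c
      refine Iff.trans (iff_of_eq (congrArg _ ?_)) (h2 .E ![g, c]).symm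
      funext i
      fin_cases i <;> rfl
    have inj : Function.Injective fun c : {c // C.child g c} => e c :=
      e.injective.comp Subtype.val_injective
    have hin : ∀ c : {c // C.child g c}, I.IsGate n x (e c) ∧ I.Holds .E n x ![e g, e c] :=
      fun c => ⟨(h1 _).1 ⟨c, rfl⟩, (hE c).2 c.2⟩
    have hout : ∀ b, b ∉ Set.range (fun c : {c // C.child g c} => e c) →
        ¬ (I.IsGate n x b ∧ I.Holds .E n x ![e g, b]) := by
      rintro b hb ⟨h3, h4⟩
      obtain ⟨c, rfl⟩ := (h1 b).2 h3
      exact hb ⟨⟨c, (hE c).1 h4⟩, rfl⟩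
    rw [gateValue]
    simp only [hB, hand, hor]
    by_cases hinner : (C.kind g).Inner
    · have hl : ¬ (C.kind g).LeafTrue x := fun h => Circuit.not_inner_of_leafTrue h hinner
      rw [if_neg hl]
      rcases hinner with h | h
      · rw [if_pos h, C.treeCount_and x h]
        refine (Fintype.prod_of_injective _ inj _ _ (fun b hb => if_neg (hout b hb))
          fun c => ?_).symm
        rw [if_pos (hin c), ih c (hg.child c.2)]
      · rw [if_neg (by rw [h]; exact fun h => by cases h), if_pos h, C.treeCount_or x h]
        refine (Fintype.sum_of_injective _ inj _ _ (fun b hb => if_neg (hout b hb))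
          fun c => ?_).symm
        rw [if_pos (hin c), ih c (hg.child c.2)]
    · rw [C.treeCount_leaf x hinner, if_neg fun h => hinner (.inl h), if_neg fun h => hinner (.inr h)]

end FOInterpretation

theorem exists_arith_of_mem_foUniform {f : Word → ℕ} (hf : f ∈ FOUniformSharpACZero) :
    ∃ F : StrFun Empty, Arith F ∧ ∀ w : Word, f w = F w.1.length w.1.get Empty.elim := by
  classical
  obtain ⟨C, ⟨I, hI⟩, -, ⟨d, hd⟩, hC⟩ := hf
  refine ⟨fun n x v => ∑ b : Fin I.k → Fin n, if I.IsGate n x b ∧ I.Holds .r n x (fun _ => b)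
    then I.gateValue (d + 1) n x b else 0, ?_, fun w => ?_⟩
  · exact (Arith.sumTuple (α := Empty) (.ite
      ((I.foDef_isGate .inr).and (I.foDef_holds .r fun _ => .inr))
      ((I.arith_gateValue (d + 1)).rename .inr) .zero)).congr fun _ _ _ _ =>
        Finset.sum_congr rfl fun _ _ => ite_congr_decidable Iff.rfl
  · obtain ⟨e, he⟩ := hI w.1.length (List.length_pos_iff.2 w.2)
    obtain ⟨h1, h2⟩ := he w.1.get
    dsimp only
    rw [hC w, Finset.sum_eq_single (e (C w.1.length).root)]
    · rw [if_pos ⟨(h1 _).1 ⟨_, rfl⟩, (h2 (CircRel.r : circLang.Relations 1) fun _ => _).1 rfl⟩]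
      exact (I.gateValue_eq h1 h2 _ _ (hd _)).symm
    · intro b _ hb
      refine if_neg ?_
      rintro ⟨h3, h4⟩
      obtain ⟨g, rfl⟩ := (h1 b).2 h3
      exact hb (congrArg e ((h2 (CircRel.r : circLang.Relations 1) fun _ => g).2 h4))
    · simp

/-! ### Arithmetic expressions yield uniform circuit families. -/

/-! ### Normal forms with literals as leaves -/

open Classical in
/-- Functions that are the truth value of a literal or constant that depends on the assignment. -/
def LeafBase {α : Type} (F : StrFun α) : Prop :=
  ∃ κ : ∀ n : ℕ, (α → Fin n) → GateKind n, (∀ n v, ¬ (κ n v).Inner) ∧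
    FODef (fun n x v => (κ n v).LeafTrue x) ∧
    ∀ n, 2 ≤ n → ∀ x v, F n x v = if (κ n v).LeafTrue x then 1 else 0

/-- Definable predicates that do not depend on the bits of the string. -/
def StaticDef {α : Type} (P : StrPred α) : Prop :=
  ∃ Q : ∀ n : ℕ, (α → Fin n) → Prop, FODef (fun n _ v => Q n v) ∧ P = fun n _ v => Q n v

theorem not_inner_const {n : ℕ} (b : Bool) : ¬ (GateKind.const b : GateKind n).Inner := by
  rintro (h | h) <;> cases h

theorem not_inner_lit {n : ℕ} (i : Fin n) (b : Bool) : ¬ (GateKind.lit i b).Inner := by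
  rintro (h | h) <;> cases h

theorem isBase_leafBase : IsBase LeafBase StaticDef 2 where
  pos := two_pos
  zero := ⟨fun _ _ => .const false, fun _ _ => not_inner_const _, .const _,
    fun _ _ _ _ => by simp [GateKind.LeafTrue]⟩
  one := ⟨fun _ _ => .const true, fun _ _ => not_inner_const _, .const _,
    fun _ _ _ _ => by simp [GateKind.LeafTrue]⟩
  rename g := fun ⟨κ, h1, h2, h3⟩ => ⟨fun n v => κ n fun i => v (g i), fun n v => h1 n _,
    h2.rename g, fun n hn x v => h3 n hn x _⟩
  congr := fun ⟨κ, h1, h2, h3⟩ h => ⟨κ, h1, h2, fun n hn x v =>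
    (h n hn x v).symm.trans (h3 n hn x v)⟩
  ite := by
    classical
    rintro α P F G ⟨Q, hQ, rfl⟩ ⟨κ, h1, h2, h3⟩ ⟨ν, h4, h5, h6⟩
    refine ⟨fun n v => if Q n v then κ n v else ν n v, fun n v => ?_, ?_, fun n hn x v => ?_⟩
    · dsimp only
      split_ifs
      exacts [h1 n v, h4 n v]
    · refine ((hQ.and h2).or (hQ.not.and h5)).congr fun n _ x v => ?_
      by_cases h : Q n v <;> simp [h]
    · simp only [h3 n hn, h6 n hn]
      by_cases h : Q n v <;> simp [h]
  cond_rename g := by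
    rintro P ⟨Q, hQ, rfl⟩
    exact ⟨_, hQ.rename g, rfl⟩
  cond_zero i := ⟨_, .zero i, rfl⟩

/-- One alternation can express a sum of two binary products, using positions 0 and 1 of each
variable. This is where length at least two is needed for normal forms with static leaves. -/
theorem sum_prod_two {n : ℕ} (hn : 2 ≤ n) (a b c d : ℕ) :
    ∑ u : Fin n, ∏ y : Fin n, (if (u : ℕ) = 0 then
        if (y : ℕ) = 0 then a else if (y : ℕ) = 1 then b else 1
      else if (u : ℕ) = 1 then if (y : ℕ) = 0 then c else if (y : ℕ) = 1 then d else 1 else 0) =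
    a * b + c * d := by
  obtain ⟨k, rfl⟩ := Nat.exists_eq_add_of_le' hn
  rw [Fin.sum_univ_succ, Fin.sum_univ_succ]
  simp [Fin.prod_univ_succ]

/-- Every arithmetic expression has an alternating normal form with literals as leaves. -/
theorem Arith.leafNormalForm {α : Type} {F : StrFun α} (hF : Arith F) :
    ∃ d, AltForm LeafBase 2 d F := by
  classical
  have hone : ∀ {α : Type} (k : α), StaticDef fun n _ (v : α → Fin n) => (v k : ℕ) = 1 :=
    fun k => ⟨_, .numeral 1 k, rfl⟩
  have hlit : ∀ {α : Type} (i : α) (b : Bool) (d : ℕ),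
      AltForm LeafBase 2 d (α := α) fun n x v => if (x (v i) ^^ b) = true then 1 else 0 := by
    intro α i b d
    refine isBase_leafBase.altForm_mono (Nat.zero_le d) ⟨fun n v => .lit (v i) b,
      fun _ _ => not_inner_lit _ _, ?_, fun _ _ _ _ => ite_congr_decidable Iff.rfl⟩
    cases b with
    | false => exact (FODef.one i).congr fun _ _ _ _ => by simp [GateKind.LeafTrue]
    | true => exact (FODef.one i).not.congr fun _ _ _ _ => by simp [GateKind.LeafTrue]
  refine hF.altForm isBase_leafBase (fun i j => ⟨_, .le i j, rfl⟩) (fun i j => ⟨_, .bit i j, rfl⟩)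
    fun {α} i d {F G} h1 h2 => ⟨d + 1, ?_⟩
  have h0 := isBase_leafBase.altForm_const (le_refl 1) d (α := Option (Option α))
  -- A test of the bit `x` is `x * F + (1 - x) * G`, the factors `x` and `1 - x` being literals.
  refine ⟨_, isBase_leafBase.altForm_ite (isBase_leafBase.cond_zero (some none))
    (isBase_leafBase.altForm_ite (isBase_leafBase.cond_zero none) (hlit (some (some i)) false d)
      (isBase_leafBase.altForm_ite (hone none)
        (isBase_leafBase.altForm_rename h1 fun i => some (some i)) h0))
    (isBase_leafBase.altForm_ite (hone (some none))
      (isBase_leafBase.altForm_ite (isBase_leafBase.cond_zero none)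
        (hlit (some (some i)) true d) (isBase_leafBase.altForm_ite (hone none)
        (isBase_leafBase.altForm_rename h2 fun i => some (some i)) h0))
      (isBase_leafBase.altForm_const zero_le_one d)), fun n hn x v => ?_⟩
  refine Eq.trans ?_ ((sum_prod_two hn (if (x (v i) ^^ false) = true then 1 else 0) (F n x v)
    (if (x (v i) ^^ true) = true then 1 else 0) (G n x v)).symm.trans
      (Finset.sum_congr rfl fun a _ => Finset.prod_congr rfl fun b _ => ?_))
  · cases hx : x (v i) <;> simp [hx]
  · simp only [ext]
    split_ifs <;> simp [*]

/-! ### Definable predicates are defined by formulae -/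

theorem FODef.exists_formula {α : Type} {P : StrPred α} (hP : FODef P) :
    ∃ φ : stringLang.Formula α, ∀ n, 0 < n → ∀ x v,
      @Language.Formula.Realize _ _ (stringStructure x) _ φ v ↔ P n x v := by
  induction hP with
  | le i j => exact ⟨.rel (.le : stringLang.Relations 2) ![.var (.inl i), .var (.inl j)],
      fun n _ x v => Iff.rfl⟩
  | bit i j => exact ⟨.rel (.bit : stringLang.Relations 2) ![.var (.inl i), .var (.inl j)],
      fun n _ x v => Iff.rfl⟩
  | one i => exact ⟨.rel (.one : stringLang.Relations 1) ![.var (.inl i)], fun n _ x v => Iff.rfl⟩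
  | fls => exact ⟨.falsum, fun n _ x v => Iff.rfl⟩
  | imp _ _ h₁ h₂ =>
    obtain ⟨φ, hφ⟩ := h₁
    obtain ⟨ψ, hψ⟩ := h₂
    exact ⟨φ.imp ψ, fun n hn x v => imp_congr (hφ n hn x v) (hψ n hn x v)⟩
  | @all α P _ h =>
    obtain ⟨φ, hφ⟩ := h
    refine ⟨(φ.relabel fun o : Option α => o.elim (Sum.inr ()) Sum.inl).iAlls Unit,
      fun n hn x v => ?_⟩
    let _ := stringStructure x
    rw [Language.Formula.realize_iAlls]
    have key : ∀ i : Unit → Fin n, (φ.relabel fun o : Option α =>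
        (o.elim (Sum.inr ()) Sum.inl : α ⊕ Unit)).Realize (fun a => Sum.elim v i a) ↔
        P n x (ext v (i ())) := by
      intro i
      rw [Language.Formula.realize_relabel, ← hφ n hn]
      refine iff_of_eq (congrArg _ (funext fun o => ?_))
      cases o <;> rfl
    simp only [key]
    exact ⟨fun h a => h fun _ => a, fun h i => h _⟩
  | congr _ h ih =>
    obtain ⟨φ, hφ⟩ := ih
    exact ⟨φ, fun n hn x v => (hφ n hn x v).trans (h n hn x v)⟩

/-! ### Circuits for alternating normal forms -/

/-- The position of a variable in the alternating prefix of sums and products. -/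
def varPos {d : ℕ} : Fin d ⊕ Fin d → ℕ
  | .inr s => 2 * s
  | .inl s => 2 * s + 1

theorem varPos_lt {d : ℕ} (i : Fin d ⊕ Fin d) : varPos i < 2 * d := by
  rcases i with s | s <;> simp only [varPos] <;> omega

theorem varPos_injective {d : ℕ} : Function.Injective (varPos (d := d)) := by
  rintro (s | s) (t | t) h <;> simp only [varPos] at h
  · exact congrArg _ (Fin.ext (by omega))
  · omega
  · omega
  · exact congrArg _ (Fin.ext (by omega))

/-- The mark of the gates at level `t` of the circuit for an alternating normal form. -/
def prefixKind {d n : ℕ} (κ : (Fin d ⊕ Fin d → Fin n) → GateKind n)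
    (g : Fin (2 * d + 1) × (Fin d ⊕ Fin d → Fin n)) : GateKind n :=
  if (g.1 : ℕ) = 2 * d then κ g.2 else if (g.1 : ℕ) % 2 = 0 then .or else .and

/-- The edges of the circuit for an alternating normal form: a gate at level `t` has the children
at level `t + 1` that arise by changing the variable at position `t`. -/
def prefixChild {d n : ℕ} (g h : Fin (2 * d + 1) × (Fin d ⊕ Fin d → Fin n)) : Prop :=
  (h.1 : ℕ) = g.1 + 1 ∧ ∀ i, varPos i ≠ g.1 → h.2 i = g.2 i

theorem prefixKind_inner_iff {d n : ℕ} {κ : (Fin d ⊕ Fin d → Fin n) → GateKind n}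
    (hκ : ∀ v, ¬ (κ v).Inner) (g : Fin (2 * d + 1) × (Fin d ⊕ Fin d → Fin n)) :
    (prefixKind κ g).Inner ↔ (g.1 : ℕ) ≠ 2 * d := by
  unfold prefixKind
  split_ifs with h1 h2
  · simp [h1, hκ]
  · simp [h1, GateKind.Inner]
  · simp [h1, GateKind.Inner]

/-- The circuit for an alternating normal form with `d` alternations and leaves `κ`. -/
def prefixCircuit (d n : ℕ) (hn : 0 < n) (κ : (Fin d ⊕ Fin d → Fin n) → GateKind n)
    (hκ : ∀ v, ¬ (κ v).Inner) : Circuit n where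
  Gate := Fin (2 * d + 1) × (Fin d ⊕ Fin d → Fin n)
  finite := inferInstance
  kind := prefixKind κ
  child := prefixChild
  -- The initial assignment is arbitrary: every variable is overwritten once on the way to a leaf.
  root := (0, fun _ => ⟨0, hn⟩)
  inner_iff g := by
    rw [prefixKind_inner_iff hκ]
    constructor
    · intro h
      exact ⟨(⟨g.1 + 1, by omega⟩, g.2), rfl, fun _ _ => rfl⟩
    · rintro ⟨h, h1, -⟩
      have := h.1.2
      omega
  acyclic g h := by
    have key : ∀ a b : Fin (2 * d + 1) × (Fin d ⊕ Fin d → Fin n),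
        Relation.TransGen prefixChild a b → (a.1 : ℕ) < b.1 := by
      intro a b h
      induction h with
      | single h => have := h.1; omega
      | tail _ h ih => have := h.1; omega
    exact lt_irrefl _ (key g g h)

section

variable {d n : ℕ} {hn : 0 < n} {κ : (Fin d ⊕ Fin d → Fin n) → GateKind n}
  {hκ : ∀ v, ¬ (κ v).Inner}

theorem prefixCircuit_depthLE : (prefixCircuit d n hn κ hκ).DepthLE (2 * d) := by
  have key : ∀ (p : List (Fin (2 * d + 1) × (Fin d ⊕ Fin d → Fin n))) (h : p ≠ []),
      p.IsChain prefixChild → (p.head h).1 + p.length ≤ 2 * d + 1 := by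
    intro p
    induction p with
    | nil => exact fun h => (h rfl).elim
    | cons a p ih =>
      intro _ hp
      cases p with
      | nil => have := a.1.2; simp; omega
      | cons b p =>
        obtain ⟨h1, h2⟩ := List.isChain_cons_cons.1 hp
        have h3 := ih (by simp) h2
        have h4 := h1.1
        simp only [List.head_cons, List.length_cons] at h3 ⊢
        omega
  intro p h h1 _ _
  exact (Nat.le_add_left _ _).trans (key p h h1)

theorem prefixCircuit_size_le : (prefixCircuit d n hn κ hκ).size ≤ (2 * d + 1) * n ^ (2 * d) := by
  have := (prefixCircuit d n hn κ hκ).finite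
  refine (Finite.card_subtype_le _).trans (le_of_eq ?_)
  change Nat.card (Fin (2 * d + 1) × (Fin d ⊕ Fin d → Fin n)) = _
  rw [Nat.card_prod, Nat.card_fun]
  simp [two_mul]

/-- The children of a gate are given by the values of a variable. -/
theorem children_bijective (g : Fin (2 * d + 1) × (Fin d ⊕ Fin d → Fin n)) (i : Fin d ⊕ Fin d)
    (hi : varPos i = g.1) : Function.Bijective fun a : Fin n =>
      (⟨(⟨g.1 + 1, by have := varPos_lt i; omega⟩, Function.update g.2 i a), rfl, fun j hj =>
        Function.update_of_ne (fun h => hj (by rw [h]; exact hi)) _ _⟩ : {c // prefixChild g c}) := by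
  constructor
  · intro a b h
    have := congrFun (congrArg (fun c : {c // prefixChild g c} => c.1.2) h) i
    simpa using this
  · rintro ⟨⟨t, v⟩, h1, h2⟩
    refine ⟨v i, Subtype.ext (Prod.ext (Fin.ext h1.symm) (funext fun j => ?_))⟩
    by_cases hj : j = i
    · subst hj
      simp
    · simp only [Function.update_of_ne hj]
      exact (h2 j fun h => hj (varPos_injective (h.trans hi.symm))).symm

variable {x : Fin n → Bool}

open Classical in
theorem treeCount_prefix_leaf (v : Fin d ⊕ Fin d → Fin n) :
    (prefixCircuit d n hn κ hκ).treeCount x (⟨2 * d, by omega⟩, v) =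
      if (κ v).LeafTrue x then 1 else 0 := by
  have e : (prefixCircuit d n hn κ hκ).kind (⟨2 * d, by omega⟩, v) = κ v := if_pos rfl
  exact (Circuit.treeCount_leaf _ x (by rw [e]; exact hκ v)).trans
    (ite_congr_decidable (by rw [e]))

theorem treeCount_prefix_sum (s : Fin d) (v : Fin d ⊕ Fin d → Fin n) :
    (prefixCircuit d n hn κ hκ).treeCount x (⟨2 * s, by omega⟩, v) =
      ∑ a, (prefixCircuit d n hn κ hκ).treeCount x
        (⟨2 * s + 1, by omega⟩, Function.update v (.inr s) a) := by
  classical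
  let _ : Fintype (prefixCircuit d n hn κ hκ).Gate :=
    inferInstanceAs (Fintype (Fin (2 * d + 1) × (Fin d ⊕ Fin d → Fin n)))
  have e : (prefixCircuit d n hn κ hκ).kind (⟨2 * s, by omega⟩, v) = .or :=
    (if_neg (by simp only; omega)).trans (if_pos (by simp only; omega))
  have hs : 2 * (s : ℕ) < 2 * d + 1 := by omega
  exact (Circuit.treeCount_or _ x e).trans (@Fintype.sum_bijective _ _ _ _ _ _ _
    (children_bijective (⟨2 * s, hs⟩, v) (.inr s) rfl) _
    (fun c => (prefixCircuit d n hn κ hκ).treeCount x c.1) fun a => rfl).symm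

theorem treeCount_prefix_prod (s : Fin d) (v : Fin d ⊕ Fin d → Fin n) :
    (prefixCircuit d n hn κ hκ).treeCount x (⟨2 * s + 1, by omega⟩, v) =
      ∏ a, (prefixCircuit d n hn κ hκ).treeCount x
        (⟨2 * (s + 1), by omega⟩, Function.update v (.inl s) a) := by
  classical
  let _ : Fintype (prefixCircuit d n hn κ hκ).Gate :=
    inferInstanceAs (Fintype (Fin (2 * d + 1) × (Fin d ⊕ Fin d → Fin n)))
  have e : (prefixCircuit d n hn κ hκ).kind (⟨2 * s + 1, by omega⟩, v) = .and :=
    (if_neg (by simp only; omega)).trans (if_neg (by simp only; omega))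
  have hs : 2 * (s : ℕ) + 1 < 2 * d + 1 := by omega
  exact (Circuit.treeCount_and _ x e).trans (@Fintype.prod_bijective _ _ _ _ _ _ _
    (children_bijective (⟨2 * s + 1, hs⟩, v) (.inl s) rfl) _
    (fun c => (prefixCircuit d n hn κ hκ).treeCount x c.1) fun a => rfl).symm

/-- The assignment that agrees with `v` on the first `s` variables of each kind, and that is given
by `ys` and `zs` on the other ones. -/
def mergeVal {s r : ℕ} (h : s + r = d) (v : Fin d ⊕ Fin d → Fin n) (ys zs : Fin r → Fin n) :
    Fin d ⊕ Fin d → Fin n :=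
  Sum.elim (fun j => if hj : (j : ℕ) < s then v (.inl j) else ys ⟨j - s, by omega⟩)
    fun j => if hj : (j : ℕ) < s then v (.inr j) else zs ⟨j - s, by omega⟩

theorem mergeVal_cons_aux {s r : ℕ} (h : s + (r + 1) = d) (w : Fin d → Fin n) (a : Fin n)
    (ys : Fin r → Fin n) (j : Fin d) :
    (if hj : (j : ℕ) < s then w j else
      (Fin.cons a ys : Fin (r + 1) → Fin n) ⟨j - s, by omega⟩) =
    if hj : (j : ℕ) < s + 1 then Function.update w ⟨s, by omega⟩ a j
      else ys ⟨j - (s + 1), by omega⟩ := by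
  rcases lt_trichotomy (j : ℕ) s with h1 | h1 | h1
  · rw [dif_pos h1, dif_pos (by omega), Function.update_of_ne]
    exact fun h => by simp [h] at h1
  · rw [dif_neg (by omega), dif_pos (by omega)]
    have e1 : j = ⟨s, by omega⟩ := Fin.ext h1
    have e2 : (⟨j - s, by omega⟩ : Fin (r + 1)) = 0 := Fin.ext (by simp; omega)
    rw [e2, Fin.cons_zero, e1, Function.update_self]
  · rw [dif_neg (by omega), dif_neg (by omega)]
    have e2 : (⟨j - s, by omega⟩ : Fin (r + 1)) = Fin.succ ⟨j - (s + 1), by omega⟩ :=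
      Fin.ext (by simp; omega)
    rw [e2, Fin.cons_succ]

theorem mergeVal_cons {s r : ℕ} (h : s + (r + 1) = d) (v : Fin d ⊕ Fin d → Fin n) (a b : Fin n)
    (ys zs : Fin r → Fin n) :
    mergeVal h v (Fin.cons b ys : Fin (r + 1) → Fin n) (Fin.cons a zs : Fin (r + 1) → Fin n) =
      mergeVal (s := s + 1) (by omega) (Function.update (Function.update v (.inr ⟨s, by omega⟩) a)
        (.inl ⟨s, by omega⟩) b) ys zs := by
  funext i
  rcases i with j | j
  · refine (mergeVal_cons_aux h (fun j => v (.inl j)) b ys j).trans ?_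
    refine dite_congr rfl (fun hj => ?_) fun _ => rfl
    by_cases e : j = ⟨s, by omega⟩
    · rw [e]; simp
    · rw [Function.update_of_ne e, Function.update_of_ne (by simpa using e),
        Function.update_of_ne (by simp)]
  · refine (mergeVal_cons_aux h (fun j => v (.inr j)) a zs j).trans ?_
    refine dite_congr rfl (fun hj => ?_) fun _ => rfl
    by_cases e : j = ⟨s, by omega⟩
    · rw [e]; simp
    · rw [Function.update_of_ne e, Function.update_of_ne (by simp),
        Function.update_of_ne (by simpa using e)]

-- At level `2 * s` the first `s` variables of each kind are decided. The remaining entries of `v`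
-- do not matter, and accordingly `mergeVal` ignores them.
open Classical in
theorem treeCount_prefixCircuit {s r : ℕ} (h : s + r = d) (v : Fin d ⊕ Fin d → Fin n) :
    (prefixCircuit d n hn κ hκ).treeCount x (⟨2 * s, by omega⟩, v) =
      altVal n r (fun _ => Fin n) fun ys zs =>
        if (κ (mergeVal h v ys zs)).LeafTrue x then 1 else 0 := by
  induction r generalizing s v with
  | zero =>
    have hs : s = d := by omega
    subst hs
    rw [treeCount_prefix_leaf, altVal]
    congr 3
    funext i
    rcases i with j | j <;> simp [mergeVal]
  | succ r ih =>
    rw [treeCount_prefix_sum ⟨s, by omega⟩ v]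
    refine Finset.sum_congr rfl fun a _ => ?_
    rw [treeCount_prefix_prod ⟨s, by omega⟩]
    refine Finset.prod_congr rfl fun b _ => ?_
    rw [ih (s := s + 1) (by omega)]
    simp only [mergeVal_cons]

open Classical in
theorem numProofTrees_prefixCircuit : (prefixCircuit d n hn κ hκ).numProofTrees x =
    altVal n d (fun _ => Fin n) fun ys zs =>
      if (κ (Sum.elim ys zs)).LeafTrue x then 1 else 0 := by
  refine (treeCount_prefixCircuit (s := 0) (Nat.zero_add d) fun _ => ⟨0, hn⟩).trans ?_
  congr 1

end

/-- A circuit that consists of a single leaf. -/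
def leafCircuit {n : ℕ} (s : GateKind n) (hs : ¬ s.Inner) : Circuit n where
  Gate := Unit
  finite := inferInstance
  kind _ := s
  child _ _ := False
  root := ()
  inner_iff _ := by simp [hs]
  acyclic _ h := by
    induction h with
    | single h => exact h
    | tail _ h _ => exact h

theorem leafCircuit_size {n : ℕ} (s : GateKind n) (hs : ¬ s.Inner) : (leafCircuit s hs).size = 0 := by
  have : IsEmpty {g : (leafCircuit s hs).Gate // ((leafCircuit s hs).kind g).Inner} :=
    ⟨fun g => hs g.2⟩
  exact Nat.card_of_isEmpty

theorem leafCircuit_depthLE {n : ℕ} (s : GateKind n) (hs : ¬ s.Inner) (d : ℕ) :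
    (leafCircuit s hs).DepthLE d := by
  intro p h h1 _ _
  rcases p with _ | ⟨a, _ | ⟨b, p⟩⟩
  · simp
  · simp
  · exact (List.isChain_cons_cons.1 h1).1.elim

open Classical in
theorem leafCircuit_numProofTrees {n : ℕ} (s : GateKind n) (hs : ¬ s.Inner) (x : Fin n → Bool) :
    (leafCircuit s hs).numProofTrees x = if s.LeafTrue x then 1 else 0 :=
  Circuit.treeCount_leaf (leafCircuit s hs) x hs

/-! ### Uniformity of the circuits -/

/-- Uniformity in terms of definable predicates, with gates named by tuples over a finite index
type. -/
theorem FOUniform.of_foDef {C : (n : ℕ) → Circuit n} {J : Type} [Fintype J]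
    {U A O B R : StrPred J} {E : StrPred (J ⊕ J)} (hU : FODef U) (hA : FODef A) (hO : FODef O)
    (hB : FODef B) (hR : FODef R) (hE : FODef E)
    (h : ∀ n, 0 < n → ∃ e : (C n).Gate ↪ (J → Fin n), ∀ x : Fin n → Bool,
      (∀ b, b ∈ Set.range e ↔ U n x b) ∧
      (∀ g g', (C n).child g g' ↔ E n x (Sum.elim (e g) (e g'))) ∧
      (∀ g, (C n).kind g = .and ↔ A n x (e g)) ∧ (∀ g, (C n).kind g = .or ↔ O n x (e g)) ∧
      (∀ g, ((C n).kind g).LeafTrue x ↔ B n x (e g)) ∧ ∀ g, g = (C n).root ↔ R n x (e g)) :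
    FOUniform C := by
  let ε := Fintype.equivFin J
  have unary : ∀ {P : StrPred J}, FODef P → ∃ φ : stringLang.Formula (Fin 1 × Fin (Fintype.card J)),
      ∀ n, 0 < n → ∀ x v, @Language.Formula.Realize _ _ (stringStructure x) _ φ v ↔
        P n x fun j => v (0, ε j) := fun hP => (hP.rename fun j => ((0 : Fin 1), ε j)).exists_formula
  obtain ⟨φU, hU⟩ := (hU.rename ε).exists_formula
  obtain ⟨φA, hA⟩ := unary hA
  obtain ⟨φO, hO⟩ := unary hO
  obtain ⟨φB, hB⟩ := unary hB
  obtain ⟨φR, hR⟩ := unary hR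
  obtain ⟨φE, hE⟩ := (hE.rename (Sum.elim (fun j => ((0 : Fin 2), ε j))
    fun j => ((1 : Fin 2), ε j))).exists_formula
  refine ⟨⟨Fintype.card J, φU, fun {_} S => match S with
    | .E => φE | .and => φA | .or => φO | .B => φB | .r => φR⟩, fun n hn => ?_⟩
  obtain ⟨e, he⟩ := h n hn
  refine ⟨e.trans (ε.arrowCongr (Equiv.refl (Fin n))).toEmbedding, fun x => ?_⟩
  obtain ⟨h1, h2, h3, h4, h5, h6⟩ := he x
  refine ⟨fun b => ?_, fun {a} S v => ?_⟩
  · rw [hU n hn, ← h1]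
    constructor
    · rintro ⟨g, rfl⟩
      exact ⟨g, funext fun j => by simp⟩
    · rintro ⟨g, hg⟩
      exact ⟨g, funext fun j => by simp [hg]⟩
  · have key : ∀ g : (C n).Gate, (fun j => e.trans
        (ε.arrowCongr (Equiv.refl (Fin n))).toEmbedding g (ε j)) = e g :=
      fun g => funext fun j => by simp
    cases S with
    | E =>
      refine (h2 (v 0) (v 1)).trans (Iff.trans (iff_of_eq (congrArg _ ?_)) (hE n hn x _).symm)
      funext j
      rcases j with j | j
      exacts [(congrFun (key (v 0)) j).symm, (congrFun (key (v 1)) j).symm]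
    | and =>
      refine (h3 (v 0)).trans (Iff.trans (iff_of_eq (congrArg _ ?_)) (hA n hn x _).symm)
      exact (key (v 0)).symm
    | or =>
      refine (h4 (v 0)).trans (Iff.trans (iff_of_eq (congrArg _ ?_)) (hO n hn x _).symm)
      exact (key (v 0)).symm
    | B =>
      refine (h5 (v 0)).trans (Iff.trans (iff_of_eq (congrArg _ ?_)) (hB n hn x _).symm)
      exact (key (v 0)).symm
    | r =>
      refine (h6 (v 0)).trans (Iff.trans (iff_of_eq (congrArg _ ?_)) (hR n hn x _).symm)
      exact (key (v 0)).symm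

/-- The name of a gate of the circuit for an alternating normal form. -/
def gateName {d n : ℕ} (g : Fin (2 * d + 1) × (Fin d ⊕ Fin d → Fin (n + 2))) :
    Fin (2 * d + 1) ⊕ (Fin d ⊕ Fin d) → Fin (n + 2) :=
  -- The level is coded by a unit vector, which requires two distinct positions.
  Sum.elim (fun j => if j = g.1 then 1 else 0) g.2

/-- The tuple names a gate at level `t`. -/
def IsLevel {d : ℕ} (t : Fin (2 * d + 1)) : StrPred (Fin (2 * d + 1) ⊕ (Fin d ⊕ Fin d)) :=
  fun _ _ v => ∀ j, (v (.inl j) : ℕ) = if j = t then 1 else 0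

theorem isLevel_gateName {d n : ℕ} (x : Fin (n + 2) → Bool)
    (g : Fin (2 * d + 1) × (Fin d ⊕ Fin d → Fin (n + 2))) (t : Fin (2 * d + 1)) :
    IsLevel t (n + 2) x (gateName g) ↔ g.1 = t := by
  constructor
  · intro h
    by_contra hne
    have := h g.1
    simp [gateName, hne] at this
  · rintro rfl j
    simp only [gateName, Sum.elim_inl]
    split_ifs <;> simp

theorem eq_gateName {d n : ℕ} {x : Fin (n + 2) → Bool} {t : Fin (2 * d + 1)}
    {b : Fin (2 * d + 1) ⊕ (Fin d ⊕ Fin d) → Fin (n + 2)} (h : IsLevel t (n + 2) x b) :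
    gateName (t, fun i => b (.inr i)) = b := by
  funext i
  rcases i with j | i
  · refine Fin.ext ?_
    rw [h j]
    simp only [gateName, Sum.elim_inl]
    split_ifs <;> simp
  · rfl

theorem gateName_injective {d n : ℕ} : Function.Injective (gateName (d := d) (n := n)) := by
  intro g g' h
  have h1 := (isLevel_gateName (fun _ => false) g' g.1).1
    (h ▸ (isLevel_gateName (fun _ => false) g g.1).2 rfl)
  exact Prod.ext h1.symm (funext fun i => congrFun h (.inr i))

theorem foDef_isLevel {d : ℕ} (t : Fin (2 * d + 1)) : FODef (IsLevel t) :=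
  FODef.allFinite fun _ => FODef.numeral _ _

/-- The circuits for an alternating normal form on inputs of length at least `2`, with special
treatment of inputs of length at most `1`. -/
def normalFormCircuit (d : ℕ) (κ₁ : GateKind 1) (h₁ : ¬ κ₁.Inner)
    (κ : ∀ n, (Fin d ⊕ Fin d → Fin n) → GateKind n) (hκ : ∀ n v, ¬ (κ n v).Inner) :
    (n : ℕ) → Circuit n
  | 0 => leafCircuit (.const false) (not_inner_const _)
  | 1 => leafCircuit κ₁ h₁
  | n + 2 => prefixCircuit d (n + 2) (Nat.succ_pos _) (κ (n + 2)) (hκ _)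

section

variable {d : ℕ} {κ₁ : GateKind 1} {h₁ : ¬ κ₁.Inner}
  {κ : ∀ n, (Fin d ⊕ Fin d → Fin n) → GateKind n} {hκ : ∀ n v, ¬ (κ n v).Inner}

/-- The number of levels is fixed, so marks and edges are finite disjunctions over levels or pairs
of levels. Length one is a separate disjunct, where the only tuple names the only gate. -/
theorem normalFormCircuit_foUniform (hdef : FODef fun n x v => (κ n v).LeafTrue x) :
    FOUniform (normalFormCircuit d κ₁ h₁ κ hκ) := by
  have hlong : ∀ {α : Type}, FODef (α := α) fun n _ _ => n ≠ 1 := (FODef.card_eq 1).not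
  have hinner : ∀ p : Fin (2 * d + 1) → Prop, FODef fun n x v =>
      n ≠ 1 ∧ ∃ t : {t // p t}, IsLevel t.1 n x v := fun p =>
    hlong.and (FODef.exFinite fun t => foDef_isLevel t.1)
  have hbit : ∀ {α : Type} (i : α) (q : Bool), FODef fun n x (v : α → Fin n) => x (v i) = q := by
    intro α i q
    cases q
    · exact (FODef.one i).not.congr fun n _ x v => by simp
    · exact FODef.one i
  refine FOUniform.of_foDef (J := Fin (2 * d + 1) ⊕ (Fin d ⊕ Fin d))
    (U := fun n x v => n = 1 ∨ ∃ t, IsLevel t n x v)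
    (A := fun n x v => n ≠ 1 ∧ ∃ t : {t : Fin (2 * d + 1) // (t : ℕ) ≠ 2 * d ∧ (t : ℕ) % 2 = 1},
      IsLevel t.1 n x v)
    (O := fun n x v => n ≠ 1 ∧ ∃ t : {t : Fin (2 * d + 1) // (t : ℕ) ≠ 2 * d ∧ (t : ℕ) % 2 = 0},
      IsLevel t.1 n x v)
    -- For `n = 1` the truth of the leaf `κ₁` depends on one bit, so the values `q` that make it
    -- true are enumerated.
    (B := fun n x v => (n = 1 ∧ ∃ q : {q // κ₁.LeafTrue fun _ => q}, ∃ a, x a = q.1) ∨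
      (n ≠ 1 ∧ IsLevel (Fin.last _) n x v ∧ (κ n fun i => v (.inr i)).LeafTrue x))
    (R := fun n x v => n = 1 ∨ (IsLevel 0 n x v ∧ ∀ i, (v (.inr i) : ℕ) = 0))
    (E := fun n x v => n ≠ 1 ∧ ∃ p : {p : Fin (2 * d + 1) × Fin (2 * d + 1) // (p.2 : ℕ) = p.1 + 1},
      IsLevel p.1.1 n x (fun i => v (.inl i)) ∧ IsLevel p.1.2 n x (fun i => v (.inr i)) ∧
      ∀ i : {i // varPos i ≠ p.1.1}, (v (.inr (.inr i.1)) : ℕ) = v (.inl (.inr i.1)))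
    ((FODef.card_eq 1).or (FODef.exFinite foDef_isLevel)) (hinner _) (hinner _)
    (((FODef.card_eq 1).and (FODef.exFinite fun q => FODef.ex₁ (hbit none q.1))).or
      (hlong.and ((foDef_isLevel _).and (hdef.rename _))))
    ((FODef.card_eq 1).or ((foDef_isLevel 0).and (FODef.allFinite fun i => FODef.zero _)))
    (hlong.and (FODef.exFinite fun p => ((foDef_isLevel p.1.1).rename _).and
      (((foDef_isLevel p.1.2).rename _).and (FODef.allFinite fun i => FODef.eq _ _)))) ?_
  rintro (_ | _ | n) hn
  · exact (lt_irrefl _ hn).elim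
  · refine ⟨⟨fun _ _ => 0, fun _ _ _ => rfl⟩, fun x => ⟨fun b => ?_, fun g g' => ?_, fun g => ?_,
      fun g => ?_, fun g => ?_, fun g => ?_⟩⟩
    · exact iff_of_true ⟨(), funext fun j => Subsingleton.elim (α := Fin 1) _ _⟩ (.inl rfl)
    · exact iff_of_false id fun h => h.1 rfl
    · exact iff_of_false (fun h => h₁ (.inl h)) fun h => h.1 rfl
    · exact iff_of_false (fun h => h₁ (.inr h)) fun h => h.1 rfl
    · have hx : ∀ a : Fin 1, x = fun _ => x a := fun a => funext fun b =>
        congrArg x (Subsingleton.elim (α := Fin 1) _ _)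
      change κ₁.LeafTrue x ↔ _
      constructor
      · intro h
        exact .inl ⟨rfl, ⟨x 0, (hx 0) ▸ h⟩, 0, rfl⟩
      · rintro (⟨-, q, a, h⟩ | h)
        · rw [hx a, show x a = q.1 from h]
          exact q.2
        · exact (h.1 rfl).elim
    · exact iff_of_true rfl (.inl rfl)
  · have hne : n + 1 + 1 ≠ 1 := by omega
    have hsplit : ∀ {p : Fin (2 * d + 1) × (Fin d ⊕ Fin d → Fin (n + 2)) → Prop}, (∀ g, p g) →
        ∀ g : (prefixCircuit d (n + 2) (Nat.succ_pos _) (κ (n + 2)) (hκ _)).Gate, p g := id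
    refine ⟨⟨gateName, gateName_injective⟩, fun x => ⟨fun b => ?_,
      hsplit fun g => hsplit fun g' => ?_, hsplit fun g => ?_, hsplit fun g => ?_,
      hsplit fun g => ?_, hsplit fun g => ?_⟩⟩
    · constructor
      · rintro ⟨g, rfl⟩
        exact .inr ⟨g.1, (isLevel_gateName x g _).2 rfl⟩
      · rintro (h | ⟨t, h⟩)
        · exact (hne h).elim
        · exact ⟨_, eq_gateName h⟩
    · change prefixChild g g' ↔ _ ∧ ∃ p : {p : Fin (2 * d + 1) × Fin (2 * d + 1) //
        (p.2 : ℕ) = p.1 + 1}, IsLevel p.1.1 (n + 2) x (gateName g) ∧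
        IsLevel p.1.2 (n + 2) x (gateName g') ∧ ∀ i : {i // varPos i ≠ p.1.1},
          (g'.2 i.1 : ℕ) = g.2 i.1
      simp only [isLevel_gateName]
      constructor
      · rintro ⟨h1, h2⟩
        exact ⟨hne, ⟨(g.1, g'.1), h1⟩, rfl, rfl, fun i => congrArg _ (h2 i.1 i.2)⟩
      · rintro ⟨-, ⟨⟨t, t'⟩, h1⟩, rfl, rfl, h2⟩
        exact ⟨h1, fun i hi => Fin.ext (h2 ⟨i, hi⟩)⟩
    · change prefixKind _ g = _ ↔ _ ∧ ∃ t : {t : Fin (2 * d + 1) // _}, IsLevel t.1 (n + 2) x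
        (gateName g)
      simp only [isLevel_gateName]
      unfold prefixKind
      split_ifs with h2 h3
      · refine iff_of_false (fun h => hκ _ _ (.inl h)) ?_
        rintro ⟨-, t, h⟩
        exact t.2.1 (h ▸ h2)
      · refine iff_of_false nofun ?_
        rintro ⟨-, t, h⟩
        have := t.2.2
        rw [← h] at this
        omega
      · exact iff_of_true rfl ⟨hne, ⟨g.1, h2, by omega⟩, rfl⟩
    · change prefixKind _ g = _ ↔ _ ∧ ∃ t : {t : Fin (2 * d + 1) // _}, IsLevel t.1 (n + 2) x
        (gateName g)
      simp only [isLevel_gateName]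
      unfold prefixKind
      split_ifs with h2 h3
      · refine iff_of_false (fun h => hκ _ _ (.inr h)) ?_
        rintro ⟨-, t, h⟩
        exact t.2.1 (h ▸ h2)
      · exact iff_of_true rfl ⟨hne, ⟨g.1, h2, h3⟩, rfl⟩
      · refine iff_of_false nofun ?_
        rintro ⟨-, t, h⟩
        exact h3 (h ▸ t.2.2)
    · change (prefixKind _ g).LeafTrue x ↔ _ ∨ (_ ∧ IsLevel (Fin.last _) (n + 2) x (gateName g) ∧
        (κ (n + 2) g.2).LeafTrue x)
      rw [isLevel_gateName]
      unfold prefixKind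
      have hl : g.1 = Fin.last (2 * d) ↔ (g.1 : ℕ) = 2 * d := Fin.ext_iff
      split_ifs with h2 h3
      · rw [hl]
        exact ⟨fun h => .inr ⟨hne, h2, h⟩, fun h => h.elim (fun h => (hne h.1).elim) fun h => h.2.2⟩
      · exact iff_of_false id (by rw [hl]; tauto)
      · exact iff_of_false id (by rw [hl]; tauto)
    · change g = (0, fun _ => (⟨0, Nat.succ_pos _⟩ : Fin (n + 2))) ↔ _ ∨ (IsLevel 0 (n + 2) x (gateName g) ∧
        ∀ i, (g.2 i : ℕ) = 0)
      rw [isLevel_gateName]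
      constructor
      · rintro rfl
        exact .inr ⟨rfl, fun i => rfl⟩
      · rintro (h | ⟨h2, h3⟩)
        · exact (hne h).elim
        · exact Prod.ext h2 (funext fun i => Fin.ext (h3 i))

theorem normalFormCircuit_size_le (n : ℕ) : (normalFormCircuit d κ₁ h₁ κ hκ n).size ≤
    (2 * d + 1) * n ^ (2 * d) := by
  rcases n with _ | _ | n
  · exact (leafCircuit_size (n := 0) _ (not_inner_const _)).le.trans (Nat.zero_le _)
  · exact (leafCircuit_size _ h₁).le.trans (Nat.zero_le _)
  · exact prefixCircuit_size_le (hκ := hκ _)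

theorem normalFormCircuit_depthLE (n : ℕ) :
    (normalFormCircuit d κ₁ h₁ κ hκ n).DepthLE (2 * d) := by
  rcases n with _ | _ | n
  · exact leafCircuit_depthLE (n := 0) _ (not_inner_const _) _
  · exact leafCircuit_depthLE _ h₁ _
  · exact prefixCircuit_depthLE (hκ := hκ _)

end

-- The four functions from one bit to `{0, 1}` are the two constants and the two literals.
open Classical in
theorem exists_leaf_one {g : (Fin 1 → Bool) → ℕ} (hg : ∀ x, g x ≤ 1) :
    ∃ κ : GateKind 1, ¬ κ.Inner ∧ ∀ x, g x = if κ.LeafTrue x then 1 else 0 := by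
  have hx : ∀ x : Fin 1 → Bool, x = (fun _ => false) ∨ x = fun _ => true := fun x =>
    (Bool.eq_false_or_eq_true (x 0)).symm.imp (fun h => funext fun i => by
      rw [Subsingleton.elim i 0, h]) fun h => funext fun i => by rw [Subsingleton.elim i 0, h]
  have h0 := hg fun _ => false
  have h1 := hg fun _ => true
  have hr : ∀ a, a ≤ 1 → a = 0 ∨ a = 1 := by omega
  rcases hr _ h0 with h0 | h0 <;> rcases hr _ h1 with h1 | h1
  · exact ⟨.const false, not_inner_const _, fun x => by
      rcases hx x with rfl | rfl <;> simp [GateKind.LeafTrue, h0, h1]⟩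
  · exact ⟨.lit 0 false, not_inner_lit _ _, fun x => by
      rcases hx x with rfl | rfl <;> simp [GateKind.LeafTrue, h0, h1]⟩
  · exact ⟨.lit 0 true, not_inner_lit _ _, fun x => by
      rcases hx x with rfl | rfl <;> simp [GateKind.LeafTrue, h0, h1]⟩
  · exact ⟨.const true, not_inner_const _, fun x => by
      rcases hx x with rfl | rfl <;> simp [GateKind.LeafTrue, h0, h1]⟩

/-- Functions given by arithmetic expressions belong to FO-uniform `#AC⁰`. -/
theorem Arith.mem_foUniformSharpACZero {F : StrFun Empty} (hF : Arith F) {f : Word → ℕ}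
    (hf : ∀ w : Word, f w = F w.1.length w.1.get Empty.elim) : f ∈ FOUniformSharpACZero := by
  classical
  obtain ⟨d, hd⟩ := hF.leafNormalForm
  obtain ⟨B, ⟨κ, h1, h2, h3⟩, h4⟩ := isBase_leafBase.flatten hd
  obtain ⟨κ₁, h5, h6⟩ := exists_leaf_one fun x => hF.le_one x Empty.elim
  let g : Empty ⊕ (Fin d ⊕ Fin d) → Fin d ⊕ Fin d := Sum.elim Empty.elim id
  refine ⟨normalFormCircuit d κ₁ h5 (fun n v => κ n fun i => v (g i)) fun n v => h1 n _,
    normalFormCircuit_foUniform (h2.rename g),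
    ⟨Polynomial.C (2 * d + 1) * Polynomial.X ^ (2 * d), fun n => ?_⟩,
    ⟨2 * d, normalFormCircuit_depthLE⟩, fun w => ?_⟩
  · refine normalFormCircuit_size_le n |>.trans (le_of_eq ?_)
    simp
  · rw [hf]
    obtain ⟨w, hw⟩ := w
    have hpos : 0 < w.length := List.length_pos_iff.2 hw
    dsimp only
    generalize w.get = x
    generalize w.length = n at hpos x
    rcases n with _ | _ | n
    · exact (lt_irrefl _ hpos).elim
    · exact (h6 x).trans (leafCircuit_numProofTrees κ₁ h5 x).symm
    · rw [h4 _ (by omega)]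
      refine Eq.trans ?_ (numProofTrees_prefixCircuit (hκ := fun v => h1 _ _)).symm
      congr 1
      funext ys zs
      rw [h3 _ (by omega)]
      refine ite_congr_decidable (iff_of_eq (congrArg (fun u => (κ _ u).LeafTrue x) ?_))
      funext i
      rcases i with i | i
      exacts [i.elim, rfl]

/-! ### Prefix formulae over encoded structures yield arithmetic expressions. -/

/-! ### Positions in the encoding of a structure -/

/-- The list `L` occurs in the sequence `β` from position `o` on. -/
def OccursAt (β : ℕ → Bool) (o : ℕ) (L : List Bool) : Prop :=
  ∀ k (h : k < L.length), L[k] = β (o + k)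

theorem occursAt_append {β : ℕ → Bool} {o : ℕ} {L M : List Bool} :
    OccursAt β o (L ++ M) ↔ OccursAt β o L ∧ OccursAt β (o + L.length) M := by
  constructor
  · refine fun h => ⟨fun k hk => ?_, fun k hk => ?_⟩
    · have := h k (by simp; omega)
      rwa [List.getElem_append_left hk] at this
    · have := h (L.length + k) (by simp; omega)
      rw [List.getElem_append_right (by omega)] at this
      simpa [add_assoc] using this
  · rintro ⟨h1, h2⟩ k hk
    by_cases hkL : k < L.length
    · rw [List.getElem_append_left hkL, h1]
    · rw [List.getElem_append_right (by omega), h2]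
      congr 1
      omega

theorem occursAt_flatMap_finRange {β : ℕ → Bool} {r : ℕ} (f : Fin r → List Bool) {o : ℕ} :
    OccursAt β o ((List.finRange r).flatMap f) ↔
      ∀ i, OccursAt β (o + ∑ k, if k < i then (f k).length else 0) (f i) := by
  induction r generalizing o with
  | zero => exact iff_of_true (fun k hk => by simp at hk) fun i => i.elim0
  | succ r ih =>
    rw [List.finRange_succ, List.flatMap_cons, List.flatMap_map, occursAt_append, ih,
      Fin.forall_fin_succ]
    simp [Fin.sum_univ_succ, add_assoc]

theorem sum_ite_lt {r : ℕ} (i : Fin r) (c : ℕ) : (∑ k, if k < i then c else 0) = i * c := by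
  rw [← Finset.sum_filter, Finset.sum_const, smul_eq_mul]
  congr 1
  rw [← Fin.card_Iio i]
  congr 1
  ext k
  simp

/-- The position of a tuple in the lexicographic order, where `c` is the position of a prefix. -/
def lexAcc (n : ℕ) : (a : ℕ) → ℕ → (Fin a → ℕ) → ℕ
  | 0, c, _ => c
  | a + 1, c, t => lexAcc n a (c * n + t 0) fun j => t j.succ

theorem lexAcc_eq (n : ℕ) {a : ℕ} (c : ℕ) (t : Fin a → ℕ) :
    lexAcc n a c t = c * n ^ a + lexAcc n a 0 t := by
  induction a generalizing c with
  | zero => simp [lexAcc]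
  | succ a ih =>
    rw [lexAcc, ih, lexAcc, ih (0 * n + t 0)]
    ring

theorem length_tuples (n a : ℕ) : (tuples n a).length = n ^ a := by
  induction a with
  | zero => rfl
  | succ a ih => simp [tuples, List.length_flatMap, ih, pow_succ, mul_comm]

theorem occursAt_map_tuples {β : ℕ → Bool} {n a o : ℕ} (R : (Fin a → Fin n) → Bool) :
    OccursAt β o ((tuples n a).map R) ↔ ∀ t, R t = β (o + lexAcc n a 0 fun j => t j) := by
  induction a generalizing o with
  | zero =>
    constructor
    · intro h t
      rw [Subsingleton.elim t Fin.elim0]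
      exact h 0 (by simp [tuples])
    · intro h k hk
      have hk0 : k = 0 := by simpa [tuples] using hk
      subst hk0
      exact h Fin.elim0
  | succ a ih =>
    rw [tuples, List.map_flatMap, occursAt_flatMap_finRange, Fin.forall_fin_succ_pi]
    simp only [List.map_map, List.length_map, length_tuples, sum_ite_lt]
    refine forall_congr' fun y => (ih (R ∘ fun t => Fin.cons y t)).trans ?_
    refine forall_congr' fun t => ?_
    rw [lexAcc, lexAcc_eq n (0 * n + _)]
    simp [add_assoc]

theorem occursAt_binary {β : ℕ → Bool} {o len v : ℕ} :
    OccursAt β o (binary len v) ↔ ∀ l e, l + e + 1 = len → v.testBit e = β (o + l) := by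
  have hlen : (binary len v).length = len := by simp [binary]
  have hget : ∀ l (h : l < (binary len v).length), (binary len v)[l] = v.testBit (len - 1 - l) := by
    intro l h
    simp [binary]
  constructor
  · intro h l e hle
    rw [← h l (by omega), hget]
    congr 1
    omega
  · intro h l hl
    rw [hget, h l (len - 1 - l) (by omega)]

/-- The length of the encoding of a structure with `n` elements. -/
def Vocabulary.encLen (σ : Vocabulary) (n : ℕ) : ℕ :=
  ∑ i, n ^ σ.arity i + σ.consts * Nat.clog 2 n

/-- The position of the truth table of a relation in the encoding. -/
def Vocabulary.relOffset (σ : Vocabulary) (n : ℕ) (i : Fin σ.rels) : ℕ :=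
  ∑ k, if k < i then n ^ σ.arity k else 0

/-- The position of the value of a constant in the encoding. -/
def Vocabulary.constOffset (σ : Vocabulary) (n : ℕ) (j : Fin σ.consts) : ℕ :=
  ∑ i, n ^ σ.arity i + j * Nat.clog 2 n

theorem Vocabulary.Struc.length_enc {σ : Vocabulary} {n : ℕ} (A : σ.Struc n) :
    A.enc.length = σ.encLen n := by
  have h : ∀ len v, (binary len v).length = len := by simp [binary]
  simp [enc, encLen, List.length_flatMap, length_tuples, h, List.sum_ofFn, ← List.ofFn_eq_map]

/-- The bit of a string at a position, with default value `0`. -/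
def bitAt {n : ℕ} (x : Fin n → Bool) (p : ℕ) : Bool := if h : p < n then x ⟨p, h⟩ else false

/-- Every bit of the encoding has a computable position. Constants are written with the most
significant digit first, so the digit of weight `2 ^ e` stands at offset `l` with `l + e + 1` equal
to the number of digits. -/
theorem Vocabulary.Struc.enc_eq_iff {σ : Vocabulary} {n : ℕ} (A : σ.Struc n) (w : List Bool) :
    A.enc = w ↔ σ.encLen n = w.length ∧
      (∀ i t, A.rel i t =
        bitAt w.get (σ.relOffset n i + lexAcc n (σ.arity i) 0 fun j => t j)) ∧
      ∀ j l e, l + e + 1 = Nat.clog 2 n →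
        (A.const j : ℕ).testBit e = bitAt w.get (σ.constOffset n j + l) := by
  have h1 : A.enc = w ↔ σ.encLen n = w.length ∧ OccursAt (bitAt w.get) 0 A.enc := by
    rw [← A.length_enc]
    constructor
    · rintro rfl
      exact ⟨rfl, fun k hk => by simp [bitAt, hk]⟩
    · rintro ⟨h1, h2⟩
      refine List.ext_getElem h1 fun k hk hk' => ?_
      rw [h2 k hk]
      simp [bitAt, hk']
  have h2 : ∀ len v, (binary len v).length = len := by simp [binary]
  have h3 : ((List.finRange σ.rels).flatMap fun i => (tuples n (σ.arity i)).map (A.rel i)).length =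
      ∑ i, n ^ σ.arity i := by
    simp [List.length_flatMap, length_tuples, List.sum_ofFn, ← List.ofFn_eq_map]
  rw [h1, enc, occursAt_append, occursAt_flatMap_finRange, occursAt_flatMap_finRange, h3]
  simp only [occursAt_map_tuples, occursAt_binary, List.length_map, length_tuples, h2, sum_ite_lt,
    Nat.zero_add]
  rfl

/-! ### Definable terms -/

/-- Numbers whose graph is definable. -/
def DefTerm {α : Type} (T : StrFun α) : Prop :=
  FODef fun n x (v : Option α → Fin n) => (v none : ℕ) = T n x fun i => v (some i)

namespace DefTerm

variable {α β : Type} {T S : StrFun α}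

theorem rename (hT : DefTerm T) (g : α → β) : DefTerm fun n x v => T n x fun i => v (g i) :=
  FODef.rename hT (Option.map g)

theorem var (i : α) : DefTerm fun _ _ v => (v i : ℕ) := FODef.eq none (some i)

theorem const (c : ℕ) : DefTerm (α := α) fun _ _ _ => c := FODef.numeral c none

theorem congr (hT : DefTerm T) (h : ∀ n x v, T n x v = S n x v) : DefTerm S :=
  FODef.congr hT fun n _ x v => by rw [h]

theorem bind (hT : DefTerm T) {P : StrPred (Option α)} (hP : FODef P) :
    FODef fun n x v => ∃ a : Fin n, (a : ℕ) = T n x v ∧ P n x (ext v a) :=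
  FODef.ex (hT.and hP)

/-- A definable term may exceed all positions; its graph is then empty. If the sum is a position, so
are the summands, and they can be quantified. -/
theorem add (hT : DefTerm T) (hS : DefTerm S) : DefTerm fun n x v => T n x v + S n x v := by
  refine (bind (hT.rename some) (bind (hS.rename fun i => some (some i))
    (FODef.add (some none) none (some (some none))))).congr fun n _ x v => ?_
  simp only [ext]
  constructor
  · rintro ⟨a, ha, b, hb, h⟩
    omega
  · intro h
    have := (v none).2
    exact ⟨⟨_, by omega⟩, rfl, ⟨S n x fun i => v (some i), by omega⟩, rfl, h.symm⟩

/-- The size of the encoded structure can equal the length of the string and need not be a position;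
it is represented by the largest element `v i`. As the factor is positive, the partial results do
not exceed the product. -/
theorem mulSucc (hT : DefTerm T) (i : α) : DefTerm fun n x v => T n x v * (v i + 1) := by
  refine (bind (hT.rename some) (FODef.ex ((FODef.mul (some none) (some (some (some i))) none).and
    (FODef.add none (some none) (some (some none)))))).congr fun n _ x v => ?_
  simp only [ext]
  constructor
  · rintro ⟨a, ha, b, hb, h⟩
    rw [mul_add, mul_one, ← ha, hb, h]
  · intro h
    rw [mul_add, mul_one] at h
    have := (v none).2
    exact ⟨⟨T n x fun i => v (some i), by omega⟩, rfl,
      ⟨(T n x fun i => v (some i)) * v (some i), by omega⟩, rfl, h.symm⟩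

theorem sum {ι : Type} (s : Finset ι) {T : ι → StrFun α} (hT : ∀ i, DefTerm (T i)) :
    DefTerm fun n x v => ∑ i ∈ s, T i n x v := by
  classical
  induction s using Finset.induction_on with
  | empty => exact (const 0).congr fun n x v => by simp
  | insert i s hi ih => exact ((hT i).add ih).congr fun n x v => by rw [Finset.sum_insert hi]

theorem constMul (c : ℕ) (hT : DefTerm T) : DefTerm fun n x v => c * T n x v :=
  (sum (Finset.range c) fun _ => hT).congr fun n x v => by simp

theorem pow (i : α) (a : ℕ) : DefTerm fun _ _ v => ((v i : ℕ) + 1) ^ a := by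
  induction a with
  | zero => exact (const 1).congr fun n x v => by simp
  | succ a ih => exact (ih.mulSucc i).congr fun n x v => by rw [pow_succ]

/-- Powers of the size can reach the length of the string, so `foDef_encLen` works with
predecessors. -/
theorem powPred (i : α) (a : ℕ) : DefTerm fun _ _ v => ((v i : ℕ) + 1) ^ a - 1 := by
  induction a with
  | zero => exact (const 0).congr fun n x v => by simp
  | succ a ih =>
    refine ((ih.mulSucc i).add (var i)).congr fun n x v => ?_
    have : 1 ≤ ((v i : ℕ) + 1) ^ a := Nat.one_le_pow _ _ (Nat.succ_pos _)
    obtain ⟨q, hq⟩ := Nat.exists_eq_add_of_le' this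
    rw [pow_succ, hq, Nat.add_sub_cancel]
    have : (q + 1) * ((v i : ℕ) + 1) = q * (v i + 1) + v i + 1 := by ring
    omega

/-- Horner's scheme: only additions and multiplications by the size occur. -/
theorem lexAcc (i : α) {a : ℕ} (hS : DefTerm S) {T : Fin a → StrFun α} (hT : ∀ j, DefTerm (T j)) :
    DefTerm fun n x v => CountFO.lexAcc (v i + 1) a (S n x v) fun j => T j n x v := by
  induction a generalizing S with
  | zero => exact hS
  | succ a ih => exact ih ((hS.mulSucc i).add (hT 0)) fun j => hT j.succ

theorem eq (hT : DefTerm T) (hS : DefTerm S) (h : ∀ n, 0 < n → ∀ x v, S n x v < n) :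
    FODef fun n x v => T n x v = S n x v := by
  refine (FODef.ex (FODef.and hT hS)).congr fun n hn x v => ?_
  simp only [ext]
  constructor
  · rintro ⟨a, h1, h2⟩
    exact h1.symm.trans h2
  · exact fun e => ⟨⟨_, h n hn x v⟩, e.symm, rfl⟩

theorem bitAt (hT : DefTerm T) : FODef fun n x v => CountFO.bitAt x (T n x v) = true := by
  refine (bind hT (FODef.one none)).congr fun n _ x v => ?_
  simp only [ext, CountFO.bitAt]
  constructor
  · rintro ⟨a, h1, h2⟩
    rw [← h1, dif_pos a.2]
    exact h2
  · intro h
    split_ifs at h with hlt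
    exact ⟨⟨_, hlt⟩, rfl, h⟩

theorem _root_.CountFO.clog_two_succ_le (m : ℕ) : Nat.clog 2 (m + 1) ≤ m :=
  Nat.clog_le_of_le_pow Nat.lt_two_pow_self

/-- This is the bit length of `v i`: a number lies below it exactly if `v i` has a nonzero bit at or
above that position. -/
theorem clog (i : α) : DefTerm fun _ _ v => Nat.clog 2 ((v i : ℕ) + 1) := by
  refine (FODef.all ((FODef.lt none (some none)).iff (FODef.ex ((FODef.le (some none) none).and
    (FODef.bit none (some (some (some i)))))))).congr fun n _ x v => ?_
  have key : ∀ a : Fin n, (∃ b : Fin n, (a : ℕ) ≤ b ∧ (v (some i) : ℕ).testBit b = true) ↔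
      (a : ℕ) < Nat.clog 2 (v (some i) + 1) := by
    intro a
    rw [Nat.lt_clog_iff_pow_lt one_lt_two, Nat.lt_succ_iff]
    constructor
    · rintro ⟨b, h1, h2⟩
      exact (Nat.pow_le_pow_right two_pos h1).trans (Nat.ge_two_pow_of_testBit h2)
    · intro h
      by_contra hne
      push Not at hne
      refine absurd (Nat.lt_pow_two_of_testBit (v (some i) : ℕ) fun b hb => ?_) (not_lt.2 h)
      by_contra hb'
      rw [Bool.not_eq_false] at hb'
      exact hne ⟨b, testBit_lt_card hb'⟩ hb hb'
  simp only [ext, key]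
  have h1 := (v none).2
  have h2 := (clog_two_succ_le (v (some i))).trans_lt (v (some i)).2
  constructor
  · intro h
    by_contra hne
    rcases lt_or_gt_of_ne hne with hlt | hlt
    · exact lt_irrefl _ ((h ⟨_, h1⟩).2 hlt)
    · exact lt_irrefl _ ((h ⟨_, h2⟩).1 hlt)
  · intro h a
    rw [h]

end DefTerm

/-! ### Definability of the encoding -/

section

variable {α : Type} (σ : Vocabulary) (i : α)

theorem defTerm_relOffset (r : Fin σ.rels) : DefTerm fun _ _ v => σ.relOffset (v i + 1) r :=
  DefTerm.sum _ fun k => by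
    by_cases h : k < r
    · exact (DefTerm.pow i (σ.arity k)).congr fun n x v => by simp [h]
    · exact (DefTerm.const 0).congr fun n x v => by simp [h]

theorem defTerm_constOffset (j : Fin σ.consts) : DefTerm fun _ _ v => σ.constOffset (v i + 1) j :=
  (DefTerm.sum _ fun k => DefTerm.pow i (σ.arity k)).add (DefTerm.constMul j (DefTerm.clog i))

/-- The length `n` is not a position, so `encLen - 1` is compared with the last position. One is
subtracted from each of the `σ.rels` powers and `σ.rels - 1` is added back. -/
theorem foDef_encLen (h : 0 < σ.rels) : FODef fun n _ v => σ.encLen (v i + 1) = n := by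
  refine (FODef.ex (FODef.and (((DefTerm.sum Finset.univ fun k => DefTerm.powPred i (σ.arity k)).add
    (DefTerm.const (σ.rels - 1))).add (DefTerm.constMul σ.consts (DefTerm.clog i)))
    (FODef.last none))).congr fun n _ x v => ?_
  have e : σ.encLen (v i + 1) = ∑ k, (((v i : ℕ) + 1) ^ σ.arity k - 1) + (σ.rels - 1) +
      σ.consts * Nat.clog 2 ((v i : ℕ) + 1) + 1 := by
    have : ∑ k, ((v i : ℕ) + 1) ^ σ.arity k = ∑ k, (((v i : ℕ) + 1) ^ σ.arity k - 1) + σ.rels := by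
      calc ∑ k, ((v i : ℕ) + 1) ^ σ.arity k
          = ∑ k, ((((v i : ℕ) + 1) ^ σ.arity k - 1) + 1) := Finset.sum_congr rfl fun k _ =>
            (Nat.sub_add_cancel (Nat.one_le_pow _ _ (Nat.succ_pos _))).symm
        _ = _ := by simp [Finset.sum_add_distrib]
    rw [Vocabulary.encLen, this]
    omega
  rw [e]
  simp only [ext]
  constructor
  · rintro ⟨a, h1, h2⟩
    omega
  · intro h
    exact ⟨⟨n - 1, by omega⟩, by simp only; omega, by simp only; omega⟩

/-- The string has the length of the encoding of a structure with `v i + 1` elements, and its final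
part encodes the constants `v (c j)`. -/
def EncodesConsts (c : Fin σ.consts → α) : StrPred α := fun n x v =>
  σ.encLen (v i + 1) = n ∧ ∀ j, (v (c j) : ℕ) ≤ v i ∧ ∀ l e, l + e + 1 = Nat.clog 2 (v i + 1) →
    (v (c j) : ℕ).testBit e = bitAt x (σ.constOffset (v i + 1) j + l)

theorem foDef_encodesConsts (h : 0 < σ.rels) (c : Fin σ.consts → α) :
    FODef (EncodesConsts σ i c) := by
  refine ((foDef_encLen σ i h).and (FODef.allFinite fun j => (FODef.le (c j) i).and
    (FODef.all (FODef.all ((DefTerm.eq ((((DefTerm.var (some none)).add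
      (DefTerm.var none)).add (DefTerm.const 1))) (DefTerm.clog (some (some i)))
      fun n _ x v => (clog_two_succ_le _).trans_lt (v _).2).imp
      ((FODef.bit none (some (some (c j)))).iff (((defTerm_constOffset σ (some (some i)) j).add
        (DefTerm.var (some none))).bitAt))))))).congr fun n _ x v => ?_
  refine and_congr_right fun _ => forall_congr' fun j => and_congr_right fun _ => ?_
  simp only [ext]
  have hc := (clog_two_succ_le (v i)).trans_lt (v i).2
  constructor
  · intro h l e hle
    exact Bool.eq_iff_iff.2 (h ⟨l, by omega⟩ ⟨e, by omega⟩ hle)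
  · intro h l e hle
    exact Bool.eq_iff_iff.1 (h l e hle)

end

/-! ### Definability of quantifier-free formulae over encoded structures -/

section

variable {σ : Vocabulary} {r : ℕ} {ar : Fin r → ℕ} {l k : ℕ} {α : Type}

/-- Variables that hold the largest element of a structure, its constants, the values of the free
and bound variables of a formula, and the values of its function variables. -/
structure EncodingVars (σ : Vocabulary) (r l k : ℕ) (α : Type) where
  top : α
  const : Fin σ.consts → α
  free : Fin l → α
  bound : Fin k → α
  fn : Fin r → α

/-- The structure `A` is encoded by the string `x`, and the assignment `v` holds the values of the
constants and variables, where function variables are applied to the first bound variables. -/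
structure EncodingVars.Matches (V : EncodingVars σ r l k α) {N : ℕ} (x : Fin N → Bool)
    (v : α → Fin N) {n : ℕ} (A : σ.Struc n) (F : (i : Fin r) → (Fin (ar i) → Fin n) → Fin n)
    (xs : Fin l → Fin n) (ys : Fin k → Fin n) : Prop where
  top : (v V.top : ℕ) + 1 = n
  rel : ∀ i t, A.rel i t = bitAt x (σ.relOffset n i + lexAcc n (σ.arity i) 0 fun j => t j)
  const : ∀ j, (A.const j : ℕ) = v (V.const j)
  free : ∀ i, (xs i : ℕ) = v (V.free i)
  bound : ∀ j, (ys j : ℕ) = v (V.bound j)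
  fn : ∀ i (h : ar i ≤ k), (F i fun j => ys ⟨j, j.2.trans_le h⟩ : ℕ) = v (V.fn i)

variable (V : EncodingVars σ r l k α)

/-- The restriction on arguments excludes nesting: under a fixed assignment each function variable
takes a single value, which one variable can hold. -/
theorem exists_defTerm {s : (σ.lang ar).Term (Fin l ⊕ Fin k)} (hs : TermRestricted s) :
    ∃ T : StrFun α, DefTerm T ∧ (∀ N, 0 < N → ∀ x v, T N x v < N) ∧
      ∀ {N : ℕ} (x : Fin N → Bool) (v : α → Fin N) {n : ℕ} [NeZero n] (A : σ.Struc n)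
        (F : (i : Fin r) → (Fin (ar i) → Fin n) → Fin n) (xs : Fin l → Fin n) (ys : Fin k → Fin n),
        V.Matches x v A F xs ys →
          ((@Language.Term.realize _ _ (A.expand F) _ (Sum.elim xs ys) s : Fin n) : ℕ) = T N x v := by
  cases s with
  | var i =>
    rcases i with i | i
    · exact ⟨_, DefTerm.var (V.free i), fun _ _ _ v => (v _).2, fun x v n _ A F xs ys h => h.free i⟩
    · exact ⟨_, DefTerm.var (V.bound i), fun _ _ _ v => (v _).2,
        fun x v n _ A F xs ys h => h.bound i⟩
  | func f ts =>
    cases f with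
    | min => exact ⟨_, DefTerm.const 0, fun _ h _ _ => h, fun x v n _ A F xs ys h => rfl⟩
    | const j => exact ⟨_, DefTerm.var (V.const j), fun _ _ _ v => (v _).2,
        fun x v n _ A F xs ys h => h.const j⟩
    | funVar i =>
      have hts : ∀ j : Fin (ar i), ∃ hj : (j : ℕ) < k, ts j = .var (Sum.inr ⟨j, hj⟩) := hs.1
      have hk : ar i ≤ k := by
        by_contra hlt
        obtain ⟨hj, -⟩ := hts ⟨k, not_le.1 hlt⟩
        exact lt_irrefl _ hj
      refine ⟨_, DefTerm.var (V.fn i), fun _ _ _ v => (v _).2, fun x v n _ A F xs ys h => ?_⟩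
      refine Eq.trans (congrArg (fun t => (F i t : ℕ)) (funext fun j => ?_)) (h.fn i hk)
      obtain ⟨hj, e⟩ := hts j
      rw [e]
      rfl

theorem exists_foDef {θ : (σ.lang ar).BoundedFormula (Fin l) k} (hθ : θ.IsQF)
    (hr : Restricted θ) : ∃ P : StrPred α, FODef P ∧
      ∀ {N : ℕ} (x : Fin N → Bool) (v : α → Fin N) {n : ℕ} [NeZero n] (A : σ.Struc n)
        (F : (i : Fin r) → (Fin (ar i) → Fin n) → Fin n) (xs : Fin l → Fin n) (ys : Fin k → Fin n),
        V.Matches x v A F xs ys →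
          (P N x v ↔ @Language.BoundedFormula.Realize _ _ (A.expand F) _ _ θ xs ys) := by
  induction hθ with
  | falsum => exact ⟨_, .fls, fun x v n _ A F xs ys h => Iff.rfl⟩
  | of_isAtomic ha =>
    cases ha with
    | equal s t =>
      obtain ⟨S, hS, -, hS'⟩ := exists_defTerm V hr.1
      obtain ⟨T, hT, hlt, hT'⟩ := exists_defTerm V hr.2
      refine ⟨_, hS.eq hT hlt, fun x v n _ A F xs ys h => ?_⟩
      rw [← hS' x v A F xs ys h, ← hT' x v A F xs ys h, ← Fin.ext_iff]
      rfl
    | rel R ts =>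
      have hts := fun j => exists_defTerm V (hr j)
      choose T hT hlt hT' using hts
      cases R with
      | le =>
        refine ⟨_, (hT 0).bind (((hT 1).rename some).bind (FODef.le (some none) none)),
          fun {N} x v n _ A F xs ys h => ?_⟩
        have hN := Fin.pos (v V.top)
        simp only [ext]
        refine Iff.trans ?_ (Fin.le_iff_val_le_val (a := @Language.Term.realize _ _ (A.expand F) _
          (Sum.elim xs ys) (ts 0))).symm
        rw [hT' 0 x v A F xs ys h]
        refine Iff.trans ?_ (iff_of_eq (congrArg _ (hT' 1 x v A F xs ys h))).symm
        constructor
        · rintro ⟨a, ha, b, hb, hab⟩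
          rwa [← ha, ← hb]
        · exact fun hab => ⟨⟨_, hlt 0 N hN x v⟩, rfl, ⟨_, hlt 1 N hN x v⟩, rfl, hab⟩
      | bit =>
        refine ⟨_, (hT 0).bind (((hT 1).rename some).bind (FODef.bit (some none) none)),
          fun {N} x v n _ A F xs ys h => ?_⟩
        have hN := Fin.pos (v V.top)
        simp only [ext]
        change _ ↔ Nat.testBit
          (@Language.Term.realize _ _ (A.expand F) _ (Sum.elim xs ys) (ts 1) : Fin n)
          (@Language.Term.realize _ _ (A.expand F) _ (Sum.elim xs ys) (ts 0) : Fin n) = true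
        rw [hT' 0 x v A F xs ys h, hT' 1 x v A F xs ys h]
        constructor
        · rintro ⟨a, ha, b, hb, hab⟩
          rwa [← ha, ← hb]
        · exact fun hab => ⟨⟨_, hlt 0 N hN x v⟩, rfl, ⟨_, hlt 1 N hN x v⟩, rfl, hab⟩
      | rel i =>
        refine ⟨_, ((defTerm_relOffset σ V.top i).add
          ((DefTerm.const 0).lexAcc V.top hT)).bitAt, fun x v n _ A F xs ys h => ?_⟩
        change _ ↔ A.rel i (fun j => @Language.Term.realize _ _ (A.expand F) _ (Sum.elim xs ys)
          (ts j)) = true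
        rw [h.rel, h.top]
        simp only [hT' _ x v A F xs ys h]
  | imp _ _ h₁ h₂ =>
    obtain ⟨P, hP, hP'⟩ := h₁ hr.1
    obtain ⟨Q, hQ, hQ'⟩ := h₂ hr.2
    exact ⟨_, hP.imp hQ, fun x v n _ A F xs ys h =>
      imp_congr (hP' x v A F xs ys h) (hQ' x v A F xs ys h)⟩

end

/-! ### Counting satisfying assignments by alternating sums and products -/

/-- Grouping function variables by their arity. -/
def groupByArity {r d : ℕ} (ar : Fin r → ℕ) (hd : ∀ i, ar i < d) (n : ℕ) :
    ((i : Fin r) → (Fin (ar i) → Fin n) → Fin n) ≃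
      ((a : Fin d) → (Fin a → Fin n) → ({i : Fin r // ar i = a} → Fin n)) where
  toFun f _ t i := f i.1 fun j => t (Fin.cast i.2 j)
  invFun f i t := f ⟨ar i, hd i⟩ t ⟨i, rfl⟩
  left_inv _ := rfl
  right_inv f := by
    funext ⟨a, ha⟩ t ⟨i, hi⟩
    dsimp only at hi
    subst hi
    rfl

-- Function variables of arity `a` are chosen together at level `a` of the alternation; a level may
-- hold several or none. Universal variables beyond `φ.univVars` are dummies that give every
-- function variable a level.
open Classical in
theorem RestrictedPiOne.count_eq {σ : Vocabulary} (φ : RestrictedPiOne σ) {n d : ℕ} [NeZero n]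
    (A : σ.Struc n) (hk : φ.univVars ≤ d) (hd : ∀ i, φ.funArity i < d)
    (P : (Fin φ.freeVars → Fin n) → (Fin d → Fin n) →
      ((a : Fin d) → {i // φ.funArity i = a} → Fin n) → Prop)
    (hP : ∀ F xs ys, P xs ys (fun a i => F i.1 fun j => ys ⟨j, j.2.trans (i.2.trans_lt a.2)⟩) ↔
      @Language.BoundedFormula.Realize _ _ (A.expand F) _ _ φ.matrix xs
        fun j => ys (Fin.castLE hk j)) :
    φ.count A = ∑ xs, altVal n d (fun a => {i // φ.funArity i = a} → Fin n) fun ys zs =>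
      if P xs ys zs then 1 else 0 := by
  let Q := fun (F : (i : Fin φ.funVars) → (Fin (φ.funArity i) → Fin n) → Fin n) xs =>
    @Language.Formula.Realize _ _ (A.expand F) _ φ.formula xs
  have e : {p : ((i : Fin φ.funVars) → (Fin (φ.funArity i) → Fin n) → Fin n) ×
      (Fin φ.freeVars → Fin n) // Q p.1 p.2} ≃ Σ xs, {F // Q F xs} :=
    ⟨fun p => ⟨p.1.2, p.1.1, p.2⟩, fun s => ⟨(s.2.1, s.1), s.2.2⟩, fun _ => rfl, fun _ => rfl⟩
  refine (Nat.card_congr e).trans (Nat.card_sigma.trans (Finset.sum_congr rfl fun xs _ => ?_))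
  rw [← card_skolem]
  refine Nat.card_congr ((groupByArity φ.funArity hd n).subtypeEquiv fun F => ?_)
  have h1 : Q F xs ↔ ∀ ys, @Language.BoundedFormula.Realize _ _ (A.expand F) _ _ φ.matrix xs ys :=
    @Language.BoundedFormula.realize_alls _ _ (A.expand F) _ _ _ _
  rw [h1]
  constructor
  · exact fun h ys => (hP F xs ys).2 (h _)
  · intro h ys
    -- The dummy universal variables receive the default value 0.
    have := (hP F xs fun j => if hj : (j : ℕ) < φ.univVars then ys ⟨j, hj⟩ else 0).1 (h _)
    simpa using this

theorem sum_tuple_le {N m : ℕ} (hm : m < N) {ι : Type} [Fintype ι] [DecidableEq ι]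
    [∀ z : ι → Fin N, Decidable (∀ i, (z i : ℕ) ≤ m)] (f : (ι → Fin N) → ℕ) :
    (∑ z : ι → Fin N, if ∀ i, (z i : ℕ) ≤ m then f z else 0) =
      ∑ z : ι → Fin (m + 1), f fun i => Fin.castLE hm (z i) := by
  symm
  refine Finset.sum_of_injOn (fun (z : ι → Fin (m + 1)) i => Fin.castLE hm (z i)) ?_
    (fun _ _ => Finset.mem_univ _) (fun z _ hz => if_neg fun h => hz ?_)
    fun z _ => (if_pos fun i => ?_).symm
  · intro z _ z' _ h
    exact funext fun i => Fin.castLE_injective hm (congrFun h i)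
  · exact ⟨fun i => ⟨z i, Nat.lt_succ_of_le (h i)⟩, Finset.mem_coe.2 (Finset.mem_univ _), rfl⟩
  · exact Nat.le_of_lt_succ (z i).2

theorem prod_le {N m : ℕ} (hm : m < N) [∀ y : Fin N, Decidable ((y : ℕ) ≤ m)] (f : Fin N → ℕ) :
    (∏ y : Fin N, if (y : ℕ) ≤ m then f y else 1) = ∏ y : Fin (m + 1), f (Fin.castLE hm y) := by
  refine (Finset.prod_of_injOn (Fin.castLE hm) (Fin.castLE_injective hm).injOn
    (fun _ _ => Finset.mem_univ _) (fun y _ hy => if_neg fun h => hy ?_) fun y _ =>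
      (if_pos (Nat.le_of_lt_succ y.2)).symm).symm
  exact ⟨⟨y, Nat.lt_succ_of_le h⟩, Finset.mem_coe.2 (Finset.mem_univ _), rfl⟩

/-- The regrouping of variables after splitting off the outermost sum and product. -/
def splitOuter {α : Type} {d : ℕ} {ι : ℕ → Type} :
    α ⊕ (Fin (d + 1) ⊕ Σ a : Fin (d + 1), ι a) →
      Option (α ⊕ ι 0) ⊕ (Fin d ⊕ Σ a : Fin d, ι (a + 1))
  | .inl i => .inl (some (.inl i))
  | .inr (.inl j) => Fin.cases (.inl none) (fun j => .inr (.inl j)) j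
  | .inr (.inr ⟨⟨0, _⟩, i⟩) => .inl (some (.inr i))
  | .inr (.inr ⟨⟨a + 1, h⟩, i⟩) => .inr (.inr ⟨⟨a, Nat.lt_of_succ_lt_succ h⟩, i⟩)

/-- Alternating sums and products over an initial segment of the positions. -/
theorem Arith.altVal {d : ℕ} {α : Type} (μ : α) {ι : ℕ → Type} [∀ a, Fintype (ι a)]
    [∀ a, DecidableEq (ι a)] {G : StrFun (α ⊕ (Fin d ⊕ Σ a : Fin d, ι a))} (hG : Arith G) :
    Arith fun N x v => CountFO.altVal (v μ + 1) d (fun a => ι a → Fin (v μ + 1)) fun ys zs =>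
      G N x (Sum.elim v (Sum.elim (fun j => Fin.castLE (v μ).2 (ys j))
        fun p => Fin.castLE (v μ).2 (zs p.1 p.2))) := by
  classical
  induction d generalizing α ι with
  | zero =>
    refine (hG.rename (Sum.elim id (Sum.elim (fun j => j.elim0) fun p => p.1.elim0))).congr
      fun N _ x v => congrArg (G N x) (funext fun i => ?_)
    rcases i with i | i | i
    exacts [rfl, i.elim0, i.1.elim0]
  | succ d ih =>
    have h1 := ih (some (.inl μ)) (ι := fun a => ι (a + 1)) (hG.rename splitOuter)
    -- Guards cut the range down to the initial segment up to `v μ`, with default 1 in the product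
    -- and 0 in the sum.
    have h2 := (Arith.ite (FODef.le none (some (.inl μ))) h1 one).prod
    refine (Arith.sumTuple (Arith.ite (FODef.allFinite fun i : ι 0 =>
      FODef.le (α := α ⊕ ι 0) (.inr i) (.inl μ)) h2 zero)).congr fun N _ x v => ?_
    refine (Finset.sum_congr rfl fun z _ => ite_congr_decidable Iff.rfl).trans
      ((sum_tuple_le (v μ).2 _).trans (Finset.sum_congr rfl fun z _ => ?_))
    refine (Finset.prod_congr rfl fun z _ => ite_congr_decidable Iff.rfl).trans
      ((prod_le (v μ).2 _).trans (Finset.prod_congr rfl fun b _ => ?_))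
    refine congrArg (CountFO.altVal _ _ _) (funext fun ys => funext fun zs => ?_)
    refine congrArg (G N x) (funext fun i => ?_)
    rcases i with i | j | ⟨⟨_ | a, ha⟩, i⟩
    · rfl
    · exact Fin.cases rfl (fun j => rfl) j
    · rfl
    · rfl

/-! ### Counting satisfying assignments in an encoded structure -/

/-- A relation of positive arity makes the size of the structure recoverable from the length of its
encoding. -/
theorem Vocabulary.encLen_strictMono {σ : Vocabulary} (h : ∃ i, 0 < σ.arity i) :
    StrictMono σ.encLen := by
  obtain ⟨i, hi⟩ := h
  intro m n hmn
  refine Nat.add_lt_add_of_lt_of_le (Finset.sum_lt_sum (fun k _ => Nat.pow_le_pow_left hmn.le _)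
    ⟨i, Finset.mem_univ _, Nat.pow_lt_pow_left hmn hi.ne'⟩)
    (Nat.mul_le_mul_left _ (Nat.clog_mono_right _ hmn.le))

open Classical in
/-- The number of satisfying assignments is an arithmetic expression in the encoding of the
structure, if the size and the constants of the structure are given. -/
theorem RestrictedPiOne.exists_arith {σ : Vocabulary} (φ : RestrictedPiOne σ) {α : Type} (μ : α)
    (c : Fin σ.consts → α) : ∃ F : StrFun α, Arith F ∧
      ∀ {N : ℕ} (x : Fin N → Bool) (v : α → Fin N) (A : σ.Struc (v μ + 1)),
        (∀ i t, A.rel i t = bitAt x (σ.relOffset (v μ + 1) i +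
          lexAcc (v μ + 1) (σ.arity i) 0 fun j => t j)) →
        (∀ j, (A.const j : ℕ) = v (c j)) → F N x v = φ.count A := by
  let d := φ.univVars + ∑ i, φ.funArity i + 1
  have hk : φ.univVars ≤ d := by omega
  have hd : ∀ i, φ.funArity i < d := fun i => by
    have := Finset.single_le_sum (fun i _ => Nat.zero_le (φ.funArity i)) (Finset.mem_univ i)
    omega
  let ι : ℕ → Type := fun a => {i : Fin φ.funVars // φ.funArity i = a}
  let V : EncodingVars σ φ.funVars φ.freeVars φ.univVars
      ((α ⊕ Fin φ.freeVars) ⊕ (Fin d ⊕ Σ a : Fin d, ι a)) :=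
    ⟨.inl (.inl μ), fun j => .inl (.inl (c j)), fun i => .inl (.inr i),
      fun j => .inr (.inl (Fin.castLE hk j)), fun i => .inr (.inr ⟨⟨_, hd i⟩, ⟨i, rfl⟩⟩)⟩
  obtain ⟨P, hP, hP'⟩ := exists_foDef V φ.isQF φ.restricted
  have h1 := Arith.altVal (α := α ⊕ Fin φ.freeVars) (.inl μ) (ι := ι)
    (Arith.ite hP Arith.one Arith.zero)
  have h2 := Arith.sumTuple (Arith.ite (FODef.allFinite fun i : Fin φ.freeVars =>
    FODef.le (α := α ⊕ Fin φ.freeVars) (.inr i) (.inl μ)) h1 Arith.zero)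
  refine ⟨_, h2, fun {N} x v A hrel hconst => ?_⟩
  refine (Finset.sum_congr rfl fun z _ => ite_congr_decidable Iff.rfl).trans
    ((sum_tuple_le (v μ).2 _).trans ?_)
  rw [φ.count_eq A hk hd (fun xs ys zs => P N x (Sum.elim
    (Sum.elim v fun i => Fin.castLE (v μ).2 (xs i))
    (Sum.elim (fun j => Fin.castLE (v μ).2 (ys j)) fun p => Fin.castLE (v μ).2 (zs p.1 p.2))))]
  · rfl
  · intro F xs ys
    exact hP' x _ A F xs _ ⟨rfl, hrel, hconst, fun i => rfl, fun j => rfl, fun i h => rfl⟩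

/-- Functions in `#Π₁^prefix` are given by arithmetic expressions. -/
theorem exists_arith_of_mem_sharpPiOnePrefix {g : Word → ℕ} (hg : g ∈ SharpPiOnePrefixClass) :
    ∃ F : StrFun Empty, Arith F ∧ ∀ w : Word, g w = F w.1.length w.1.get Empty.elim := by
  classical
  obtain ⟨σ, hσ, φ, h1, h2⟩ := hg
  obtain ⟨F, hF, hF'⟩ := φ.exists_arith (α := Option Empty ⊕ Fin σ.consts) (.inl none) .inr
  have hrels : 0 < σ.rels := hσ.elim fun i _ => i.pos
  have hmono := Vocabulary.encLen_strictMono hσ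
  have hle : ∀ n, n ≤ σ.encLen n := fun n => hmono.le_apply
  -- The sum ranges over candidates for the largest element and the constants. The guard accepts
  -- exactly one candidate if the word is an encoding and none otherwise.
  refine ⟨_, Arith.sum (Arith.sumTuple (Arith.ite (foDef_encodesConsts σ
    (.inl none : Option Empty ⊕ Fin σ.consts) hrels .inr) hF Arith.zero)), fun w => ?_⟩
  by_cases hw : ∃ (n : ℕ) (_ : NeZero n) (A : σ.Struc n), A.enc = w.1
  · obtain ⟨n, hn, A, hA⟩ := hw
    rw [h1 n A w hA]
    obtain ⟨h3, h4, h5⟩ := (A.enc_eq_iff w.1).1 hA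
    obtain ⟨m, rfl⟩ := Nat.exists_eq_succ_of_ne_zero hn.out
    have hm : m < w.1.length := h3 ▸ hle (m + 1)
    have hc : ∀ j, (A.const j : ℕ) < w.1.length := fun j =>
      (Nat.le_of_lt_succ (A.const j).2).trans_lt hm
    symm
    rw [Finset.sum_eq_single (⟨m, hm⟩ : Fin w.1.length) (fun m' _ hne => ?_) (by simp),
      Finset.sum_eq_single (fun j => (⟨A.const j, hc j⟩ : Fin w.1.length)) (fun c _ hne => ?_)
        (by simp)]
    · refine (if_pos ⟨h3, fun j => ⟨Nat.le_of_lt_succ (A.const j).2, h5 j⟩⟩).trans ?_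
      exact hF' w.1.get (Sum.elim (ext Empty.elim ⟨m, hm⟩) fun j => ⟨A.const j, hc j⟩) A h4
        fun j => rfl
    · refine if_neg fun h => hne (funext fun j => Fin.ext ?_)
      obtain ⟨h6, h7⟩ := h.2 j
      -- The encoding fixes only the first `clog` digits of a constant; the higher digits vanish
      -- because constants are below the size.
      have hp : ∀ a, a < m + 1 → ∀ e, Nat.clog 2 (m + 1) ≤ e → a.testBit e = false := fun a ha e he =>
        Nat.testBit_eq_false_of_lt (ha.trans_le ((Nat.le_pow_clog one_lt_two _).trans
          (Nat.pow_le_pow_right two_pos he)))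
      refine Nat.eq_of_testBit_eq fun e => ?_
      by_cases he : e < Nat.clog 2 (m + 1)
      · have hle : Nat.clog 2 (m + 1) - 1 - e + e + 1 = Nat.clog 2 (m + 1) := by omega
        exact (h7 _ e hle).trans (h5 j _ e hle).symm
      · exact (hp _ (Nat.lt_succ_of_le h6) e (not_lt.1 he)).trans
          (hp _ (A.const j).2 e (not_lt.1 he)).symm
    · refine Finset.sum_eq_zero fun c _ => if_neg fun h => hne (Fin.ext ?_)
      exact Nat.succ_injective (hmono.injective (h.1.trans h3.symm))
  · rw [h2 w hw]
    symm
    refine Finset.sum_eq_zero fun m _ => Finset.sum_eq_zero fun c _ => if_neg fun h => hw ?_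
    refine ⟨m + 1, inferInstance, ⟨fun i t => bitAt w.1.get (σ.relOffset (m + 1) i +
      lexAcc (m + 1) (σ.arity i) 0 fun j => t j), fun j => ⟨c j, Nat.lt_succ_of_le (h.2 j).1⟩⟩, ?_⟩
    exact (Vocabulary.Struc.enc_eq_iff _ _).2 ⟨h.1, fun _ _ => rfl, fun j => (h.2 j).2⟩

end CountFO

theorem mainTheorem3 :
    CountFO.FOUniformSharpACZero = CountFO.SharpPiOnePrefixClass := by
  refine Set.Subset.antisymm (fun f hf => ?_) fun g hg => ?_
  · obtain ⟨F, hF, h⟩ := CountFO.exists_arith_of_mem_foUniform hf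
    exact hF.mem_sharpPiOnePrefixClass h
  · obtain ⟨F, hF, h⟩ := CountFO.exists_arith_of_mem_sharpPiOnePrefix hg
    exact hF.mem_foUniformSharpACZero h
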